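/- Theorem 4.4. A planar doodle diagram is a connected 4-valent graph $M$ (loops and multiple edges allowed a priori) cellularly embedded in the sphere $S^2$; it gives a cell subdivision of $S^2$ whose vertices are the crossings, whose 1-cells are the edges, and whose 2-cells, the regions, are the components of the complement of the graph. The diagram is called super prime if its graph is 4-connected, that is, it has more than 4 vertices and is not disconnected by the removal of fewer than 4 vertices. For a region $R$, the inner complement $R^c$ is the union of all closed cells (vertices, edges and closures of regions) of the subdivision that are disjoint from the boundary of $R$. Let $M$ be a super prime doodle diagram and let $R$ be any of its regions. Then $R^c$ is a disk, i.e. it is homeomorphic to the closed unit disk in $\mathbb{R}^2$. -/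

import Mathlib

noncomputable section

/-- A connected planar doodle diagram: a connected 4-valent graph cellularly embedded in the
oriented sphere, given by its rotation system. `D` is the set of darts (edges with a direction),
`rot` sends a dart to the next one counterclockwise around its initial vertex, and `rev` reverses
a dart. The vertices (crossings), edges and regions are the cycles of `rot`, of `rev` and of
`rot * rev` (follow a dart to its end, then turn into the adjacent dart: this walks around a
region). The surface so described is the sphere exactly when the Euler characteristic is two. -/
structure DoodleDiagram (D : Type*) [Finite D] where
  /-- rotation about the initial vertex -/
  rot : Equiv.Perm D
  /-- reversal of darts -/
  rev : Equiv.Perm D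
  rev_rev : ∀ d, rev (rev d) = d
  rev_ne : ∀ d, rev d ≠ d
  four_valent : ∀ d, Function.minimalPeriod rot d = 4
  connected : MulAction.IsPretransitive (Subgroup.closure {rot, rev} : Subgroup (Equiv.Perm D)) D
  spherical :
    Nat.card (Quotient (Equiv.Perm.SameCycle.setoid rot)) +
        Nat.card (Quotient (Equiv.Perm.SameCycle.setoid (rot * rev))) =
      Nat.card (Quotient (Equiv.Perm.SameCycle.setoid rev)) + 2

/-- A simple graph is `k`-connected if it has more than `k` vertices and is not disconnected by
the removal of fewer than `k` vertices. -/
def SimpleGraph.IsKConnected {V : Type*} (G : SimpleGraph V) (k : ℕ) : Prop :=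
  k < Nat.card V ∧ ∀ S : Finset V, S.card < k → (G.induce {v | v ∉ S}).Connected

namespace DoodleDiagram

variable {D : Type*} [Finite D] (M : DoodleDiagram D)

/-- The crossings of the diagram. -/
def Vertex : Type _ := Quotient (Equiv.Perm.SameCycle.setoid M.rot)

/-- The edges of the diagram. -/
def Edge : Type _ := Quotient (Equiv.Perm.SameCycle.setoid M.rev)

/-- The regions of the diagram. -/
def Region : Type _ := Quotient (Equiv.Perm.SameCycle.setoid (M.rot * M.rev))

/-- The initial vertex of a dart. -/
def vertexOf (d : D) : M.Vertex := Quotient.mk _ d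

/-- The edge underlying a dart. -/
def edgeOf (d : D) : M.Edge := Quotient.mk _ d

/-- The region that lies on a fixed side (the same one for all darts) of a dart. -/
def regionOf (d : D) : M.Region := Quotient.mk _ d

/-- The graph of the diagram on its crossings (connectivity ignores loops and multiplicities). -/
def graph : SimpleGraph M.Vertex where
  Adj u v := u ≠ v ∧ ∃ d, M.vertexOf d = u ∧ M.vertexOf (M.rev d) = v
  symm := by
    constructor
    rintro u v ⟨h, d, hu, hv⟩
    exact ⟨h.symm, M.rev d, hv, by rw [M.rev_rev]; exact hu⟩
  loopless := ⟨fun _ h => h.1 rfl⟩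

/-- A diagram is super prime if its graph is 4-connected. -/
def IsSuperPrime : Prop := M.graph.IsKConnected 4

/-- The cells of the cell subdivision of the sphere defined by the diagram. -/
inductive Cell
  | vertex (v : M.Vertex)
  | edge (e : M.Edge)
  | region (R : M.Region)

namespace Cell

variable {M}

/-- The dimension of a cell. -/
def dim : M.Cell → ℕ
  | vertex _ => 0
  | edge _ => 1
  | region _ => 2

/-- The darts of a cell: those that start at a vertex, traverse an edge in one of its directions,
or run along the boundary of a region. -/
def darts : M.Cell → Set D
  | vertex v => {d | M.vertexOf d = v}
  | edge e => {d | M.edgeOf d = e}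
  | region R => {d | M.regionOf d = R}

/-- `c.IsFaceOf c'`: the cell `c` is contained in the closure of the cell `c'`. Each cell is
contained in its own closure; cells of equal dimension with a common dart are equal. -/
def IsFaceOf (c c' : M.Cell) : Prop :=
  c.dim ≤ c'.dim ∧ (c.darts ∩ c'.darts).Nonempty

end Cell

instance : Finite M.Vertex := Quotient.finite _
instance : Finite M.Edge := Quotient.finite _
instance : Finite M.Region := Quotient.finite _

instance : Finite M.Cell := by
  refine Finite.of_surjective
    (fun s : M.Vertex ⊕ M.Edge ⊕ M.Region =>
      Sum.elim Cell.vertex (Sum.elim Cell.edge Cell.region) s) ?_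
  rintro (v | e | R)
  · exact ⟨Sum.inl v, rfl⟩
  · exact ⟨Sum.inr (Sum.inl e), rfl⟩
  · exact ⟨Sum.inr (Sum.inr R), rfl⟩

instance : Fintype M.Cell := Fintype.ofFinite _

/-- The sphere as the underlying space of the cell subdivision defined by the diagram, through
barycentric coordinates in the barycentric subdivision: there is one barycentre for each cell, and
a point is a convex combination of the barycentres of a chain of cells, each in the closure of the
next. (This is the underlying space of every subdivision in which all closed cells are embedded
polygons, in particular of that given by a super prime diagram.) -/
def sphere : Set (M.Cell → ℝ) :=
  {x | x ∈ stdSimplex ℝ M.Cell ∧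
    ∀ c c', x c ≠ 0 → x c' ≠ 0 → c.IsFaceOf c' ∨ c'.IsFaceOf c}

/-- The closure of a cell, as a subset of the sphere. -/
def closedCell (c : M.Cell) : Set (M.Cell → ℝ) :=
  {x | x ∈ M.sphere ∧ ∀ c', x c' ≠ 0 → c'.IsFaceOf c}

/-- The boundary of a region, as a subset of the sphere: the union of the vertices and edges
in its closure. -/
def boundary (R : M.Region) : Set (M.Cell → ℝ) :=
  {x | x ∈ M.closedCell (Cell.region R) ∧ x (Cell.region R) = 0}

/-- The inner complement of a region `R`, as a subset of the sphere: the union of all closed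
cells (vertices, edges and regions) that have no contact with the boundary of `R`. -/
def innerComplement (R : M.Region) : Set (M.Cell → ℝ) :=
  ⋃ c ∈ {c : M.Cell | Disjoint (M.closedCell c) (M.boundary R)}, M.closedCell c

end DoodleDiagram

end

/-!
The barycentric subdivision of a super prime diagram is a triangulated sphere whose first homology
modulo two vanishes: by Euler's formula the sets of corners that have an even number of corners at
every vertex and in every region are exactly the coboundaries of the sets of edges. Hence every
simple closed edge path bounds a set of triangles, and this set is a disk, by induction on its size:
a chord or an ear of the path splits it into two smaller disks glued along an arc. It follows that a
strongly connected set of triangles with strongly connected complement is a disk.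

The inner complement of `R` is the union of the closed regions that do not touch `R`, so it remains
to walk between these regions, and between those that touch `R`, through common edges. The regions
that touch `R` are consecutive along its boundary. For the others, 4-connectedness makes the regions
at a vertex off `R` that do not touch `R` consecutive around this vertex, and shows that the
boundary of `R` does not separate the other vertices, so that one can pass from vertex to vertex.
-/

open Set Metric Function

section Disks

variable {E F : Type*}

/-- `X` is a closed disk with boundary circle `S`. As `X` is compact, a chart need only be a
continuous bijection onto the unit disk of `ℂ`. -/
structure IsDisk [TopologicalSpace E] (X S : Set E) : Prop where
  isCompact : IsCompact X
  subset : S ⊆ X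
  exists_chart : ∃ f : E → ℂ,
    ContinuousOn f X ∧ BijOn f X (closedBall 0 1) ∧ BijOn f S (sphere 0 1)

/-- `S` is an arc from `a` to `b`, with a chart that is a continuous bijection onto `[0, 1]`. -/
structure IsArc [TopologicalSpace E] (S : Set E) (a b : E) : Prop where
  isCompact : IsCompact S
  left_mem : a ∈ S
  right_mem : b ∈ S
  exists_chart : ∃ f : E → ℝ, ContinuousOn f S ∧ BijOn f S (Icc 0 1) ∧ f a = 0 ∧ f b = 1

section Glue

theorem bijOn_union_of_eqOn_inter {X₁ X₂ : Set E} {Y₁ Y₂ : Set F} {f : E → F}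
    (b₁ : BijOn f X₁ Y₁) (b₂ : BijOn f X₂ Y₂) (hY : Y₁ ∩ Y₂ ⊆ f '' (X₁ ∩ X₂)) :
    BijOn f (X₁ ∪ X₂) (Y₁ ∪ Y₂) := by
  have eq_of_mem : ∀ x ∈ X₁, ∀ y ∈ X₂, f x = f y → x = y := by
    intro x hx y hy hxy
    obtain ⟨z, ⟨hz₁, hz₂⟩, hz⟩ := hY ⟨b₁.mapsTo hx, hxy ▸ b₂.mapsTo hy⟩
    rw [← b₁.injOn hz₁ hx hz, b₂.injOn hz₂ hy (hz.trans hxy)]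
  refine b₁.union b₂ ?_
  rintro x (hx | hx) y (hy | hy) hxy
  · exact b₁.injOn hx hy hxy
  · exact eq_of_mem x hx y hy hxy
  · exact (eq_of_mem y hy x hx hxy.symm).symm
  · exact b₂.injOn hx hy hxy

variable [TopologicalSpace E] [TopologicalSpace F]

theorem continuousOn_invFunOn_of_isCompact [Nonempty E] [T2Space F] {X : Set E} {Y : Set F}
    {f : E → F} (hX : IsCompact X) (hf : ContinuousOn f X) (hb : BijOn f X Y) :
    ContinuousOn (invFunOn f X) Y := by
  rw [continuousOn_iff_isClosed]
  intro t ht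
  refine ⟨f '' (X ∩ t), ((hX.inter_right ht).image_of_continuousOn
    (hf.mono inter_subset_left)).isClosed, ?_⟩
  ext y
  constructor
  · rintro ⟨hy, hyY⟩
    have hy' := hb.surjOn hyY
    exact ⟨⟨_, ⟨invFunOn_mem hy', hy⟩, invFunOn_eq hy'⟩, hyY⟩
  · rintro ⟨⟨x, ⟨hxX, hxt⟩, rfl⟩, hyY⟩
    refine ⟨?_, hyY⟩
    rwa [mem_preimage, hb.injOn.leftInvOn_invFunOn hxX]

theorem exists_glue {X₁ X₂ : Set E} {Y₁ Y₂ : Set F} {f₁ f₂ : E → F}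
    (h₁ : IsClosed X₁) (h₂ : IsClosed X₂) (c₁ : ContinuousOn f₁ X₁) (c₂ : ContinuousOn f₂ X₂)
    (b₁ : BijOn f₁ X₁ Y₁) (b₂ : BijOn f₂ X₂ Y₂) (he : EqOn f₁ f₂ (X₁ ∩ X₂))
    (hY : Y₁ ∩ Y₂ ⊆ f₁ '' (X₁ ∩ X₂)) :
    ∃ f : E → F, ContinuousOn f (X₁ ∪ X₂) ∧ BijOn f (X₁ ∪ X₂) (Y₁ ∪ Y₂) ∧
      EqOn f f₁ X₁ ∧ EqOn f f₂ X₂ := by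
  classical
  have e₁ : EqOn (X₁.piecewise f₁ f₂) f₁ X₁ := piecewise_eqOn _ _ _
  have e₂ : EqOn (X₁.piecewise f₁ f₂) f₂ X₂ := by
    intro x hx
    by_cases h : x ∈ X₁
    · rw [e₁ h, he ⟨h, hx⟩]
    · exact piecewise_eq_of_notMem _ _ _ h
  refine ⟨X₁.piecewise f₁ f₂, (c₁.congr e₁).union_of_isClosed (c₂.congr e₂) h₁ h₂, ?_, e₁, e₂⟩
  refine bijOn_union_of_eqOn_inter (b₁.congr e₁.symm) (b₂.congr e₂.symm) ?_
  rwa [(e₁.mono inter_subset_left).image_eq]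

theorem IsArc.exists_param {S : Set E} {a b : E} (h : IsArc S a b) {p q : ℝ} (hpq : p < q) :
    ∃ φ : E → ℝ, ContinuousOn φ S ∧ BijOn φ S (Icc p q) ∧ φ a = p ∧ φ b = q := by
  obtain ⟨f, hf, hb, ha₀, hb₁⟩ := h.exists_chart
  have hpos : 0 < q - p := sub_pos.2 hpq
  have haffine : BijOn (fun t => (q - p) * t + p) (Icc 0 1) (Icc p q) := by
    have himage := image_affine_Icc' hpos p 0 1
    rw [mul_zero, zero_add, mul_one, sub_add_cancel] at himage
    rw [← himage]
    refine Injective.injOn (fun s t hst => ?_) |>.bijOn_image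
    exact mul_left_cancel₀ hpos.ne' (add_right_cancel hst)
  exact ⟨fun x => (q - p) * f x + p, by fun_prop, haffine.comp hb, by simp [ha₀], by simp [hb₁]⟩

theorem IsArc.trans [T2Space E] {S₁ S₂ : Set E} {a b c : E} (h₁ : IsArc S₁ a b)
    (h₂ : IsArc S₂ b c) (hi : S₁ ∩ S₂ = {b}) : IsArc (S₁ ∪ S₂) a c := by
  obtain ⟨f, hf, hfb, hfa, hfb'⟩ := h₁.exists_param (p := 0) (q := 1 / 2) (by norm_num)
  obtain ⟨g, hg, hgb, hgb', hgc⟩ := h₂.exists_param (p := 1 / 2) (q := 1) (by norm_num)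
  obtain ⟨k, hk, hkb, e₁, e₂⟩ := exists_glue h₁.isCompact.isClosed h₂.isCompact.isClosed hf hg
    hfb hgb (by rw [hi, eqOn_singleton, hfb', hgb']) (by
      rw [hi, image_singleton, hfb']
      exact fun t ht => le_antisymm ht.1.2 ht.2.1)
  rw [Icc_union_Icc_eq_Icc (by norm_num) (by norm_num)] at hkb
  exact ⟨h₁.isCompact.union h₂.isCompact, Or.inl h₁.left_mem, Or.inr h₂.right_mem, k, hk, hkb,
    (e₁ h₁.left_mem).trans hfa, (e₂ h₂.right_mem).trans hgc⟩

end Glue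

section Cone

variable [NormedAddCommGroup E] [NormedSpace ℝ E] [NormedAddCommGroup F] [NormedSpace ℝ F]
  {θ : E → F}

/-- The extension of a map of unit spheres to the unit balls which is linear on each radius. It
extends homeomorphisms between the boundaries of disks to the disks. -/
noncomputable def radialExtension (θ : E → F) (z : E) : F := ‖z‖ • θ (‖z‖⁻¹ • z)

theorem inv_norm_smul_mem_sphere {z : E} (hz : z ≠ 0) : ‖z‖⁻¹ • z ∈ sphere (0 : E) 1 := by
  rw [mem_sphere_zero_iff_norm, norm_smul, norm_inv, norm_norm,
    inv_mul_cancel₀ (norm_ne_zero_iff.2 hz)]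

theorem radialExtension_zero : radialExtension θ 0 = 0 := by simp [radialExtension]

theorem norm_radialExtension (hθ : MapsTo θ (sphere 0 1) (sphere 0 1)) (z : E) :
    ‖radialExtension θ z‖ = ‖z‖ := by
  rcases eq_or_ne z 0 with rfl | hz
  · rw [radialExtension_zero, norm_zero, norm_zero]
  · rw [radialExtension, norm_smul, norm_norm,
      mem_sphere_zero_iff_norm.1 (hθ (inv_norm_smul_mem_sphere hz)), mul_one]

theorem radialExtension_smul {r : ℝ} (hr : 0 ≤ r) {z : E} (hz : z ∈ sphere 0 1) :
    radialExtension θ (r • z) = r • θ z := by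
  rw [mem_sphere_zero_iff_norm] at hz
  rcases hr.eq_or_lt with rfl | hr
  · rw [zero_smul, zero_smul, radialExtension_zero]
  · rw [radialExtension, norm_smul, hz, mul_one, Real.norm_of_nonneg hr.le,
      inv_smul_smul₀ hr.ne']

theorem eqOn_radialExtension : EqOn (radialExtension θ) θ (sphere 0 1) := fun z hz => by
  simpa using radialExtension_smul (θ := θ) zero_le_one hz

theorem continuous_radialExtension (hc : ContinuousOn θ (sphere 0 1))
    (hθ : MapsTo θ (sphere 0 1) (sphere 0 1)) : Continuous (radialExtension θ) := by
  rw [continuous_iff_continuousAt]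
  intro z
  rcases eq_or_ne z 0 with rfl | hz
  · rw [ContinuousAt, radialExtension_zero, tendsto_zero_iff_norm_tendsto_zero]
    simpa only [norm_radialExtension hθ, norm_zero] using (continuous_norm (E := E)).tendsto 0
  · have hne : ∀ w ∈ {w : E | w ≠ 0}, ‖w‖ ≠ 0 := fun w hw => norm_ne_zero_iff.2 hw
    have hcont : ContinuousOn (radialExtension θ) {w | w ≠ 0} :=
      continuous_norm.continuousOn.smul (hc.comp
        ((continuous_norm.continuousOn.inv₀ hne).smul continuousOn_id)
        fun w hw => inv_norm_smul_mem_sphere hw)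
    exact hcont.continuousAt (isOpen_ne.mem_nhds hz)

theorem bijOn_radialExtension (hb : BijOn θ (sphere 0 1) (sphere 0 1)) :
    BijOn (radialExtension θ) (closedBall 0 1) (closedBall 0 1) := by
  have hnorm := norm_radialExtension hb.mapsTo
  refine ⟨fun z hz => ?_, fun z _ w _ hzw => ?_, fun w hw => ?_⟩
  · rwa [mem_closedBall_zero_iff, hnorm, ← mem_closedBall_zero_iff]
  · have hzw' : ‖z‖ = ‖w‖ := by rw [← hnorm z, hzw, hnorm]
    rcases eq_or_ne w 0 with rfl | hw
    · rwa [norm_zero, norm_eq_zero] at hzw'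
    have hw' : ‖w‖ ≠ 0 := norm_ne_zero_iff.2 hw
    have hz : z ≠ 0 := norm_ne_zero_iff.1 (hzw' ▸ hw')
    have hunit := hb.injOn (inv_norm_smul_mem_sphere hz) (inv_norm_smul_mem_sphere hw)
      (smul_right_injective F hw' (by simpa only [radialExtension, hzw'] using hzw))
    rw [hzw'] at hunit
    exact smul_right_injective E (inv_ne_zero hw') hunit
  · rcases eq_or_ne w 0 with rfl | hw₀
    · exact ⟨0, mem_closedBall_self zero_le_one, radialExtension_zero⟩
    obtain ⟨u, hu, huw⟩ := hb.surjOn (inv_norm_smul_mem_sphere hw₀)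
    have heq : radialExtension θ (‖w‖ • u) = w := by
      rw [radialExtension_smul (norm_nonneg w) hu, huw, smul_inv_smul₀ (norm_ne_zero_iff.2 hw₀)]
    refine ⟨‖w‖ • u, ?_, heq⟩
    rwa [mem_closedBall_zero_iff, ← hnorm, heq, ← mem_closedBall_zero_iff]

end Cone

section Extension

variable [TopologicalSpace E] [TopologicalSpace F]

theorem isDisk_of_convex {K : Set ℂ} (hc : Convex ℝ K) (hK : IsCompact K)
    (hne : (interior K).Nonempty) : IsDisk K (frontier K) := by
  obtain ⟨k, -, himage, hfrontier⟩ :=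
    exists_homeomorph_image_interior_closure_frontier_eq_unitBall hc hne hK.isBounded
  rw [hK.isClosed.closure_eq] at himage
  exact ⟨hK, hK.isClosed.frontier_subset, k, k.continuous.continuousOn,
    himage ▸ k.injective.injOn.bijOn_image, hfrontier ▸ k.injective.injOn.bijOn_image⟩

theorem IsDisk.of_bijOn {X S : Set E} {Y R : Set F} (hY : IsDisk Y R) (hX : IsCompact X)
    (hSX : S ⊆ X) {f : E → F} (hf : ContinuousOn f X) (hb : BijOn f X Y) (hbS : BijOn f S R) :
    IsDisk X S := by
  obtain ⟨k, hk, hkb, hkS⟩ := hY.exists_chart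
  exact ⟨hX, hSX, k ∘ f, hk.comp hf hb.mapsTo, hkb.comp hb, hkS.comp hbS⟩

theorem IsDisk.exists_extension {X S : Set E} {Y R : Set F} (hX : IsDisk X S) (hY : IsDisk Y R)
    {g : E → F} (hg : ContinuousOn g S) (hgb : BijOn g S R) :
    ∃ G : E → F, ContinuousOn G X ∧ BijOn G X Y ∧ EqOn G g S := by
  obtain ⟨f, hf, hfb, hfS⟩ := hX.exists_chart
  obtain ⟨k, hk, hkb, hkS⟩ := hY.exists_chart
  obtain ⟨x₀, -, -⟩ := hfb.surjOn (mem_closedBall_self zero_le_one)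
  have : Nonempty E := ⟨x₀⟩
  have : Nonempty F := ⟨g x₀⟩
  have hf' := continuousOn_invFunOn_of_isCompact hX.isCompact hf hfb
  have hk' := continuousOn_invFunOn_of_isCompact hY.isCompact hk hkb
  have hinv : InvOn (invFunOn f X) f X (closedBall 0 1) := hfb.invOn_invFunOn
  have hinvS : BijOn (invFunOn f X) (sphere 0 1) S :=
    BijOn.symm ⟨hinv.2.mono sphere_subset_closedBall, hinv.1.mono hX.subset⟩ hfS
  have hθb : BijOn (k ∘ g ∘ invFunOn f X) (sphere 0 1) (sphere 0 1) := hkS.comp (hgb.comp hinvS)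
  have hθ : ContinuousOn (k ∘ g ∘ invFunOn f X) (sphere 0 1) :=
    hk.comp (hg.comp (hf'.mono sphere_subset_closedBall) hinvS.mapsTo)
      ((hgb.comp hinvS).mapsTo.mono_right hY.subset)
  have hΘb := bijOn_radialExtension hθb
  have hkinv : BijOn (invFunOn k Y) (closedBall 0 1) Y := BijOn.symm hkb.invOn_invFunOn.symm hkb
  refine ⟨invFunOn k Y ∘ radialExtension (k ∘ g ∘ invFunOn f X) ∘ f,
    hk'.comp ((continuous_radialExtension hθ hθb.mapsTo).comp_continuousOn hf)
      (hΘb.comp hfb).mapsTo, hkinv.comp (hΘb.comp hfb), fun x hx => ?_⟩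
  rw [comp_apply, comp_apply, eqOn_radialExtension (hfS.mapsTo hx), comp_apply, comp_apply,
    hinv.1 (hX.subset hx), hkb.injOn.leftInvOn_invFunOn (hY.subset (hgb.mapsTo hx))]

theorem IsDisk.nonempty_homeomorph {X S : Set E} (h : IsDisk X S) :
    Nonempty (X ≃ₜ closedBall (0 : EuclideanSpace ℝ (Fin 2)) 1) := by
  obtain ⟨f, hf, hb, -⟩ := h.exists_chart
  have : CompactSpace X := isCompact_iff_compactSpace.1 h.isCompact
  have hcont : Continuous (hb.equiv f) :=
    (continuousOn_iff_continuous_domRestrict.1 hf).subtype_mk _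
  let e : X ≃ₜ closedBall (0 : ℂ) 1 := hcont.homeoOfEquivCompactToT2
  exact ⟨e.trans (Complex.orthonormalBasisOneI.repr.toHomeomorph.subtype fun z => by simp)⟩

end Extension

section HalfDisks

open scoped ComplexConjugate

/-- The upper half of the closed unit disk, the model for either of two disks that are glued along
an arc. The arc is the diameter. -/
def upperHalfDisk : Set ℂ := closedBall 0 1 ∩ {z | 0 ≤ z.im}

/-- The upper half of the unit circle, the part of the boundary of the upper half disk off the
gluing arc. -/
def upperHalfCircle : Set ℂ := sphere 0 1 ∩ {z | 0 ≤ z.im}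

/-- The horizontal diameter of the unit disk, the model for an arc along which disks are glued. -/
def diameter : Set ℂ := closedBall 0 1 ∩ {z | z.im = 0}

theorem frontier_upperHalfDisk : frontier upperHalfDisk = diameter ∪ upperHalfCircle := by
  have hclosed : IsClosed upperHalfDisk :=
    isClosed_closedBall.inter (isClosed_le continuous_const Complex.continuous_im)
  rw [hclosed.frontier_eq, upperHalfDisk, interior_inter, Complex.interior_setOfPred_le_im,
    interior_closedBall _ one_ne_zero]
  ext z
  simp only [diameter, upperHalfCircle, mem_sdiff, mem_inter_iff, mem_union,
    mem_closedBall_zero_iff, mem_ball_zero_iff, mem_sphere_zero_iff_norm, mem_ofPred_eq]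
  grind

theorem isDisk_upperHalfDisk : IsDisk upperHalfDisk (diameter ∪ upperHalfCircle) := by
  rw [← frontier_upperHalfDisk]
  refine isDisk_of_convex ((convex_closedBall _ _).inter (convex_halfSpace_im_ge 0))
    ((isCompact_closedBall _ _).inter_right
      (isClosed_le continuous_const Complex.continuous_im)) ⟨(1 / 2 : ℝ) * Complex.I, ?_⟩
  rw [upperHalfDisk, interior_inter, Complex.interior_setOfPred_le_im,
    interior_closedBall _ one_ne_zero]
  refine ⟨?_, ?_⟩ <;> norm_num

theorem bijOn_ofReal_diameter : BijOn (fun t : ℝ => (t : ℂ)) (Icc (-1) 1) diameter := by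
  refine ⟨fun t ht => ⟨by simpa using abs_le.2 ht, Complex.ofReal_im t⟩,
    Complex.ofReal_injective.injOn, fun z ⟨hz, hz₀⟩ => ?_⟩
  have hre : (z.re : ℂ) = z := Complex.ext rfl (by simpa using hz₀.symm)
  refine ⟨z.re, ?_, hre⟩
  rw [← hre] at hz
  simpa [abs_le] using hz

theorem bijOn_upperHalfCircle :
    BijOn (fun t : ℝ => (t : ℂ) + (√(1 - t ^ 2) : ℝ) * Complex.I) (Icc (-1) 1)
      upperHalfCircle := by
  have hre (t : ℝ) : ((t : ℂ) + (√(1 - t ^ 2) : ℝ) * Complex.I).re = t := by simp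
  have him (t : ℝ) : ((t : ℂ) + (√(1 - t ^ 2) : ℝ) * Complex.I).im = √(1 - t ^ 2) := by simp
  refine ⟨fun t ⟨ht₁, ht₂⟩ => ⟨?_, ?_⟩, fun s _ t _ hst => ?_, fun z ⟨hz, hz₀⟩ => ?_⟩
  · have hsq : 0 ≤ 1 - t ^ 2 := by nlinarith
    rw [mem_sphere_zero_iff_norm, Complex.norm_def, Complex.normSq_apply, hre, him,
      Real.mul_self_sqrt hsq, Real.sqrt_eq_one]
    ring
  · rw [mem_ofPred_eq, him]
    exact Real.sqrt_nonneg _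
  · rw [← hre s, ← hre t]
    exact congrArg Complex.re hst
  · rw [mem_sphere_zero_iff_norm, Complex.norm_def, Real.sqrt_eq_one, Complex.normSq_apply] at hz
    refine ⟨z.re, ⟨by nlinarith [mul_self_nonneg z.im], by nlinarith [mul_self_nonneg z.im]⟩,
      Complex.ext (hre _) ?_⟩
    rw [him, show 1 - z.re ^ 2 = z.im ^ 2 by linarith, Real.sqrt_sq hz₀]

theorem diameter_inter_upperHalfCircle_subset : diameter ∩ upperHalfCircle ⊆ {-1, 1} := by
  rintro z ⟨⟨-, him⟩, ⟨hnorm, -⟩⟩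
  have hre : (z.re : ℂ) = z := Complex.ext rfl (by simpa using him.symm)
  rw [← hre, mem_sphere_zero_iff_norm, Complex.norm_real, Real.norm_eq_abs,
    abs_eq zero_le_one] at hnorm
  rw [← hre]
  rcases hnorm with h | h <;> simp [h]

theorem upperHalfDisk_union_conj : upperHalfDisk ∪ conj '' upperHalfDisk = closedBall 0 1 := by
  ext z
  simp only [upperHalfDisk, mem_union, mem_inter_iff, mem_closedBall_zero_iff, mem_ofPred_eq,
    image_eq_preimage_of_inverse Complex.conj_conj Complex.conj_conj, mem_preimage,
    Complex.norm_conj, Complex.conj_im]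
  grind

theorem upperHalfCircle_union_conj : upperHalfCircle ∪ conj '' upperHalfCircle = sphere 0 1 := by
  ext z
  simp only [upperHalfCircle, mem_union, mem_inter_iff, mem_sphere_zero_iff_norm, mem_ofPred_eq,
    image_eq_preimage_of_inverse Complex.conj_conj Complex.conj_conj, mem_preimage,
    Complex.norm_conj, Complex.conj_im]
  grind

theorem upperHalfDisk_inter_conj : upperHalfDisk ∩ conj '' upperHalfDisk ⊆ diameter := by
  rintro _ ⟨⟨hz, him⟩, w, ⟨-, hwim⟩, rfl⟩
  rw [mem_ofPred_eq, Complex.conj_im] at him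
  exact ⟨hz, le_antisymm (by simpa using hwim) (by simpa using him)⟩

end HalfDisks

section Union

open scoped ComplexConjugate

variable [TopologicalSpace E] [T2Space E] {X X₁ X₂ S₀ S₁ S₂ : Set E} {a b : E}

theorem IsDisk.exists_upperHalfDisk (h : IsDisk X (S₀ ∪ S₁)) (h₀ : IsCompact S₀)
    (h₁ : IsArc S₁ a b) (hi : S₀ ∩ S₁ = {a, b}) {φ : E → ℝ} (hφ : ContinuousOn φ S₀)
    (hφb : BijOn φ S₀ (Icc (-1) 1)) (ha : φ a = -1) (hb : φ b = 1) :
    ∃ G : E → ℂ, ContinuousOn G X ∧ BijOn G X upperHalfDisk ∧ EqOn G (fun x => (φ x : ℂ)) S₀ ∧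
      BijOn G S₁ upperHalfCircle := by
  obtain ⟨ψ, hψ, hψb, hψa, hψb'⟩ := h₁.exists_param (p := -1) (q := 1) (by norm_num)
  have hb₁ := bijOn_upperHalfCircle.comp hψb
  obtain ⟨g, hg, hgb, e₀, e₁⟩ := exists_glue h₀.isClosed h₁.isCompact.isClosed (by fun_prop)
    (Continuous.comp_continuousOn (by fun_prop) hψ) (bijOn_ofReal_diameter.comp hφb) hb₁
    (by
      rw [hi]
      rintro x (rfl | rfl)
      · simp [hψa, ha]
      · simp [hψb', hb])
    (by
      rw [hi, image_pair]
      simpa [ha, hb] using diameter_inter_upperHalfCircle_subset)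
  obtain ⟨G, hG, hGb, hGe⟩ := h.exists_extension isDisk_upperHalfDisk hg hgb
  exact ⟨G, hG, hGb, (hGe.mono subset_union_left).trans e₀,
    hb₁.congr ((hGe.mono subset_union_right).trans e₁).symm⟩

theorem IsDisk.union (h₁ : IsDisk X₁ (S₀ ∪ S₁)) (h₂ : IsDisk X₂ (S₀ ∪ S₂))
    (a₀ : IsArc S₀ a b) (a₁ : IsArc S₁ a b) (a₂ : IsArc S₂ a b)
    (i₁ : S₀ ∩ S₁ = {a, b}) (i₂ : S₀ ∩ S₂ = {a, b}) (hi : X₁ ∩ X₂ = S₀) :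
    IsDisk (X₁ ∪ X₂) (S₁ ∪ S₂) := by
  obtain ⟨φ, hφ, hφb, ha, hb⟩ := a₀.exists_param (p := -1) (q := 1) (by norm_num)
  obtain ⟨G₁, hG₁, hb₁, e₁, s₁⟩ := h₁.exists_upperHalfDisk a₀.isCompact a₁ i₁ hφ hφb ha hb
  obtain ⟨G₂, hG₂, hb₂, e₂, s₂⟩ := h₂.exists_upperHalfDisk a₀.isCompact a₂ i₂ hφ hφb ha hb
  have hconj (X : Set ℂ) : BijOn conj X (conj '' X) :=
    (starRingEnd ℂ).injective.injOn.bijOn_image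
  have e₁₂ : EqOn G₁ (conj ∘ G₂) S₀ := fun x hx => by
    rw [comp_apply, e₁ hx, e₂ hx, Complex.conj_ofReal]
  obtain ⟨G, hG, hGb, E₁, E₂⟩ := exists_glue h₁.isCompact.isClosed h₂.isCompact.isClosed hG₁
    (Complex.continuous_conj.comp_continuousOn hG₂) hb₁ ((hconj _).comp hb₂) (hi ▸ e₁₂) (by
      rw [hi, e₁.image_eq]
      exact upperHalfDisk_inter_conj.trans (bijOn_ofReal_diameter.comp hφb).surjOn)
  have u₁ : S₁ ⊆ X₁ := subset_union_right.trans h₁.subset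
  have u₂ : S₂ ⊆ X₂ := subset_union_right.trans h₂.subset
  refine ⟨h₁.isCompact.union h₂.isCompact, union_subset_union u₁ u₂, G, hG,
    upperHalfDisk_union_conj ▸ hGb, upperHalfCircle_union_conj ▸ ?_⟩
  exact (s₁.congr (E₁.mono u₁).symm).union (((hconj _).comp s₂).congr (E₂.mono u₂).symm)
    (hGb.injOn.mono (union_subset_union u₁ u₂))

end Union

end Disks

section Realization

variable {V S : Type*} [Fintype V] [SetLike S V]

/-- The geometric realization of a family of simplices with vertices in `V`, in barycentric
coordinates. A simplex is any finite set of vertices; edges are also given as elements of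
`Sym2 V`. -/
def realization (𝓕 : Set S) : Set (V → ℝ) :=
  {p | p ∈ stdSimplex ℝ V ∧ ∃ t ∈ 𝓕, ∀ c, p c ≠ 0 → c ∈ t}

theorem realization_mono {𝓕 𝓖 : Set S} (h : 𝓕 ⊆ 𝓖) : realization 𝓕 ⊆ realization 𝓖 :=
  fun _ ⟨hp, t, ht, hpt⟩ => ⟨hp, t, h ht, hpt⟩

theorem realization_union (𝓕 𝓖 : Set S) :
    realization (𝓕 ∪ 𝓖) = realization 𝓕 ∪ realization 𝓖 := by
  ext p
  simp only [realization, mem_ofPred_eq, mem_union, or_and_right, exists_or, and_or_left]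

theorem mem_realization_singleton {t : S} {p : V → ℝ} :
    p ∈ realization {t} ↔ p ∈ stdSimplex ℝ V ∧ ∀ c ∉ t, p c = 0 := by
  simp [realization, not_imp_comm]

theorem isCompact_realization [Finite S] (𝓕 : Set S) : IsCompact (realization 𝓕) := by
  have hunion : realization 𝓕 = ⋃ t ∈ 𝓕, stdSimplex ℝ V ∩ ⋂ c, ⋂ (_ : c ∉ t), {p | p c = 0} := by
    ext p
    simp [realization, not_imp_comm]
  rw [hunion]
  exact 𝓕.toFinite.isCompact_biUnion fun t _ => (isCompact_stdSimplex ℝ V).inter_right <|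
    isClosed_iInter fun c => isClosed_iInter fun _ =>
      isClosed_eq (continuous_apply c) continuous_const

theorem exists_ne_zero_of_mem_stdSimplex {p : V → ℝ} (hp : p ∈ stdSimplex ℝ V) :
    ∃ c, p c ≠ 0 := by
  by_contra! h
  simpa [h] using hp.2

theorem sum_eq_one_of_mem_stdSimplex {p : V → ℝ} (hp : p ∈ stdSimplex ℝ V) {t : Finset V}
    (h : ∀ c ∉ t, p c = 0) : ∑ c ∈ t, p c = 1 := by
  rw [← hp.2]
  exact Finset.sum_subset (Finset.subset_univ t) fun c _ => h c

variable [DecidableEq V]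

theorem eq_single_of_mem_stdSimplex {p : V → ℝ} (hp : p ∈ stdSimplex ℝ V) {c : V}
    (h : ∀ d, p d ≠ 0 → d = c) : p = Pi.single c 1 := by
  have hzero : ∀ d ≠ c, p d = 0 := fun d => not_imp_comm.1 (h d)
  ext d
  rcases eq_or_ne d c with rfl | hd
  · simpa using sum_eq_one_of_mem_stdSimplex hp (t := {d}) (by simpa using hzero)
  · rw [hzero d hd, Pi.single_eq_of_ne hd]

theorem single_mem_realization {𝓕 : Set S} {t : S} (ht : t ∈ 𝓕) {c : V} (hc : c ∈ t) :
    Pi.single c 1 ∈ realization 𝓕 := by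
  refine ⟨single_mem_stdSimplex ℝ c, t, ht, fun d hd => ?_⟩
  rcases eq_or_ne d c with rfl | hdc
  · exact hc
  · exact absurd (Pi.single_eq_of_ne hdc _) hd

end Realization

section Chains

open SimpleGraph

variable {V : Type*} {G : SimpleGraph V} {x y z : V}

/-- The boundary, modulo two, of a 1-chain. Chains are functions on all of `Sym2 V`; only those that
vanish on the diagonal are meant, as a loop at `w` would contribute to the value at `w`. -/
def edgeBoundary [Fintype V] : (Sym2 V → ZMod 2) →ₗ[ZMod 2] V → ZMod 2 where
  toFun k w := ∑ u, k s(w, u)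
  map_add' k l := by
    ext w
    simp [Finset.sum_add_distrib]
  map_smul' c k := by
    ext w
    simp [Finset.mul_sum]

theorem edgeBoundary_apply [Fintype V] (k : Sym2 V → ZMod 2) (w : V) :
    edgeBoundary k w = ∑ u, k s(w, u) := rfl

theorem exists_forall_mem_edges_eq [Fintype V] {k : Sym2 V → ZMod 2} (hk : edgeBoundary k = 0)
    {p : G.Walk x z} (hp : p.IsPath)
    (h : ∀ w ∈ p.support, w ≠ x → w ≠ z → ∀ u, k s(w, u) ≠ 0 → s(w, u) ∈ p.edges) :
    ∃ c, ∀ e ∈ p.edges, k e = c := by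
  induction p with
  | nil => exact ⟨0, by simp⟩
  | @cons x y z hxy p ih =>
    obtain ⟨hp, hx⟩ := (Walk.cons_isPath_iff hxy p).1 hp
    obtain ⟨c, hc⟩ := ih hp fun w hw hwy hwz u hu => by
      have hwx : w ≠ x := ne_of_mem_of_not_mem hw hx
      have := h w (by simp [hw]) hwx hwz u hu
      simpa [hwx, hwy] using this
    cases p with
    | nil => exact ⟨k s(x, y), by simp⟩
    | @cons _ u _ hyu q =>
      obtain ⟨-, hy⟩ := (Walk.cons_isPath_iff hyu q).1 hp
      have hxu : x ≠ u := fun hxu => hx (by simp [hxu])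
      have hy_sum : k s(y, x) + k s(y, u) = 0 := by
        rw [← show edgeBoundary k y = 0 from congrFun hk y, edgeBoundary_apply]
        refine (Fintype.sum_eq_add (f := fun v => k s(y, v)) x u hxu fun v hv => ?_).symm
        by_contra hkv
        have hmem := h y (by simp) hxy.ne' (ne_of_mem_of_not_mem q.end_mem_support hy).symm v hkv
        have hyq : s(y, v) ∉ q.edges := fun hmem => hy (q.fst_mem_support_of_mem_edges hmem)
        simp [hxy.ne', hyu.ne, hv, hyq] at hmem
      refine ⟨c, fun e he => ?_⟩
      rcases List.mem_cons.1 he with rfl | he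
      · rw [Dart.edge_mk, Sym2.eq_swap, CharTwo.add_eq_zero.1 hy_sum, hc _ (by simp)]
      · exact hc e he

variable [DecidableEq V]

/-- The sum modulo two of the edges of a walk, as a 1-chain. -/
def walkChain (p : G.Walk x z) (e : Sym2 V) : ZMod 2 := p.edges.count e

theorem walkChain_nil : walkChain (Walk.nil : G.Walk x x) = 0 := rfl

theorem walkChain_cons (h : G.Adj x y) (p : G.Walk y z) :
    walkChain (Walk.cons h p) = Pi.single s(x, y) 1 + walkChain p := by
  ext e
  simp only [walkChain, Walk.edges_cons, List.count_cons, Nat.cast_add, Pi.add_apply,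
    Pi.single_apply, beq_iff_eq, eq_comm (a := e), Nat.cast_ite, Nat.cast_one, Nat.cast_zero]
  ring

theorem walkChain_append (p : G.Walk x y) (q : G.Walk y z) :
    walkChain (p.append q) = walkChain p + walkChain q := by
  ext e
  simp [walkChain, Walk.edges_append]

theorem walkChain_reverse (p : G.Walk x z) : walkChain p.reverse = walkChain p := by
  ext e
  simp [walkChain, Walk.edges_reverse]

theorem walkChain_eq_zero {p : G.Walk x z} {e : Sym2 V} (he : e ∉ p.edges) :
    walkChain p e = 0 := by
  rw [walkChain, List.count_eq_zero_of_not_mem he, Nat.cast_zero]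

theorem mem_edges_of_walkChain_ne_zero {p : G.Walk x z} {e : Sym2 V} (he : walkChain p e ≠ 0) :
    e ∈ p.edges :=
  not_imp_comm.1 walkChain_eq_zero he

theorem walkChain_eq_one {p : G.Walk x z} (hp : p.IsTrail) {e : Sym2 V} (he : e ∈ p.edges) :
    walkChain p e = 1 := by
  rw [walkChain, hp.count_edges_eq_one he, Nat.cast_one]

variable [Fintype V]

theorem edgeBoundary_single (h : x ≠ y) :
    edgeBoundary (Pi.single s(x, y) 1) = Pi.single x 1 + Pi.single y 1 := by
  ext w
  simp only [edgeBoundary_apply, Pi.single_apply, Pi.add_apply]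
  rcases eq_or_ne w x with rfl | hx
  · simp [h]
  rcases eq_or_ne w y with rfl | hy
  · simp [h.symm]
  · simp [hx, hy]

theorem edgeBoundary_walkChain (p : G.Walk x z) :
    edgeBoundary (walkChain p) = Pi.single x 1 + Pi.single z 1 := by
  induction p with
  | nil => rw [walkChain_nil, map_zero, ZModModule.add_self]
  | cons h p ih =>
    rw [walkChain_cons, map_add, edgeBoundary_single h.ne, ih]
    exact ZModModule.add_add_add_cancel _ _ _

end Chains

section Arcs

open SimpleGraph

variable {V : Type*} {G : SimpleGraph V} {x y z : V}

theorem disjoint_edges_of_isCycle {P Q : G.Walk x z} (h : (P.append Q.reverse).IsCycle) :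
    P.edges.Disjoint Q.edges := by
  have := ((Walk.isTrail_append _ _).1 h.isTrail).2.2
  rwa [Walk.edges_reverse, List.disjoint_reverse_right] at this

theorem eq_or_eq_of_isCycle {P Q : G.Walk x z} (h : (P.append Q.reverse).IsCycle) {w : V}
    (hP : w ∈ P.support) (hQ : w ∈ Q.support) : w = x ∨ w = z := by
  have hdisjoint := h.support_nodup
  rw [Walk.tail_support_append, List.nodup_append'] at hdisjoint
  have hQ' : w ∈ Q.reverse.support := by rwa [Walk.support_reverse, List.mem_reverse]
  by_contra! hne
  exact hdisjoint.2.2 (((Walk.mem_support_iff P).1 hP).resolve_left hne.1)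
    (((Walk.mem_support_iff _).1 hQ').resolve_left hne.2)

theorem mem_edges_of_theta {N P Q : G.Walk x z} (hPQ : (P.append Q.reverse).IsCycle) {e : Sym2 V}
    (heP : e ∈ (N.append P.reverse).edges) (heQ : e ∈ (N.append Q.reverse).edges) :
    e ∈ N.edges := by
  have hdisjoint : e ∈ P.edges → e ∉ Q.edges := fun h => disjoint_edges_of_isCycle hPQ h
  simp only [Walk.edges_append, Walk.edges_reverse, List.mem_append, List.mem_reverse] at heP heQ
  tauto

theorem mem_support_of_theta {N P Q : G.Walk x z} (hPQ : (P.append Q.reverse).IsCycle) {w : V}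
    (hwP : w ∈ (N.append P.reverse).support) (hwQ : w ∈ (N.append Q.reverse).support) :
    w ∈ N.support := by
  simp only [Walk.mem_support_append_iff, Walk.support_reverse, List.mem_reverse] at hwP hwQ
  by_contra hw
  rcases eq_or_eq_of_isCycle hPQ (hwP.resolve_left hw) (hwQ.resolve_left hw) with rfl | rfl
  exacts [hw N.start_mem_support, hw N.end_mem_support]

variable [DecidableEq V] [Fintype V]

theorem isArc_realization_edge (h : x ≠ y) :
    IsArc (realization {s(x, y)}) (Pi.single x 1 : V → ℝ) (Pi.single y 1) := by
  have hmem {p : V → ℝ} : p ∈ realization {s(x, y)} ↔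
      p ∈ stdSimplex ℝ V ∧ ∀ c ∉ ({x, y} : Finset V), p c = 0 := by
    simp [mem_realization_singleton]
  have hsum {p : V → ℝ} (hp : p ∈ realization {s(x, y)}) : p x + p y = 1 := by
    obtain ⟨hp, hpc⟩ := hmem.1 hp
    rw [← Finset.sum_pair h, sum_eq_one_of_mem_stdSimplex hp hpc]
  refine ⟨isCompact_realization _,
    single_mem_realization (mem_singleton _) (Sym2.mem_mk_left x y),
    single_mem_realization (mem_singleton _) (Sym2.mem_mk_right x y), fun p => p y,
    (continuous_apply y).continuousOn, ⟨fun p hp => ?_, fun p hp q hq hpq => ?_, fun t ht => ?_⟩,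
    Pi.single_eq_of_ne h.symm 1, Pi.single_eq_same y 1⟩
  · exact ⟨hp.1.1 y, by linarith [hsum hp, hp.1.1 x]⟩
  · ext c
    by_cases hc : c ∈ ({x, y} : Finset V)
    · rcases Finset.mem_insert.1 hc with rfl | hc
      · linarith [hsum hp, hsum hq, show p y = q y from hpq]
      · rwa [Finset.mem_singleton.1 hc]
    · rw [(hmem.1 hp).2 c hc, (hmem.1 hq).2 c hc]
  · refine ⟨AffineMap.lineMap (Pi.single x 1 : V → ℝ) (Pi.single y 1) t,
      hmem.2 ⟨?_, fun c hc => ?_⟩, ?_⟩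
    · exact (convex_stdSimplex ℝ V).lineMap_mem (single_mem_stdSimplex ℝ x)
        (single_mem_stdSimplex ℝ y) ht
    · rw [Finset.mem_insert, Finset.mem_singleton, not_or] at hc
      simp [AffineMap.lineMap_apply, hc.1, hc.2]
    · simp [AffineMap.lineMap_apply, h]

theorem isArc_realization_path {p : G.Walk x z} (hp : p.IsPath) (hxz : x ≠ z) :
    IsArc (realization p.edgeSet) (Pi.single x 1 : V → ℝ) (Pi.single z 1) := by
  induction p with
  | nil => exact absurd rfl hxz
  | @cons x y z h p ih =>
    obtain ⟨hp, hx⟩ := (Walk.cons_isPath_iff h p).1 hp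
    rcases eq_or_ne y z with rfl | hyz
    · rw [(Walk.isPath_iff_nil.1 hp).eq_nil, Walk.edgeSet_cons, Walk.edgeSet_nil, insert_empty_eq]
      exact isArc_realization_edge h.ne
    rw [Walk.edgeSet_cons, insert_eq, realization_union]
    refine (isArc_realization_edge h.ne).trans (ih hp hyz) (Subset.antisymm ?_ ?_)
    · rintro q ⟨⟨hq, _, rfl, hqe⟩, -, f, hf, hqf⟩
      refine eq_single_of_mem_stdSimplex hq fun c hc => ?_
      have hcx : c ≠ x := fun hcx => hx (p.mem_support_of_mem_edges hf (hcx ▸ hqf c hc))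
      exact (Sym2.mem_iff.1 (hqe c hc)).resolve_left hcx
    · rintro _ rfl
      obtain ⟨f, hf, hyf⟩ :=
        (p.mem_support_iff_exists_mem_edges_of_not_nil (Walk.not_nil_of_ne hyz)).1
          p.start_mem_support
      exact ⟨single_mem_realization (mem_singleton _) (Sym2.mem_mk_right x y),
        single_mem_realization (𝓕 := p.edgeSet) hf hyf⟩

theorem realization_inter_of_isCycle {P Q : G.Walk x z} (hxz : x ≠ z)
    (h : (P.append Q.reverse).IsCycle) :
    (realization P.edgeSet ∩ realization Q.edgeSet : Set (V → ℝ)) =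
      {Pi.single x 1, Pi.single z 1} := by
  have hmem (R : G.Walk x z) {c : V} (hc : c = x ∨ c = z) :
      (Pi.single c 1 : V → ℝ) ∈ realization R.edgeSet := by
    have hcR : c ∈ R.support := by rcases hc with rfl | rfl <;> simp
    obtain ⟨e, he, hce⟩ :=
      (R.mem_support_iff_exists_mem_edges_of_not_nil (Walk.not_nil_of_ne hxz)).1 hcR
    exact single_mem_realization (𝓕 := R.edgeSet) he hce
  apply Subset.antisymm
  · rintro p ⟨⟨hp, e, he, hpe⟩, -, f, hf, hpf⟩
    obtain ⟨c, hc⟩ := exists_ne_zero_of_mem_stdSimplex hp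
    have hpc : p = Pi.single c 1 := eq_single_of_mem_stdSimplex hp fun d hd => by
      by_contra hdc
      have hef : e = f := Sym2.eq_of_ne_mem hdc (hpe d hd) (hpe c hc) (hpf d hd) (hpf c hc)
      exact disjoint_edges_of_isCycle h he (hef ▸ hf)
    have hcxz := eq_or_eq_of_isCycle h (P.mem_support_of_mem_edges he (hpe c hc))
      (Q.mem_support_of_mem_edges hf (hpf c hc))
    rcases hcxz with rfl | rfl <;> simp [hpc]
  · rintro _ (rfl | rfl)
    exacts [⟨hmem P (Or.inl rfl), hmem Q (Or.inl rfl)⟩, ⟨hmem P (Or.inr rfl), hmem Q (Or.inr rfl)⟩]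

end Arcs

section Triangle

/-- The triangle in `ℂ` with vertices `0`, `1` and `I`, the model of a 2-simplex. -/
def rightTriangle : Set ℂ := {z | 0 ≤ z.re} ∩ {z | 0 ≤ z.im} ∩ {z | z.re + z.im ≤ 1}

theorem mem_rightTriangle {z : ℂ} :
    z ∈ rightTriangle ↔ 0 ≤ z.re ∧ 0 ≤ z.im ∧ z.re + z.im ≤ 1 := and_assoc

theorem interior_rightTriangle :
    interior rightTriangle = {z | 0 < z.re} ∩ {z | 0 < z.im} ∩ {z | z.re + z.im < 1} := by
  rw [rightTriangle, interior_inter, interior_inter, Complex.interior_setOfPred_le_re,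
    Complex.interior_setOfPred_le_im]
  congr 1
  have hopen : IsOpenMap (Complex.reLm + Complex.imLm) :=
    LinearMap.isOpenMap_of_finiteDimensional _ fun t => ⟨t, by simp⟩
  have hpreimage := hopen.preimage_interior_eq_interior_preimage
    (LinearMap.continuous_of_finiteDimensional _) (Iic 1)
  rw [interior_Iic] at hpreimage
  exact hpreimage.symm

theorem convex_rightTriangle : Convex ℝ rightTriangle :=
  ((convex_halfSpace_re_ge 0).inter (convex_halfSpace_im_ge 0)).inter
    (convex_halfSpace_le (Complex.reLm + Complex.imLm).isLinear 1)

theorem isCompact_rightTriangle : IsCompact rightTriangle := by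
  refine Metric.isCompact_of_isClosed_isBounded
    (((isClosed_le continuous_const Complex.continuous_re).inter
      (isClosed_le continuous_const Complex.continuous_im)).inter
      (isClosed_le (by fun_prop) continuous_const))
    (isBounded_closedBall.subset (t := closedBall 0 2) fun z hz => ?_)
  obtain ⟨hre, him, hsum⟩ := mem_rightTriangle.1 hz
  rw [mem_closedBall_zero_iff]
  refine (Complex.norm_le_abs_re_add_abs_im z).trans ?_
  rw [abs_of_nonneg hre, abs_of_nonneg him]
  linarith

theorem frontier_rightTriangle :
    frontier rightTriangle = {z ∈ rightTriangle | z.re = 0 ∨ z.im = 0 ∨ z.re + z.im = 1} := by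
  rw [isCompact_rightTriangle.isClosed.frontier_eq, interior_rightTriangle]
  ext z
  simp only [mem_rightTriangle, mem_sdiff, mem_inter_iff, mem_ofPred_eq]
  grind

theorem isDisk_rightTriangle :
    IsDisk rightTriangle {z ∈ rightTriangle | z.re = 0 ∨ z.im = 0 ∨ z.re + z.im = 1} := by
  rw [← frontier_rightTriangle]
  refine isDisk_of_convex convex_rightTriangle isCompact_rightTriangle ⟨⟨1 / 4, 1 / 4⟩, ?_⟩
  rw [interior_rightTriangle]
  norm_num

variable {V : Type*} [Fintype V] [DecidableEq V] {x y w : V}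

theorem apply_add_apply_add_apply_eq_one (hxy : x ≠ y) (hxw : x ≠ w) (hyw : y ≠ w) {p : V → ℝ}
    (hp : p ∈ realization {({x, y, w} : Finset V)}) : p x + p y + p w = 1 := by
  obtain ⟨hp, hpc⟩ := mem_realization_singleton.1 hp
  have hsum := sum_eq_one_of_mem_stdSimplex hp hpc
  rwa [Finset.sum_insert (by simp [hxy, hxw]), Finset.sum_pair hyw, ← add_assoc] at hsum

theorem bijOn_rightTriangle (hxy : x ≠ y) (hxw : x ≠ w) (hyw : y ≠ w) :
    BijOn (fun p : V → ℝ => (⟨p x, p y⟩ : ℂ)) (realization {({x, y, w} : Finset V)})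
      rightTriangle := by
  have hsum {p : V → ℝ} := apply_add_apply_add_apply_eq_one (p := p) hxy hxw hyw
  refine ⟨fun p hp => ?_, fun p hp q hq hpq => ?_, fun z hz => ?_⟩
  · exact mem_rightTriangle.2
      ⟨hp.1.1 x, hp.1.1 y, by linarith [hsum hp, hp.1.1 w]⟩
  · obtain ⟨hpx, hpy⟩ := Complex.mk.inj hpq
    ext c
    by_cases hc : c ∈ ({x, y, w} : Finset V)
    · simp only [Finset.mem_insert, Finset.mem_singleton] at hc
      rcases hc with rfl | rfl | rfl
      exacts [hpx, hpy, by linarith [hsum hp, hsum hq]]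
    · rw [(mem_realization_singleton.1 hp).2 c hc, (mem_realization_singleton.1 hq).2 c hc]
  · obtain ⟨hre, him, hle⟩ := mem_rightTriangle.1 hz
    have hnonneg {t : ℝ} (ht : 0 ≤ t) (d : V) : 0 ≤ (Pi.single d t : V → ℝ) :=
      Pi.single_nonneg.2 ht
    refine ⟨Pi.single x z.re + Pi.single y z.im + Pi.single w (1 - z.re - z.im),
      mem_realization_singleton.2 ⟨⟨?_, ?_⟩, fun c hc => ?_⟩, Complex.ext ?_ ?_⟩
    · exact add_nonneg (add_nonneg (hnonneg hre x) (hnonneg him y)) (hnonneg (by linarith) w)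
    · simp [Finset.sum_add_distrib]
    · simp only [Finset.mem_insert, Finset.mem_singleton, not_or] at hc
      simp [hc]
    · simp [hxy, hxw]
    · simp [hxy.symm, hyw]

theorem realization_edges_of_triangle (hxy : x ≠ y) (hxw : x ≠ w) (hyw : y ≠ w) :
    (realization {s(x, y), s(y, w), s(w, x)} : Set (V → ℝ)) =
      {p ∈ realization {({x, y, w} : Finset V)} | p x = 0 ∨ p y = 0 ∨ p w = 0} := by
  ext p
  simp only [realization, mem_ofPred_eq, mem_insert_iff, mem_singleton_iff, exists_eq_left,
    exists_eq_or_imp, Sym2.mem_iff, Finset.mem_insert, Finset.mem_singleton]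
  grind

theorem isDisk_realization_triangle (hxy : x ≠ y) (hxw : x ≠ w) (hyw : y ≠ w) :
    IsDisk (realization {({x, y, w} : Finset V)})
      (realization {s(x, y), s(y, w), s(w, x)}) := by
  have hb := bijOn_rightTriangle hxy hxw hyw
  have hcont : Continuous fun p : V → ℝ => (⟨p x, p y⟩ : ℂ) := by
    simp only [Complex.mk_eq_add_mul_I]
    fun_prop
  have hboundary {p : V → ℝ} (hp : p ∈ realization {({x, y, w} : Finset V)}) :
      p x + p y = 1 ↔ p w = 0 := by
    rw [← apply_add_apply_add_apply_eq_one hxy hxw hyw hp, left_eq_add]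
  rw [realization_edges_of_triangle hxy hxw hyw]
  refine isDisk_rightTriangle.of_bijOn (isCompact_realization _) (sep_subset _ _)
    hcont.continuousOn hb ⟨fun p hp => ?_, hb.injOn.mono (sep_subset _ _), fun z hz => ?_⟩
  · exact ⟨hb.mapsTo hp.1, hp.2.imp_right (Or.imp_right (hboundary hp.1).2)⟩
  · obtain ⟨p, hp, rfl⟩ := hb.surjOn hz.1
    exact ⟨p, ⟨hp, hz.2.imp_right (Or.imp_right (hboundary hp).1)⟩, rfl⟩

end Triangle

section SphereTriangulation

open SimpleGraph

variable {V : Type*} [DecidableEq V]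

/-- The edges of the simplex with vertex set `t`. -/
def triangleEdges (t : Finset V) : Finset (Sym2 V) := t.sym2.filter fun e => ¬e.IsDiag

theorem mk_mem_triangleEdges {t : Finset V} {u v : V} :
    s(u, v) ∈ triangleEdges t ↔ u ∈ t ∧ v ∈ t ∧ u ≠ v := by
  rw [triangleEdges, Finset.mem_filter, Finset.mk_mem_sym2_iff, Sym2.mk_isDiag_iff, and_assoc]

theorem mem_of_mem_triangleEdges {t : Finset V} {e : Sym2 V} {v : V} (he : e ∈ triangleEdges t)
    (hv : v ∈ e) : v ∈ t :=
  Finset.mem_sym2_iff.1 (Finset.mem_filter.1 he).1 v hv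

theorem exists_eq_insert_of_mem_triangleEdges {t : Finset V} (ht : t.card = 3) {u v : V}
    (h : s(u, v) ∈ triangleEdges t) : ∃ w, u ≠ w ∧ v ≠ w ∧ t = {u, v, w} := by
  obtain ⟨hu, hv, huv⟩ := mk_mem_triangleEdges.1 h
  have hpair : ({u, v} : Finset V) ⊆ t := by simp [Finset.insert_subset_iff, hu, hv]
  obtain ⟨w, hw⟩ := Finset.card_eq_one.1 (show (t \ {u, v}).card = 1 by
    rw [Finset.card_sdiff_of_subset hpair, ht, Finset.card_pair huv])
  have hmem : w ∈ t \ {u, v} := by simp [hw]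
  simp only [Finset.mem_sdiff, Finset.mem_insert, Finset.mem_singleton, not_or] at hmem
  refine ⟨w, Ne.symm hmem.2.1, Ne.symm hmem.2.2, ?_⟩
  rw [← Finset.union_sdiff_of_subset hpair, hw]
  simp only [Finset.insert_union, Finset.singleton_union]

theorem coe_triangleEdges_insert {x y w : V} (hxy : x ≠ y) (hxw : x ≠ w) (hyw : y ≠ w) :
    (triangleEdges ({x, y, w} : Finset V) : Set (Sym2 V)) = {s(x, y), s(y, w), s(w, x)} := by
  ext e
  induction e with
  | _ u v =>
    simp only [Finset.mem_coe, mk_mem_triangleEdges, Finset.mem_insert, Finset.mem_singleton,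
      mem_insert_iff, mem_singleton_iff, Sym2.eq_iff]
    grind

theorem mem_of_mem_of_mem_triangleEdges {t t' : Finset V} (ht : t.card = 3) (ht' : t'.card = 3)
    (hne : t ≠ t') {e : Sym2 V} (he : e ∈ triangleEdges t) (he' : e ∈ triangleEdges t') {v : V}
    (hv : v ∈ t) (hv' : v ∈ t') : v ∈ e := by
  induction e with
  | _ x y =>
    obtain ⟨a, -, -, rfl⟩ := exists_eq_insert_of_mem_triangleEdges ht he
    obtain ⟨b, -, -, rfl⟩ := exists_eq_insert_of_mem_triangleEdges ht' he'
    have hab : a ≠ b := fun hab => hne (hab ▸ rfl)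
    simp only [Finset.mem_insert, Finset.mem_singleton] at hv hv'
    rw [Sym2.mem_iff]
    grind

/-- The boundary, modulo two, of a set of triangles. -/
def triangleBoundary (A : Finset (Finset V)) (e : Sym2 V) : ZMod 2 :=
  ∑ t ∈ A, if e ∈ triangleEdges t then 1 else 0

theorem triangleBoundary_union {A B : Finset (Finset V)} (h : Disjoint A B) :
    triangleBoundary (A ∪ B) = triangleBoundary A + triangleBoundary B :=
  funext fun _ => Finset.sum_union h

theorem triangleBoundary_sdiff {A B : Finset (Finset V)} (h : B ⊆ A) :
    triangleBoundary (A \ B) = triangleBoundary A + triangleBoundary B := by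
  rw [← ZModModule.sub_eq_add, eq_sub_iff_add_eq, ← triangleBoundary_union Finset.sdiff_disjoint,
    Finset.sdiff_union_of_subset h]

theorem exists_mem_of_triangleBoundary_ne_zero {A : Finset (Finset V)} {e : Sym2 V}
    (h : triangleBoundary A e ≠ 0) : ∃ t ∈ A, e ∈ triangleEdges t := by
  by_contra! hA
  exact h (Finset.sum_eq_zero fun t ht => if_neg (hA t ht))

theorem edgeBoundary_triangleBoundary [Fintype V] {A : Finset (Finset V)}
    (hA : ∀ t ∈ A, t.card = 3) : edgeBoundary (triangleBoundary A) = 0 := by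
  ext w
  simp only [edgeBoundary_apply, triangleBoundary, Pi.zero_apply]
  rw [Finset.sum_comm]
  refine Finset.sum_eq_zero fun t ht => ?_
  by_cases hw : w ∈ t
  · have hlink : Finset.univ.filter (fun u => s(w, u) ∈ triangleEdges t) = t.erase w := by
      ext u
      simp [mk_mem_triangleEdges, hw, and_comm, eq_comm]
    rw [Finset.sum_boole, hlink, Finset.card_erase_of_mem hw, hA t ht]
    rfl
  · simp [mk_mem_triangleEdges, hw]

theorem realization_edgeSet_subset [Fintype V] {A : Finset (Finset V)} {G : SimpleGraph V}
    {u v : V} {c : G.Walk u v} (hc : c.IsTrail) (hb : triangleBoundary A = walkChain c) :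
    realization c.edgeSet ⊆ realization (A : Set (Finset V)) := by
  rintro p ⟨hp, e, he, hpe⟩
  obtain ⟨t, ht, het⟩ := exists_mem_of_triangleBoundary_ne_zero (A := A) (e := e)
    (by rw [hb, walkChain_eq_one hc he]; exact one_ne_zero)
  exact ⟨hp, t, ht, fun v hv => mem_of_mem_triangleEdges het (hpe v hv)⟩

/-- The combinatorial properties of a triangulated sphere, given by its set of triangles, on which
the Schoenflies theorem rests: each edge is in two triangles, the homology modulo two is that of
a sphere, and the stars of the vertices are connected. The last two conditions are expressed
through boundaries of sets of triangles. -/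
structure IsSphereTriangulation [Fintype V] (T : Finset (Finset V)) : Prop where
  card_eq : ∀ t ∈ T, t.card = 3
  edge : ∀ t ∈ T, ∀ e ∈ triangleEdges t,
    ∃ t' ∈ T, t' ≠ t ∧ e ∈ triangleEdges t' ∧ ∀ s ∈ T, e ∈ triangleEdges s → s = t ∨ s = t'
  homology : ∀ k : Sym2 V → ZMod 2, (∀ e, k e ≠ 0 → ∃ t ∈ T, e ∈ triangleEdges t) →
    edgeBoundary k = 0 → ∃ B ⊆ T, triangleBoundary B = k
  star : ∀ A ⊆ T, ∀ w, (∀ e, w ∈ e → triangleBoundary A e = 0) →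
    ∀ t ∈ A, w ∈ t → ∀ t' ∈ T, w ∈ t' → t' ∈ A
  connected : ∀ A ⊆ T, triangleBoundary A = 0 → A = ∅ ∨ A = T

namespace IsSphereTriangulation

variable [Fintype V] {T A B : Finset (Finset V)} {e : Sym2 V} {t t' : Finset V}

theorem triangleBoundary_eq_zero_of_mem (hT : IsSphereTriangulation T) (hA : A ⊆ T) (ht : t ∈ A)
    (ht' : t' ∈ A) (hne : t ≠ t') (he : e ∈ triangleEdges t) (he' : e ∈ triangleEdges t') :
    triangleBoundary A e = 0 := by
  obtain ⟨s, -, -, -, hall⟩ := hT.edge t (hA ht) e he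
  obtain rfl : t' = s := (hall t' (hA ht') he').resolve_left hne.symm
  rw [triangleBoundary, Finset.sum_eq_add_of_mem t t' ht ht' hne, if_pos he, if_pos he']
  · rfl
  · exact fun s hs hst => if_neg fun hes => (hall s (hA hs) hes).elim hst.1 hst.2

theorem triangleBoundary_self (hT : IsSphereTriangulation T) : triangleBoundary T = 0 := by
  ext e
  by_contra he
  obtain ⟨t, ht, het⟩ := exists_mem_of_triangleBoundary_ne_zero he
  obtain ⟨t', ht', hne, het', -⟩ := hT.edge t ht e het
  exact he (hT.triangleBoundary_eq_zero_of_mem Finset.Subset.rfl ht ht' hne.symm het het')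

theorem mem_of_triangleBoundary_eq_zero (hT : IsSphereTriangulation T) (hA : A ⊆ T)
    (h : triangleBoundary A e = 0) (ht : t ∈ A) (he : e ∈ triangleEdges t) (ht' : t' ∈ T)
    (he' : e ∈ triangleEdges t') : t' ∈ A := by
  by_contra htA
  obtain ⟨s, -, -, -, hall⟩ := hT.edge t (hA ht) e he
  have hne : t' ≠ t := fun h => htA (h ▸ ht)
  obtain rfl : t' = s := (hall t' ht' he').resolve_left hne
  rw [triangleBoundary, Finset.sum_eq_single_of_mem t ht, if_pos he] at h
  · exact one_ne_zero h
  · exact fun s hs hst => if_neg fun hes =>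
      (hall s (hA hs) hes).elim hst (ne_of_mem_of_not_mem hs htA)

theorem triangleBoundary_inter (hT : IsSphereTriangulation T) (hA : A ⊆ T) (hB : B ⊆ T)
    (h : triangleBoundary A e = 0) (ht : t ∈ A) (he : e ∈ triangleEdges t) :
    triangleBoundary (A ∩ B) e = triangleBoundary B e :=
  Finset.sum_subset Finset.inter_subset_right fun _ hs hs' => if_neg fun hes =>
    hs' (Finset.mem_inter.2 ⟨hT.mem_of_triangleBoundary_eq_zero hA h ht he (hB hs) hes, hs⟩)

section Gluing

variable {u x z : V} {c : (⊤ : SimpleGraph V).Walk u u} {N P Q : (⊤ : SimpleGraph V).Walk x z}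

theorem mem_support_of_mem_of_notMem (hT : IsSphereTriangulation T) (hA : A ⊆ T)
    (hb : triangleBoundary A = walkChain c) {w : V} (ht : t ∈ A) (hw : w ∈ t) (ht' : t' ∈ T)
    (hw' : w ∈ t') (htA : t' ∉ A) : w ∈ c.support := by
  by_contra hwc
  refine htA (hT.star A hA w (fun e he => ?_) t ht hw t' ht' hw')
  rw [hb, walkChain_eq_zero fun hec => hwc (c.mem_support_of_mem_edges hec he)]

theorem mem_edges_of_mem_of_notMem (hT : IsSphereTriangulation T) (hA : A ⊆ T)
    (hb : triangleBoundary A = walkChain c) (ht : t ∈ A) (he : e ∈ triangleEdges t) (ht' : t' ∈ T)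
    (he' : e ∈ triangleEdges t') (htA : t' ∉ A) : e ∈ c.edges := by
  by_contra hec
  have hbe : triangleBoundary A e = 0 := by rw [hb, walkChain_eq_zero hec]
  exact htA (hT.mem_of_triangleBoundary_eq_zero hA hbe ht he ht' he')

/-- Two disks bounded by two of the three cycles of a theta graph meet in the common path. -/
theorem realization_inter (hT : IsSphereTriangulation T) (hxz : x ≠ z)
    (hNP : (N.append P.reverse).IsCycle) (hNQ : (N.append Q.reverse).IsCycle)
    (hPQ : (P.append Q.reverse).IsCycle) (hA : A ⊆ T) (hB : B ⊆ T) (hAB : Disjoint A B)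
    (hbA : triangleBoundary A = walkChain (N.append P.reverse))
    (hbB : triangleBoundary B = walkChain (N.append Q.reverse)) :
    (realization (A : Set (Finset V)) ∩ realization (B : Set (Finset V)) : Set (V → ℝ)) =
      realization N.edgeSet := by
  apply Subset.antisymm
  · rintro p ⟨⟨hp, t, ht, hpt⟩, -, t', ht', hpt'⟩
    have htB : t ∉ B := Finset.disjoint_left.1 hAB ht
    have htA : t' ∉ A := Finset.disjoint_right.1 hAB ht'
    obtain ⟨v, hv⟩ := exists_ne_zero_of_mem_stdSimplex hp
    by_cases hpv : ∀ w, p w ≠ 0 → w = v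
    · have hvN := mem_support_of_theta hPQ
        (hT.mem_support_of_mem_of_notMem hA hbA ht (hpt v hv) (hB ht') (hpt' v hv) htA)
        (hT.mem_support_of_mem_of_notMem hB hbB ht' (hpt' v hv) (hA ht) (hpt v hv) htB)
      obtain ⟨e, he, hve⟩ :=
        (N.mem_support_iff_exists_mem_edges_of_not_nil (Walk.not_nil_of_ne hxz)).1 hvN
      exact ⟨hp, e, he, fun w hw => hpv w hw ▸ hve⟩
    · push Not at hpv
      obtain ⟨w, hw, hwv⟩ := hpv
      have he := mk_mem_triangleEdges.2 ⟨hpt w hw, hpt v hv, hwv⟩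
      have he' := mk_mem_triangleEdges.2 ⟨hpt' w hw, hpt' v hv, hwv⟩
      refine ⟨hp, s(w, v), mem_edges_of_theta hPQ
        (hT.mem_edges_of_mem_of_notMem hA hbA ht he (hB ht') he' htA)
        (hT.mem_edges_of_mem_of_notMem hB hbB ht' he' (hA ht) he htB), fun d hd => ?_⟩
      exact mem_of_mem_of_mem_triangleEdges (hT.card_eq t (hA ht)) (hT.card_eq t' (hB ht'))
        (ne_of_mem_of_not_mem ht htA) he he' (hpt d hd) (hpt' d hd)
  · have hmono {R : (⊤ : SimpleGraph V).Walk x z} :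
        (realization N.edgeSet : Set (V → ℝ)) ⊆ realization (N.append R.reverse).edgeSet :=
      realization_mono (by rw [Walk.edgeSet_append]; exact subset_union_left)
    exact subset_inter (hmono.trans (realization_edgeSet_subset hNP.isTrail hbA))
      (hmono.trans (realization_edgeSet_subset hNQ.isTrail hbB))

theorem isDisk_union (hT : IsSphereTriangulation T) (hxz : x ≠ z)
    (hNP : (N.append P.reverse).IsCycle) (hNQ : (N.append Q.reverse).IsCycle)
    (hPQ : (P.append Q.reverse).IsCycle) (hA : A ⊆ T) (hB : B ⊆ T) (hAB : Disjoint A B)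
    (hbA : triangleBoundary A = walkChain (N.append P.reverse))
    (hbB : triangleBoundary B = walkChain (N.append Q.reverse))
    (hdA : IsDisk (realization (A : Set (Finset V))) (realization (N.append P.reverse).edgeSet))
    (hdB : IsDisk (realization (B : Set (Finset V))) (realization (N.append Q.reverse).edgeSet)) :
    IsDisk (realization ((A ∪ B : Finset (Finset V)) : Set (Finset V)))
      (realization (P.append Q.reverse).edgeSet) := by
  have hnil {R : (⊤ : SimpleGraph V).Walk x z} : ¬R.reverse.Nil :=
    Walk.not_nil_of_ne hxz.symm
  have hQ : Q.IsPath := by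
    simpa using (hPQ.isPath_of_append_right (Walk.not_nil_of_ne hxz)).reverse
  simp only [Walk.edgeSet_append, Walk.edgeSet_reverse, realization_union, Finset.coe_union]
    at hdA hdB ⊢
  exact hdA.union hdB (isArc_realization_path (hNP.isPath_of_append_left hnil) hxz)
    (isArc_realization_path (hPQ.isPath_of_append_left hnil) hxz)
    (isArc_realization_path hQ hxz) (realization_inter_of_isCycle hxz hNP)
    (realization_inter_of_isCycle hxz hNQ)
    (hT.realization_inter hxz hNP hNQ hPQ hA hB hAB hbA hbB)

end Gluing

end IsSphereTriangulation

end SphereTriangulation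

section Schoenflies

open SimpleGraph

section Theta

variable {V : Type*} {G : SimpleGraph V} {u x z : V}

theorem exists_append_reverse_of_isCycle {c : G.Walk u u} (hc : c.IsCycle) (hx : x ∈ c.support)
    (hz : z ∈ c.support) :
    ∃ P Q : G.Walk x z, (P.append Q.reverse).IsCycle ∧ (P.append Q.reverse).edges.Perm c.edges ∧
      ∀ w, w ∈ (P.append Q.reverse).support ↔ w ∈ c.support := by
  classical
  have hz' : z ∈ (c.rotate x hx).support := (c.mem_support_rotate_iff x hx).2 hz
  refine ⟨(c.rotate x hx).takeUntil z hz', ((c.rotate x hx).dropUntil z hz').reverse, ?_⟩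
  rw [Walk.reverse_reverse, Walk.take_spec]
  exact ⟨hc.rotate hx, (c.rotate_edges x hx).perm, fun w => c.mem_support_rotate_iff x hx⟩

theorem isCycle_append_reverse {N P : G.Walk x z} (hN : N.IsPath) (hP : P.IsPath) (hxz : x ≠ z)
    (hedges : N.edges.Disjoint P.edges)
    (hsupport : ∀ w ∈ N.support, w ∈ P.support → w = x ∨ w = z) :
    (N.append P.reverse).IsCycle := by
  have hne : N ≠ P := by
    rintro rfl
    have he := Walk.mk_start_snd_mem_edges (p := N) (Walk.not_nil_of_ne hxz)
    exact hedges he he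
  refine hN.isCycle_append hP.reverse (fun w hw hw' => ?_) ?_
  · have hwP : w ∈ P.support := by
      simpa only [Walk.support_reverse, List.mem_reverse] using List.mem_of_mem_tail hw'
    have hstart {a b : V} {R : G.Walk a b} (hR : R.IsPath) : a ∉ R.support.tail :=
      (List.nodup_cons.1 (R.cons_tail_support.symm ▸ hR.support_nodup)).1
    rcases hsupport w (List.mem_of_mem_tail hw) hwP with rfl | rfl
    · exact hstart hN hw
    · exact hstart hP.reverse hw'
  · by_contra! hlength
    exact hne (Walk.eq_of_length_le_one hlength.1 (P.length_reverse ▸ hlength.2))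

theorem eq_zero_or_eq_walkChain [Fintype V] [DecidableEq V] {c : G.Walk u u} (hc : c.IsCycle)
    {k : Sym2 V → ZMod 2} (hk : edgeBoundary k = 0) (hsupp : ∀ e, k e ≠ 0 → e ∈ c.edges) :
    k = 0 ∨ k = walkChain c := by
  cases c with
  | nil => exact absurd rfl hc.ne_nil
  | @cons _ b _ hab p =>
    have hp := ((Walk.cons_isCycle_iff p hab).1 hc).1
    -- Subtracting a multiple of the cycle leaves a chain that vanishes on the first edge.
    have hdiff : k + k s(u, b) • walkChain (p.cons hab) = 0 := by
      set l := k + k s(u, b) • walkChain (p.cons hab) with hl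
      have hlk : edgeBoundary l = 0 := by
        rw [hl, map_add, map_smul, hk, edgeBoundary_walkChain, ZModModule.add_self, smul_zero,
          add_zero]
      have hl_supp (e : Sym2 V) (he : l e ≠ 0) : e ∈ p.edges := by
        have hec : e ∈ (p.cons hab).edges := by
          by_contra hec
          exact he (by simp [hl, walkChain_eq_zero hec, not_imp_comm.1 (hsupp e) hec])
        refine (List.mem_cons.1 hec).resolve_left ?_
        rintro rfl
        refine he ?_
        simp [hl, walkChain_eq_one hc.isTrail (e := s(u, b)) (by simp), ZModModule.add_self]
      obtain ⟨d, hd⟩ := exists_forall_mem_edges_eq hlk hp fun _ _ _ _ _ hu => hl_supp _ hu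
      have hlp : l = d • walkChain p := by
        ext e
        by_cases he : e ∈ p.edges
        · simp [hd e he, walkChain_eq_one hp.isTrail he]
        · simp [not_imp_comm.1 (hl_supp e) he, walkChain_eq_zero he]
      have hd_zero : d = 0 := by
        have := congrFun hlk b
        simpa [hlp, edgeBoundary_walkChain, hab.ne'] using this
      rw [hlp, hd_zero, zero_smul]
    rw [← ZModModule.sub_eq_add, sub_eq_zero] at hdiff
    have hbit : ∀ x : ZMod 2, x = 0 ∨ x = 1 := by decide
    rcases hbit (k s(u, b)) with h | h <;> rw [h] at hdiff
    · exact Or.inl (by rw [hdiff, zero_smul])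
    · exact Or.inr (by rw [hdiff, one_smul])

theorem eq_walkChain_of_theta [Fintype V] [DecidableEq V] {N P Q : G.Walk x z}
    (hNP : (N.append P.reverse).IsCycle) (hPQ : (P.append Q.reverse).IsCycle)
    {k : Sym2 V → ZMod 2} (hk : edgeBoundary k = 0) (hkN : ∀ e ∈ N.edges, k e = 1)
    (hsupp : ∀ e, k e ≠ 0 → e ∈ N.edges ∨ e ∈ P.edges ∨ e ∈ Q.edges) :
    k = walkChain (N.append P.reverse) ∨ k = walkChain (N.append Q.reverse) := by
  have hl : edgeBoundary (k + walkChain (N.append P.reverse)) = 0 := by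
    rw [map_add, hk, edgeBoundary_walkChain, ZModModule.add_self, add_zero]
  refine (eq_zero_or_eq_walkChain hPQ hl fun e he => ?_).imp (fun h => ?_) (fun h => ?_)
  · have heN : e ∉ N.edges := by
      intro heN
      have heNP : e ∈ (N.append P.reverse).edges := by simp [Walk.edges_append, heN]
      exact he (by simp [hkN e heN, walkChain_eq_one hNP.isTrail heNP, ZModModule.add_self])
    by_contra hePQ
    simp only [Walk.edges_append, Walk.edges_reverse, List.mem_append, List.mem_reverse,
      not_or] at hePQ
    have hke : k e = 0 := by
      by_contra hke
      rcases hsupp e hke with h | h | h <;> simp_all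
    have heNP : e ∉ (N.append P.reverse).edges := by
      simp [Walk.edges_append, Walk.edges_reverse, heN, hePQ.1]
    exact he (by simp [hke, walkChain_eq_zero heNP])
  · rwa [← ZModModule.sub_eq_add, sub_eq_zero] at h
  · rw [← ZModModule.sub_eq_add, sub_eq_iff_eq_add] at h
    rw [h]
    simp only [walkChain_append, walkChain_reverse]
    rw [add_comm, ZModModule.add_add_add_cancel]

end Theta

variable {V : Type*} [DecidableEq V]

namespace IsSphereTriangulation

variable [Fintype V] {T A : Finset (Finset V)}

theorem exists_subset_triangleBoundary_eq (hT : IsSphereTriangulation T) (hA : A ⊆ T) {x z : V}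
    {N P Q : (⊤ : SimpleGraph V).Walk x z}
    (hNP : (N.append P.reverse).IsCycle) (hNQ : (N.append Q.reverse).IsCycle)
    (hPQ : (P.append Q.reverse).IsCycle)
    (hb : triangleBoundary A = walkChain (P.append Q.reverse))
    (hN : ∀ e ∈ N.edges, ∃ t ∈ A, e ∈ triangleEdges t) :
    ∃ B ⊆ A, triangleBoundary B = walkChain (N.append P.reverse) := by
  have hA_eq_zero {e : Sym2 V} (heP : e ∉ P.edges) (heQ : e ∉ Q.edges) :
      triangleBoundary A e = 0 := by
    rw [hb, walkChain_eq_zero (by simp [Walk.edges_append, Walk.edges_reverse, heP, heQ])]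
  obtain ⟨B, hBT, hB⟩ := hT.homology (walkChain (N.append P.reverse)) (fun e he => by
    have heNP : e ∈ N.edges ∨ e ∈ P.edges := by
      simpa [Walk.edges_append, Walk.edges_reverse] using mem_edges_of_walkChain_ne_zero he
    obtain ⟨t, ht, het⟩ : ∃ t ∈ A, e ∈ triangleEdges t := by
      refine heNP.elim (hN e) fun heP => exists_mem_of_triangleBoundary_ne_zero ?_
      rw [hb, walkChain_eq_one hPQ.isTrail (by simp [Walk.edges_append, heP])]
      exact one_ne_zero
    exact ⟨t, hA ht, het⟩) (by rw [edgeBoundary_walkChain, ZModModule.add_self])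
  have hAB : A ∩ B ⊆ A := Finset.inter_subset_left
  have hkN (e : Sym2 V) (he : e ∈ N.edges) : triangleBoundary (A ∩ B) e = 1 := by
    obtain ⟨t, ht, het⟩ := hN e he
    have hAe := hA_eq_zero (fun h => disjoint_edges_of_isCycle hNP he h)
      (fun h => disjoint_edges_of_isCycle hNQ he h)
    rw [hT.triangleBoundary_inter hA hBT hAe ht het, hB,
      walkChain_eq_one hNP.isTrail (by simp [Walk.edges_append, he])]
  have hsupp (e : Sym2 V) (he : triangleBoundary (A ∩ B) e ≠ 0) :
      e ∈ N.edges ∨ e ∈ P.edges ∨ e ∈ Q.edges := by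
    by_contra! hNPQ
    obtain ⟨t, ht, het⟩ := exists_mem_of_triangleBoundary_ne_zero he
    rw [hT.triangleBoundary_inter hA hBT (hA_eq_zero hNPQ.2.1 hNPQ.2.2) (hAB ht) het, hB] at he
    simpa [Walk.edges_append, Walk.edges_reverse, hNPQ] using mem_edges_of_walkChain_ne_zero he
  have hk := edgeBoundary_triangleBoundary fun t ht => hT.card_eq t (hA (hAB ht))
  rcases eq_walkChain_of_theta hNP hPQ hk hkN hsupp with hk | hk
  · exact ⟨A ∩ B, hAB, hk⟩
  · refine ⟨A \ (A ∩ B), Finset.sdiff_subset, ?_⟩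
    rw [triangleBoundary_sdiff hAB, hb, hk]
    simp only [walkChain_append, walkChain_reverse]
    rw [add_comm (walkChain N), ZModModule.add_add_add_cancel, add_comm]

theorem isDisk_of_theta (hT : IsSphereTriangulation T) (hA : A ⊆ T)
    (ih : ∀ B ⊂ A, ∀ {u : V} {c : (⊤ : SimpleGraph V).Walk u u}, c.IsCycle →
      triangleBoundary B = walkChain c →
      IsDisk (realization (B : Set (Finset V))) (realization c.edgeSet)) {x z : V}
    (hxz : x ≠ z) {N P Q : (⊤ : SimpleGraph V).Walk x z}
    (hNP : (N.append P.reverse).IsCycle) (hNQ : (N.append Q.reverse).IsCycle)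
    (hPQ : (P.append Q.reverse).IsCycle)
    (hb : triangleBoundary A = walkChain (P.append Q.reverse))
    (hN : ∀ e ∈ N.edges, ∃ t ∈ A, e ∈ triangleEdges t) :
    IsDisk (realization (A : Set (Finset V))) (realization (P.append Q.reverse).edgeSet) := by
  obtain ⟨B, hBA, hbB⟩ := hT.exists_subset_triangleBoundary_eq hA hNP hNQ hPQ hb hN
  have hbAB : triangleBoundary (A \ B) = walkChain (N.append Q.reverse) := by
    rw [triangleBoundary_sdiff hBA, hb, hbB]
    simp only [walkChain_append, walkChain_reverse]
    rw [add_comm (walkChain N), add_comm (walkChain P), ZModModule.add_add_add_cancel, add_comm]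
  have hne {C : Finset (Finset V)} {R : (⊤ : SimpleGraph V).Walk x z}
      (hc : (N.append R.reverse).IsCycle)
      (hC : triangleBoundary C = walkChain (N.append R.reverse)) : C.Nonempty := by
    have he := Walk.mk_start_snd_mem_edges hc.not_nil
    obtain ⟨t, ht, -⟩ := exists_mem_of_triangleBoundary_ne_zero (A := C)
      (by rw [hC, walkChain_eq_one hc.isTrail he]; exact one_ne_zero)
    exact ⟨t, ht⟩
  have hssub : B ⊂ A := Finset.sdiff_nonempty.1 (hne hNQ hbAB) |> (⟨hBA, ·⟩)
  have hdiff : A \ B ⊂ A := Finset.sdiff_ssubset hBA (hne hNP hbB)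
  rw [← Finset.union_sdiff_of_subset hBA]
  exact hT.isDisk_union hxz hNP hNQ hPQ (hBA.trans hA) (Finset.sdiff_subset.trans hA)
    Finset.disjoint_sdiff hbB hbAB (ih B hssub hNP hbB) (ih (A \ B) hdiff hNQ hbAB)

theorem isDisk_of_ear (hT : IsSphereTriangulation T) (hA : A ⊆ T)
    (ih : ∀ B ⊂ A, ∀ {u : V} {c : (⊤ : SimpleGraph V).Walk u u}, c.IsCycle →
      triangleBoundary B = walkChain c →
      IsDisk (realization (B : Set (Finset V))) (realization c.edgeSet)) {u x z : V}
    {c : (⊤ : SimpleGraph V).Walk u u} (hc : c.IsCycle) (hb : triangleBoundary A = walkChain c)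
    (hx : x ∈ c.support) (hz : z ∈ c.support) (hxz : x ≠ z) {N : (⊤ : SimpleGraph V).Walk x z}
    (hNpath : N.IsPath) (hNc : N.edges.Disjoint c.edges)
    (hsupport : ∀ w ∈ N.support, w ∈ c.support → w = x ∨ w = z)
    (hN : ∀ e ∈ N.edges, ∃ t ∈ A, e ∈ triangleEdges t) :
    IsDisk (realization (A : Set (Finset V))) (realization c.edgeSet) := by
  obtain ⟨P, Q, hPQ, hperm, hsupp⟩ := exists_append_reverse_of_isCycle hc hx hz
  have hPN {R : (⊤ : SimpleGraph V).Walk x z} (hR : R.IsPath)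
      (hRc : ∀ e ∈ R.edges, e ∈ (P.append Q.reverse).edges)
      (hRs : ∀ w ∈ R.support, w ∈ (P.append Q.reverse).support) :
      (N.append R.reverse).IsCycle :=
    isCycle_append_reverse hNpath hR hxz (fun e heN heR => hNc heN (hperm.mem_iff.1 (hRc e heR)))
      fun w hwN hwR => hsupport w hwN ((hsupp w).1 (hRs w hwR))
  have hedges : (P.append Q.reverse).edgeSet = c.edgeSet := Set.ext fun e => hperm.mem_iff
  rw [← hedges]
  refine hT.isDisk_of_theta hA ih hxz (N := N)
    (hPN (hPQ.isPath_of_append_left (Walk.not_nil_of_ne hxz.symm)) ?_ ?_)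
    (hPN (by simpa using (hPQ.isPath_of_append_right (Walk.not_nil_of_ne hxz)).reverse) ?_ ?_)
    hPQ (hb.trans (funext fun e => ?_)) hN
  · simp +contextual [Walk.edges_append]
  · simp +contextual [Walk.mem_support_append_iff]
  · simp +contextual [Walk.edges_append, Walk.edges_reverse]
  · simp +contextual [Walk.mem_support_append_iff]
  · rw [walkChain, walkChain, hperm.count_eq]

theorem isDisk_of_chord (hT : IsSphereTriangulation T) (hA : A ⊆ T)
    (ih : ∀ B ⊂ A, ∀ {u : V} {c : (⊤ : SimpleGraph V).Walk u u}, c.IsCycle →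
      triangleBoundary B = walkChain c →
      IsDisk (realization (B : Set (Finset V))) (realization c.edgeSet)) {u x z : V}
    {c : (⊤ : SimpleGraph V).Walk u u} (hc : c.IsCycle) (hb : triangleBoundary A = walkChain c)
    (hx : x ∈ c.support) (hz : z ∈ c.support) (hxz : s(x, z) ∉ c.edges)
    (h : ∃ t ∈ A, s(x, z) ∈ triangleEdges t) :
    IsDisk (realization (A : Set (Finset V))) (realization c.edgeSet) := by
  obtain ⟨t, ht, htxz⟩ := h
  have hne := (mk_mem_triangleEdges.1 htxz).2.2
  refine hT.isDisk_of_ear hA ih hc hb hx hz hne (N := .cons hne .nil)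
    (by simpa using hne) (by simpa using hxz) (fun w hw _ => by simpa using hw) ?_
  simpa using ⟨t, ht, htxz⟩

theorem isDisk_of_triangleEdges_subset (hT : IsSphereTriangulation T) (hA : A ⊆ T) {u : V}
    {c : (⊤ : SimpleGraph V).Walk u u} (hc : c.IsCycle) (hb : triangleBoundary A = walkChain c)
    {t : Finset V} (ht : t ∈ A) (h : ∀ e ∈ triangleEdges t, e ∈ c.edges) :
    IsDisk (realization (A : Set (Finset V))) (realization c.edgeSet) := by
  obtain ⟨a, b, w, hab, haw, hbw, htabw⟩ := Finset.card_eq_three.1 (hT.card_eq t (hA ht))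
  have hedges : (triangleEdges t : Set (Sym2 V)) = {s(a, b), s(b, w), s(w, a)} := by
    rw [htabw, coe_triangleEdges_insert hab haw hbw]
  have htriangle (e : Sym2 V) : triangleBoundary {t} e = if e ∈ triangleEdges t then 1 else 0 :=
    Finset.sum_singleton _ _
  have hbt : triangleBoundary {t} = walkChain c := by
    refine (eq_zero_or_eq_walkChain hc (edgeBoundary_triangleBoundary ?_) ?_).resolve_left ?_
    · simpa using hT.card_eq t (hA ht)
    · exact fun e he => h e (by simpa [htriangle] using he)
    · intro h0
      have hmem : s(a, b) ∈ triangleEdges t := by simp [← Finset.mem_coe, hedges]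
      simpa [htriangle, hmem] using congrFun h0 s(a, b)
  have hAt : A \ {t} = ∅ := by
    refine (hT.connected _ (Finset.sdiff_subset.trans hA) ?_).resolve_right ?_
    · rw [triangleBoundary_sdiff (Finset.singleton_subset_iff.2 ht), hb, hbt, ZModModule.add_self]
    · intro h
      simpa using h.symm.subset (hA ht)
  have hct : c.edgeSet = triangleEdges t := by
    refine Subset.antisymm (fun e he => ?_) h
    have := htriangle e
    rw [hbt, walkChain_eq_one hc.isTrail he] at this
    by_contra het
    exact one_ne_zero (this.trans (if_neg het))
  rw [Finset.Subset.antisymm (Finset.sdiff_eq_empty_iff_subset.1 hAt)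
    (Finset.singleton_subset_iff.2 ht), hct, hedges, htabw, Finset.coe_singleton]
  exact isDisk_realization_triangle hab haw hbw

theorem isDisk_realization (hT : IsSphereTriangulation T) (hA : A ⊆ T) {u : V}
    {c : (⊤ : SimpleGraph V).Walk u u} (hc : c.IsCycle) (hb : triangleBoundary A = walkChain c) :
    IsDisk (realization (A : Set (Finset V))) (realization c.edgeSet) := by
  induction A using Finset.strongInduction generalizing u with
  | H A ih =>
    have ih' : ∀ B ⊂ A, ∀ {u : V} {c : (⊤ : SimpleGraph V).Walk u u}, c.IsCycle →
        triangleBoundary B = walkChain c →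
        IsDisk (realization (B : Set (Finset V))) (realization c.edgeSet) :=
      fun B hB _ _ hc hb => ih B hB (hB.subset.trans hA) hc hb
    obtain ⟨b, hub, hmem⟩ : ∃ b, (⊤ : SimpleGraph V).Adj u b ∧ s(u, b) ∈ c.edges :=
      ⟨c.snd, c.adj_snd hc.not_nil, Walk.mk_start_snd_mem_edges hc.not_nil⟩
    obtain ⟨t, ht, htub⟩ := exists_mem_of_triangleBoundary_ne_zero (A := A) (e := s(u, b))
      (by rw [hb, walkChain_eq_one hc.isTrail hmem]; exact one_ne_zero)
    obtain ⟨w, huw, hbw, htw⟩ := exists_eq_insert_of_mem_triangleEdges (hT.card_eq t (hA ht)) htub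
    have htriangle : (triangleEdges t : Set (Sym2 V)) = {s(u, b), s(b, w), s(w, u)} := by
      rw [htw, coe_triangleEdges_insert hub huw hbw]
    have hb_mem : b ∈ c.support := c.snd_mem_support_of_mem_edges hmem
    have hbwt : s(b, w) ∈ triangleEdges t := by simp [← Finset.mem_coe, htriangle]
    have hwut : s(w, u) ∈ triangleEdges t := by simp [← Finset.mem_coe, htriangle]
    by_cases hw : w ∈ c.support
    · by_cases hbwc : s(b, w) ∈ c.edges
      · by_cases hwuc : s(w, u) ∈ c.edges
        · refine hT.isDisk_of_triangleEdges_subset hA hc hb ht fun e he => ?_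
          rw [← Finset.mem_coe, htriangle] at he
          rcases he with rfl | rfl | rfl
          exacts [hmem, hbwc, hwuc]
        · exact hT.isDisk_of_chord hA ih' hc hb hw c.start_mem_support hwuc ⟨t, ht, hwut⟩
      · exact hT.isDisk_of_chord hA ih' hc hb hb_mem hw hbwc ⟨t, ht, hbwt⟩
    · have hwc (v : V) : s(v, w) ∉ c.edges := fun h => hw (c.snd_mem_support_of_mem_edges h)
      refine hT.isDisk_of_ear hA ih' hc hb c.start_mem_support hb_mem hub.ne
        (N := .cons huw (.cons hbw.symm .nil)) ?_ ?_ ?_ ?_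
      · simp [huw, hub.ne, hbw.symm]
      · simp [hwc, Sym2.eq_swap (a := w)]
      · rintro v hv hvc
        simp only [Walk.support_cons, Walk.support_nil, List.mem_cons, List.not_mem_nil] at hv
        grind
      · simp only [Walk.edges_cons, Walk.edges_nil, List.mem_cons, List.not_mem_nil, or_false]
        rintro e (rfl | rfl)
        exacts [⟨t, ht, Sym2.eq_swap ▸ hwut⟩, ⟨t, ht, Sym2.eq_swap ▸ hbwt⟩]

end IsSphereTriangulation

end Schoenflies

section StronglyConnected

open SimpleGraph

theorem exists_isCycle_of_edgeBoundary_eq_zero {V : Type*} [Fintype V] {k : Sym2 V → ZMod 2}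
    (hk : edgeBoundary k = 0) (hne : k ≠ 0) (hdiag : ∀ e, k e ≠ 0 → ¬e.IsDiag) :
    ∃ (x : V) (c : (⊤ : SimpleGraph V).Walk x x), c.IsCycle ∧ ∀ e ∈ c.edges, k e ≠ 0 := by
  let H := fromEdgeSet {e | k e ≠ 0}
  have hadj {x y : V} : H.Adj x y ↔ k s(x, y) ≠ 0 :=
    (fromEdgeSet_adj _).trans (and_iff_left_of_imp (hdiag s(x, y)))
  suffices hcycle : ¬H.IsAcyclic by
    simp only [IsAcyclic, not_forall, not_not] at hcycle
    obtain ⟨x, c, hc⟩ := hcycle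
    refine ⟨x, c.mapLe le_top, hc.mapLe le_top, fun e he => ?_⟩
    rw [Walk.edges_mapLe_eq_edges] at he
    induction e with
    | _ u v => exact hadj.1 (c.adj_of_mem_edges he)
  intro hacyclic
  obtain ⟨e, he⟩ : ∃ e, k e ≠ 0 := ne_iff.1 hne
  induction e with
  | _ a b =>
    have : Nonempty V := ⟨a⟩
    -- The start of a longest path of an acyclic graph has only one neighbour.
    obtain ⟨x, y, p, hp, hmax⟩ := Walk.exists_isPath_forall_isPath_length_le_length H
    have hnil : ¬p.Nil := by
      intro hnil
      have := hmax _ _ _ (Walk.IsPath.of_adj (hadj.2 he))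
      simp [hnil.length_eq_zero] at this
    have hunique (w : V) (hw : H.Adj x w) : w = p.snd := by
      refine hacyclic.eq_snd_of_adj_start hp hw ?_
      by_contra hwp
      have := hmax _ _ _ (hp.cons (h := hw.symm) hwp)
      simp at this
    refine hadj.1 (p.adj_snd hnil) ?_
    refine Eq.trans ?_ (congrFun hk x)
    rw [edgeBoundary_apply]
    exact (Finset.sum_eq_single _ (fun w _ hw => not_imp_comm.1 (hunique w ∘ hadj.2) hw)
      (by simp)).symm

variable {V : Type*} [DecidableEq V]

/-- A set of triangles is strongly connected if any two of its triangles are joined by a sequence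
of its triangles in which consecutive ones share an edge: no nonempty proper subset is closed under
passing to an adjacent triangle. -/
def StronglyConnected (A : Finset (Finset V)) : Prop :=
  ∀ B : Finset (Finset V),
    (∀ t ∈ A, ∀ t' ∈ A, ∀ e ∈ triangleEdges t, e ∈ triangleEdges t' → t ∈ B → t' ∈ B) →
      A ⊆ B ∨ Disjoint A B

namespace IsSphereTriangulation

variable [Fintype V] {T A B : Finset (Finset V)}

theorem subset_or_disjoint (hT : IsSphereTriangulation T) (hA : A ⊆ T) (hB : B ⊆ T)
    (hAs : StronglyConnected A) (h : ∀ e, triangleBoundary A e = 0 → triangleBoundary B e = 0) :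
    A ⊆ B ∨ Disjoint A B := by
  refine hAs B fun t ht t' ht' e he he' htB => ?_
  rcases eq_or_ne t t' with rfl | hne
  · exact htB
  · have hAe := hT.triangleBoundary_eq_zero_of_mem hA ht ht' hne he he'
    exact hT.mem_of_triangleBoundary_eq_zero hB (h e hAe) htB he (hA ht') he'

theorem triangleBoundary_compl (hT : IsSphereTriangulation T) (hA : A ⊆ T) :
    triangleBoundary (T \ A) = triangleBoundary A := by
  rw [triangleBoundary_sdiff hA, hT.triangleBoundary_self, zero_add]

theorem triangleBoundary_eq_of_stronglyConnected (hT : IsSphereTriangulation T) (hA : A ⊆ T)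
    (hB : B ⊆ T) (hAs : StronglyConnected A) (hAs' : StronglyConnected (T \ A))
    (h : ∀ e, triangleBoundary A e = 0 → triangleBoundary B e = 0)
    (hne : triangleBoundary B ≠ 0) : triangleBoundary B = triangleBoundary A := by
  have hor := hT.subset_or_disjoint hA hB hAs h
  have hor' := hT.subset_or_disjoint Finset.sdiff_subset hB hAs'
    fun e => hT.triangleBoundary_compl hA ▸ h e
  rw [Finset.disjoint_left] at hor hor'
  rcases hor with h₁ | h₁ <;> rcases hor' with h₂ | h₂
  · refine absurd ?_ hne
    rw [show B = T by grind, hT.triangleBoundary_self]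
  · rw [show B = A by grind]
  · rw [show B = T \ A by grind, hT.triangleBoundary_compl hA]
  · refine absurd ?_ hne
    rw [show B = ∅ by grind]
    exact funext fun _ => Finset.sum_empty

theorem exists_isDisk (hT : IsSphereTriangulation T) (hA : A ⊆ T) (hne : A.Nonempty)
    (hne' : A ≠ T) (hAs : StronglyConnected A) (hAs' : StronglyConnected (T \ A)) :
    ∃ S, IsDisk (realization (A : Set (Finset V))) S := by
  have hA_ne : triangleBoundary A ≠ 0 := fun h => (hT.connected A hA h).elim hne.ne_empty hne'
  obtain ⟨x, c, hc, hcA⟩ := exists_isCycle_of_edgeBoundary_eq_zero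
    (edgeBoundary_triangleBoundary fun t ht => hT.card_eq t (hA ht)) hA_ne fun e he => by
      obtain ⟨t, -, het⟩ := exists_mem_of_triangleBoundary_ne_zero he
      exact (Finset.mem_filter.1 het).2
  have hc_zero (e : Sym2 V) (he : triangleBoundary A e = 0) : walkChain c e = 0 :=
    walkChain_eq_zero fun hec => hcA e hec he
  obtain ⟨B, hB, hbB⟩ := hT.homology (walkChain c) (fun e he => by
    obtain ⟨t, ht, het⟩ := exists_mem_of_triangleBoundary_ne_zero (mt (hc_zero e) he)
    exact ⟨t, hA ht, het⟩) (by rw [edgeBoundary_walkChain, ZModModule.add_self])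
  have hB_ne : triangleBoundary B ≠ 0 := by
    rw [hbB]
    intro h
    have := walkChain_eq_one hc.isTrail (Walk.mk_start_snd_mem_edges hc.not_nil)
    rw [h] at this
    exact zero_ne_one this
  have hb := hT.triangleBoundary_eq_of_stronglyConnected hA hB hAs hAs' (hbB ▸ hc_zero) hB_ne
  exact ⟨_, hT.isDisk_realization hA hc (hb.symm.trans hbB)⟩

end IsSphereTriangulation

end StronglyConnected

section Invariants

variable {D X : Type*}

theorem eq_of_mem_closure {s : Set (Equiv.Perm D)} {b : D → X} (hb : ∀ σ ∈ s, ∀ d, b (σ d) = b d)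
    {g : Equiv.Perm D} (hg : g ∈ Subgroup.closure s) (d : D) : b (g d) = b d := by
  induction hg using Subgroup.closure_induction generalizing d with
  | mem σ hσ => exact hb σ hσ d
  | one => rfl
  | mul σ τ _ _ hσ hτ => rw [Equiv.Perm.mul_apply, hσ, hτ]
  | inv σ _ hσ => rw [← hσ, Equiv.Perm.coe_inv, Equiv.apply_symm_apply]

theorem eq_of_sameCycle {σ : Equiv.Perm D} {b : D → X} (hb : ∀ d, b (σ d) = b d) {x y : D}
    (h : σ.SameCycle x y) : b x = b y := by
  obtain ⟨i, rfl⟩ := h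
  exact (eq_of_mem_closure (s := {σ}) (by simpa using hb)
    (Subgroup.zpow_mem _ (Subgroup.mem_closure_singleton_self σ) i) x).symm

theorem exists_iterate_eq_of_sameCycle [Finite D] {σ : Equiv.Perm D} {x y : D}
    (h : σ.SameCycle x y) : ∃ i < minimalPeriod σ x, σ^[i] x = y := by
  obtain ⟨n, hn⟩ := h.exists_nat_pow_eq
  have hpos : 0 < minimalPeriod σ x :=
    minimalPeriod_pos_of_mem_periodicPts (σ.injective.mem_periodicPts x)
  exact ⟨n % minimalPeriod σ x, Nat.mod_lt _ hpos, by
    rw [iterate_mod_minimalPeriod_eq, Equiv.Perm.iterate_eq_pow, hn]⟩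

/-- The functions modulo two which are invariant under a permutation. -/
def invariants (σ : Equiv.Perm D) : Submodule (ZMod 2) (D → ZMod 2) where
  carrier := {b | ∀ d, b (σ d) = b d}
  add_mem' ha hb d := congrArg₂ (· + ·) (ha d) (hb d)
  zero_mem' _ := rfl
  smul_mem' c _ hb d := congrArg (c • ·) (hb d)

theorem exists_comp_mk_eq {σ : Equiv.Perm D} {b : D → X} (hb : ∀ d, b (σ d) = b d) :
    ∃ g : Quotient (Equiv.Perm.SameCycle.setoid σ) → X, g ∘ Quotient.mk _ = b :=
  ⟨Quotient.lift b fun _ _ h => eq_of_sameCycle hb h, rfl⟩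

theorem finrank_invariants [Finite D] (σ : Equiv.Perm D) :
    Module.finrank (ZMod 2) (invariants σ) =
      Nat.card (Quotient (Equiv.Perm.SameCycle.setoid σ)) := by
  classical
  have := Fintype.ofFinite (Quotient (Equiv.Perm.SameCycle.setoid σ))
  have h : invariants σ = LinearMap.range (LinearMap.funLeft (ZMod 2) (ZMod 2)
      (Quotient.mk (Equiv.Perm.SameCycle.setoid σ))) := by
    ext b
    refine ⟨exists_comp_mk_eq, ?_⟩
    rintro ⟨g, rfl⟩ d
    exact congrArg g (Quotient.sound (Equiv.Perm.sameCycle_apply_left.2 (.refl σ d)))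
  rw [h, LinearMap.finrank_range_of_inj (LinearMap.funLeft_injective_of_surjective _ _ _
    Quotient.mk_surjective), Module.finrank_fintype_fun_eq_card, Nat.card_eq_fintype_card]

end Invariants

section FiberSum

variable {D Q : Type*} [Fintype D]

open scoped Classical in
/-- The pushforward of a chain modulo two along a map. -/
noncomputable def fiberSum (f : D → Q) : (D → ZMod 2) →ₗ[ZMod 2] (Q → ZMod 2) where
  toFun K q := ∑ d with f d = q, K d
  map_add' _ _ := funext fun _ => Finset.sum_add_distrib
  map_smul' _ _ := funext fun _ => Finset.mul_sum _ _ _ |>.symm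

open scoped Classical in
theorem fiberSum_apply (f : D → Q) (K : D → ZMod 2) (q : Q) :
    fiberSum f K q = ∑ d with f d = q, K d := rfl

theorem fiberSum_single [DecidableEq D] [DecidableEq Q] (f : D → Q) (d : D) :
    fiberSum f (Pi.single d 1) = Pi.single (f d) 1 := by
  ext q
  simp [fiberSum_apply, Pi.single_apply, eq_comm]

theorem dotProduct_fiberSum [Fintype Q] (f : D → Q) (g : Q → ZMod 2) (K : D → ZMod 2) :
    g ⬝ᵥ fiberSum f K = (g ∘ f) ⬝ᵥ K := by
  classical
  simp only [dotProduct, fiberSum_apply, Finset.mul_sum]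
  rw [← Finset.sum_fiberwise (s := Finset.univ) (g := f)]
  refine Finset.sum_congr rfl fun q _ => Finset.sum_congr rfl fun d hd => ?_
  rw [comp_apply, (Finset.mem_filter.1 hd).2]

theorem dotProductBilin_nondegenerate {R : Type*} [CommRing R] :
    LinearMap.BilinForm.Nondegenerate
      (dotProductBilin R R : LinearMap.BilinForm R (D → R)) :=
  ⟨dotProduct_eq_zero, fun a h => dotProduct_eq_zero a fun w => (dotProduct_comm a w).trans (h w)⟩

theorem fiberSum_comp_perm {f : D → Q} {σ : Equiv.Perm D} (hσ : ∀ d, f (σ d) = f d)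
    (K : D → ZMod 2) :
    fiberSum f (K ∘ σ) = fiberSum f K := by
  classical
  ext q
  simp only [fiberSum_apply, Finset.sum_filter]
  rw [← Equiv.sum_comp σ fun d => if f d = q then K d else 0]
  simp only [hσ, comp_apply]

theorem fiberSum_comp_apply {X : Type*} {f : D → Q} {g : Q → X} (hg : Injective g)
    (K : D → ZMod 2) (q : Q) :
    fiberSum (g ∘ f) K (g q) = fiberSum f K q := by
  classical
  simp only [fiberSum_apply, comp_apply, hg.eq_iff]

end FiberSum

namespace DoodleDiagram

section Cells

variable {D : Type*} [Finite D] (M : DoodleDiagram D)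

theorem vertexOf_eq_iff {d d' : D} : M.vertexOf d = M.vertexOf d' ↔ M.rot.SameCycle d d' :=
  Quotient.eq (r := Equiv.Perm.SameCycle.setoid M.rot)

theorem regionOf_eq_iff {d d' : D} :
    M.regionOf d = M.regionOf d' ↔ (M.rot * M.rev).SameCycle d d' :=
  Quotient.eq (r := Equiv.Perm.SameCycle.setoid (M.rot * M.rev))

theorem vertexOf_rot (d : D) : M.vertexOf (M.rot d) = M.vertexOf d :=
  M.vertexOf_eq_iff.2 (Equiv.Perm.sameCycle_apply_left.2 (.refl _ d))

theorem vertexOf_rot_symm (d : D) : M.vertexOf (M.rot.symm d) = M.vertexOf d := by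
  rw [← vertexOf_rot, Equiv.apply_symm_apply]

theorem regionOf_rot_rev (d : D) : M.regionOf (M.rot (M.rev d)) = M.regionOf d :=
  M.regionOf_eq_iff.2 (Equiv.Perm.sameCycle_apply_left (f := M.rot * M.rev).2 (.refl _ d))

theorem regionOf_rot (d : D) : M.regionOf (M.rot d) = M.regionOf (M.rev d) := by
  rw [← M.regionOf_rot_rev (M.rev d), M.rev_rev]

theorem vertexOf_surjective : Surjective M.vertexOf := Quotient.mk_surjective
theorem edgeOf_surjective : Surjective M.edgeOf := Quotient.mk_surjective
theorem regionOf_surjective : Surjective M.regionOf := Quotient.mk_surjective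

theorem edgeOf_eq_iff {d d' : D} : M.edgeOf d = M.edgeOf d' ↔ d' = d ∨ d' = M.rev d := by
  have h : M.edgeOf d = M.edgeOf d' ↔ M.rev.SameCycle d d' :=
    Quotient.eq (r := Equiv.Perm.SameCycle.setoid M.rev)
  rw [h]
  constructor
  · intro h
    obtain ⟨i, hi, rfl⟩ := exists_iterate_eq_of_sameCycle h
    have hi2 : i < 2 :=
      hi.trans_le (IsPeriodicPt.minimalPeriod_le two_pos (M.rev_rev d))
    interval_cases i
    · exact Or.inl rfl
    · exact Or.inr rfl
  · rintro (rfl | rfl)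
    · exact .refl _ _
    · exact Equiv.Perm.sameCycle_apply_right.2 (.refl _ _)

theorem edgeOf_rev (d : D) : M.edgeOf (M.rev d) = M.edgeOf d :=
  (M.edgeOf_eq_iff.2 (Or.inr rfl)).symm

theorem rot_four (d : D) : M.rot (M.rot (M.rot (M.rot d))) = d := by
  have h := isPeriodicPt_minimalPeriod M.rot d
  rwa [M.four_valent d] at h

theorem iterate_rot_ne {n : ℕ} (hn : n ≠ 0) (hn' : n < 4) (d : D) : M.rot^[n] d ≠ d :=
  not_isPeriodicPt_of_pos_of_lt_minimalPeriod hn (hn'.trans_eq (M.four_valent d).symm)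

theorem rot_ne (d : D) : M.rot d ≠ d := M.iterate_rot_ne one_ne_zero (by norm_num) d

theorem rot_two_ne (d : D) : M.rot (M.rot d) ≠ d := M.iterate_rot_ne two_ne_zero (by norm_num) d

theorem rot_three_ne (d : D) : M.rot (M.rot (M.rot d)) ≠ d :=
  M.iterate_rot_ne three_ne_zero (by norm_num) d

theorem eq_rot_of_vertexOf_eq {d d' : D} (h : M.vertexOf d = M.vertexOf d') :
    d' = d ∨ d' = M.rot d ∨ d' = M.rot (M.rot d) ∨ d' = M.rot (M.rot (M.rot d)) := by
  obtain ⟨i, hi, rfl⟩ := exists_iterate_eq_of_sameCycle (M.vertexOf_eq_iff.1 h)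
  rw [M.four_valent] at hi
  interval_cases i <;> simp

theorem eq_of_invariant {X : Type*} {b : D → X} (hrot : ∀ d, b (M.rot d) = b d)
    (hrev : ∀ d, b (M.rev d) = b d) (d d' : D) : b d = b d' := by
  obtain ⟨⟨g, hg⟩, rfl⟩ := M.connected.exists_smul_eq d d'
  refine (eq_of_mem_closure ?_ hg d).symm
  rintro σ (rfl | rfl) <;> assumption

theorem nonempty_darts {D : Type*} [Finite D] (M : DoodleDiagram D) : Nonempty D := by
  by_contra h
  rw [not_nonempty_iff] at h
  have hcard (s : Setoid D) : Nat.card (Quotient s) = 0 :=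
    have : IsEmpty (Quotient s) := ⟨fun q => q.exists_rep.elim fun d _ => h.elim d⟩
    Nat.card_of_isEmpty
  simpa only [hcard, zero_add, OfNat.zero_ne_ofNat] using M.spherical

theorem card_darts : Nat.card D = 2 * Nat.card (Quotient (Equiv.Perm.SameCycle.setoid M.rev)) := by
  classical
  have := Fintype.ofFinite D
  have := Fintype.ofFinite M.Edge
  change _ = 2 * Nat.card M.Edge
  rw [Nat.card_eq_fintype_card, Nat.card_eq_fintype_card, ← Finset.card_univ,
    Finset.card_eq_sum_card_fiberwise (f := M.edgeOf) (t := Finset.univ) (by simp),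
    Finset.sum_const_nat (m := 2), Finset.card_univ, mul_comm]
  intro e _
  obtain ⟨d, rfl⟩ := M.edgeOf_surjective e
  have hfiber : ({x | M.edgeOf x = M.edgeOf d} : Finset D) = {d, M.rev d} := by
    ext x
    simp [eq_comm (b := M.edgeOf d), edgeOf_eq_iff]
  rw [hfiber, Finset.card_pair (M.rev_ne d).symm]

end Cells

section Corners

variable {D : Type*} [Finite D] (M : DoodleDiagram D)

/-- The coboundary of a set of darts: the corners that separate a dart of the set from one outside.
A corner of the diagram is encoded by the later one of the two successive darts that bound it, so
that it lies at the vertex and in the region of this dart. -/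
def cornerMap : (D → ZMod 2) →ₗ[ZMod 2] (D → ZMod 2) :=
  LinearMap.id + LinearMap.funLeft (ZMod 2) (ZMod 2) M.rot.symm

theorem cornerMap_apply (a : D → ZMod 2) (d : D) : M.cornerMap a d = a d + a (M.rot.symm d) := rfl

theorem cornerMap_rot (a : D → ZMod 2) (d : D) : M.cornerMap a (M.rot d) = a (M.rot d) + a d := by
  rw [cornerMap_apply, Equiv.symm_apply_apply]

theorem finrank_eq_one_of_constant {D : Type*} [Finite D] (M : DoodleDiagram D)
    {W : Submodule (ZMod 2) (D → ZMod 2)} (h1 : 1 ∈ W)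
    (h : ∀ a ∈ W, ∀ d d', a d = a d') : Module.finrank (ZMod 2) W = 1 := by
  obtain ⟨d₀⟩ := M.nonempty_darts
  refine finrank_eq_one (⟨1, h1⟩ : W) (fun h0 => ?_) fun a => ⟨a.1 d₀, ?_⟩
  · exact one_ne_zero (congrFun (congrArg Subtype.val h0) d₀)
  · ext d
    simpa using h a.1 a.2 d₀ d

theorem finrank_invariants_inf :
    Module.finrank (ZMod 2)
      (invariants M.rot ⊓ invariants (M.rot * M.rev) : Submodule (ZMod 2) (D → ZMod 2)) = 1 := by
  refine M.finrank_eq_one_of_constant ⟨fun _ => rfl, fun _ => rfl⟩ ?_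
  rintro a ⟨hrot, hregion⟩
  exact M.eq_of_invariant hrot fun d => (hrot _).symm.trans (hregion d)

theorem finrank_ker_cornerMap :
    Module.finrank (ZMod 2)
      (LinearMap.ker (M.cornerMap.domRestrict (invariants M.rev))) = 1 := by
  rw [← Submodule.finrank_map_subtype_eq (invariants M.rev)]
  refine M.finrank_eq_one_of_constant ?_ ?_
  · exact ⟨⟨1, fun _ => rfl⟩, funext fun _ => ZModModule.add_self (1 : ZMod 2), rfl⟩
  · rintro _ ⟨⟨a, hrev⟩, h, rfl⟩
    refine M.eq_of_invariant (fun d => CharTwo.add_eq_zero.1 ?_) hrev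
    rw [Submodule.subtype_apply, ← cornerMap_rot]
    exact congrFun h (M.rot d)

variable {D : Type*} [Fintype D] (M : DoodleDiagram D)

theorem dotProduct_cornerMap_eq_zero {σ : Equiv.Perm D} {a b : D → ZMod 2} (hb : b ∈ invariants σ)
    (ha : ∀ d, a (M.rot.symm (σ d)) = a d) : b ⬝ᵥ M.cornerMap a = 0 := by
  have h : ∑ d, b d * a (M.rot.symm d) = ∑ d, b d * a d := by
    rw [← Equiv.sum_comp σ]
    exact Finset.sum_congr rfl fun d _ => by rw [hb d, ha d]
  simp only [dotProduct, cornerMap_apply, mul_add, Finset.sum_add_distrib, h]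
  exact ZModModule.add_self _

theorem dotProduct_cornerMap_vertex {a b : D → ZMod 2} (hb : b ∈ invariants M.rot) :
    b ⬝ᵥ M.cornerMap a = 0 :=
  M.dotProduct_cornerMap_eq_zero hb fun d => by rw [Equiv.symm_apply_apply]

theorem dotProduct_cornerMap_region {a b : D → ZMod 2} (ha : a ∈ invariants M.rev)
    (hb : b ∈ invariants (M.rot * M.rev)) : b ⬝ᵥ M.cornerMap a = 0 :=
  M.dotProduct_cornerMap_eq_zero hb fun d => by
    rw [Equiv.Perm.mul_apply, Equiv.symm_apply_apply, ha d]

-- One inclusion is the orthogonality above; Euler's formula makes the dimensions agree.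
theorem map_cornerMap_invariants_rev :
    (invariants M.rev).map M.cornerMap =
      LinearMap.BilinForm.orthogonal (dotProductBilin (ZMod 2) (ZMod 2))
        (invariants M.rot ⊔ invariants (M.rot * M.rev)) := by
  refine Submodule.eq_of_le_of_finrank_eq ?_ ?_
  · rintro _ ⟨a, ha, rfl⟩ b hb
    obtain ⟨b₁, h₁, b₂, h₂, rfl⟩ := Submodule.mem_sup.1 hb
    change (b₁ + b₂) ⬝ᵥ _ = 0
    rw [add_dotProduct, M.dotProduct_cornerMap_vertex h₁, M.dotProduct_cornerMap_region ha h₂,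
      add_zero]
  · have hrank := LinearMap.finrank_range_add_finrank_ker
      (M.cornerMap.domRestrict (invariants M.rev))
    have hsup := Submodule.finrank_sup_add_finrank_inf_eq (invariants M.rot)
      (invariants (M.rot * M.rev))
    have horth := LinearMap.BilinForm.finrank_orthogonal (dotProductBilin_nondegenerate (D := D))
      (invariants M.rot ⊔ invariants (M.rot * M.rev))
    rw [LinearMap.range_domRestrict, M.finrank_ker_cornerMap, finrank_invariants] at hrank
    rw [M.finrank_invariants_inf, finrank_invariants, finrank_invariants] at hsup
    rw [Module.finrank_fintype_fun_eq_card, ← Nat.card_eq_fintype_card, M.card_darts] at horth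
    have := M.spherical
    omega

theorem exists_cornerMap_eq {K : D → ZMod 2} (hV : fiberSum M.vertexOf K = 0)
    (hF : fiberSum M.regionOf K = 0) :
    ∃ a : D → ZMod 2, (∀ d, a (M.rev d) = a d) ∧ M.cornerMap a = K := by
  suffices hK : K ∈ (invariants M.rev).map M.cornerMap from hK
  rw [map_cornerMap_invariants_rev]
  intro b hb
  obtain ⟨b₁, h₁, b₂, h₂, rfl⟩ := Submodule.mem_sup.1 hb
  have := Fintype.ofFinite M.Vertex
  have := Fintype.ofFinite M.Region
  obtain ⟨g₁, rfl⟩ : ∃ g : M.Vertex → ZMod 2, g ∘ M.vertexOf = b₁ := exists_comp_mk_eq h₁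
  obtain ⟨g₂, rfl⟩ : ∃ g : M.Region → ZMod 2, g ∘ M.regionOf = b₂ := exists_comp_mk_eq h₂
  have e₁ : (g₁ ∘ M.vertexOf) ⬝ᵥ K = 0 := by
    rw [← dotProduct_fiberSum M.vertexOf g₁, hV, dotProduct_zero]
  have e₂ : (g₂ ∘ M.regionOf) ⬝ᵥ K = 0 := by
    rw [← dotProduct_fiberSum M.regionOf g₂, hF, dotProduct_zero]
  exact (add_dotProduct _ _ K).trans ((congrArg₂ (· + ·) e₁ e₂).trans (add_zero 0))

theorem fiberSum_regionOf_cornerMap {a : D → ZMod 2} (ha : ∀ d, a (M.rev d) = a d) :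
    fiberSum M.regionOf (M.cornerMap a) = 0 := by
  classical
  have := Fintype.ofFinite M.Region
  refine dotProduct_eq_zero _ fun g => ?_
  rw [dotProduct_comm, dotProduct_fiberSum]
  exact M.dotProduct_cornerMap_region ha fun d => congrArg g (M.regionOf_rot_rev d)

end Corners

end DoodleDiagram

section KConnected

variable {V X : Type*} {G : SimpleGraph V} {k : ℕ}

theorem eq_of_reachable {f : V → X} (hf : ∀ u v, G.Adj u v → f u = f v) {u v : V}
    (h : G.Reachable u v) : f u = f v := by
  obtain ⟨p⟩ := h
  induction p with
  | nil => rfl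
  | cons hadj _ ih => exact (hf _ _ hadj).trans ih

theorem exists_notMem_of_isKConnected (hG : G.IsKConnected k) {S : Finset V} (hS : S.card ≤ k) :
    ∃ v, v ∉ S := by
  have := Nat.finite_of_card_ne_zero (pos_of_gt hG.1).ne'
  have := Fintype.ofFinite V
  have hlt : S.card < (Finset.univ : Finset V).card := by
    rw [Finset.card_univ, ← Nat.card_eq_fintype_card]
    exact hS.trans_lt hG.1
  obtain ⟨v, -, hv⟩ := Finset.exists_mem_notMem_of_card_lt_card hlt
  exact ⟨v, hv⟩

theorem le_ncard_neighborSet_of_isKConnected [Finite V] (hG : G.IsKConnected k) (v : V) :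
    k ≤ (G.neighborSet v).ncard := by
  classical
  by_contra! hlt
  set S := (toFinite (G.neighborSet v)).toFinset with hS
  have hmem {w : V} : w ∈ S ↔ G.Adj v w := by simp [hS]
  have hcard : S.card < k := by rwa [hS, ← ncard_eq_toFinset_card]
  obtain ⟨w, hw⟩ := exists_notMem_of_isKConnected hG (S := insert v S)
    ((Finset.card_insert_le _ _).trans hcard)
  rw [Finset.mem_insert, not_or] at hw
  have hv : v ∉ S := fun h => G.irrefl (hmem.1 h)
  obtain ⟨p⟩ := (hG.2 S hcard).preconnected ⟨v, hv⟩ ⟨w, hw.2⟩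
  cases p with
  | nil => exact hw.1 rfl
  | @cons _ x _ h _ => exact x.2 (hmem.2 h)

end KConnected

namespace DoodleDiagram

section Target

variable {D : Type*} [Finite D] (M : DoodleDiagram D)

/-- The vertex at the end of a dart. -/
def target (d : D) : M.Vertex := M.vertexOf (M.rev d)

theorem target_rev (d : D) : M.target (M.rev d) = M.vertexOf d := by
  rw [target, M.rev_rev]

theorem vertexOf_iterate_rot (n : ℕ) (d : D) : M.vertexOf (M.rot^[n] d) = M.vertexOf d := by
  induction n with
  | zero => rfl
  | succ n ih => rw [iterate_succ_apply', vertexOf_rot, ih]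

theorem ncard_setOf_vertexOf_eq_le (v : M.Vertex) : {d | M.vertexOf d = v}.ncard ≤ 4 := by
  classical
  obtain ⟨d, rfl⟩ := M.vertexOf_surjective v
  have hsub : {x | M.vertexOf x = M.vertexOf d} ⊆
      ({d, M.rot d, M.rot (M.rot d), M.rot (M.rot (M.rot d))} : Finset D) := fun x hx => by
    simpa using M.eq_rot_of_vertexOf_eq (Eq.symm hx)
  exact (ncard_le_ncard hsub).trans ((ncard_coe_finset _).trans_le Finset.card_le_four)

variable {M}

theorem IsSuperPrime.eq_of_notMem (hM : M.IsSuperPrime) {S : Finset M.Vertex} (hS : S.card < 4)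
    {X : Type*} {f : M.Vertex → X}
    (hf : ∀ d, M.vertexOf d ∉ S → M.target d ∉ S → f (M.vertexOf d) = f (M.target d))
    {v w : M.Vertex} (hv : v ∉ S) (hw : w ∉ S) : f v = f w := by
  refine eq_of_reachable (f := fun x : {v // v ∉ S} => f x) ?_
    ((hM.2 S hS).preconnected ⟨v, hv⟩ ⟨w, hw⟩)
  rintro ⟨_, hx⟩ ⟨_, hy⟩ ⟨-, d, rfl, rfl⟩
  exact hf d hx hy

theorem neighborSet_subset_image_target (v : M.Vertex) :
    M.graph.neighborSet v ⊆ M.target '' {d | M.vertexOf d = v} := by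
  rintro w ⟨-, d, hd, rfl⟩
  exact ⟨d, hd, rfl⟩

theorem IsSuperPrime.image_target (hM : M.IsSuperPrime) (v : M.Vertex) :
    M.target '' {d | M.vertexOf d = v} = M.graph.neighborSet v :=
  (eq_of_subset_of_ncard_le (neighborSet_subset_image_target v)
    (((ncard_image_le (toFinite _)).trans (M.ncard_setOf_vertexOf_eq_le v)).trans
      (le_ncard_neighborSet_of_isKConnected hM v)) (toFinite _)).symm

theorem IsSuperPrime.target_ne (hM : M.IsSuperPrime) (d : D) : M.target d ≠ M.vertexOf d := by
  have hadj : M.target d ∈ M.graph.neighborSet (M.vertexOf d) :=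
    (hM.image_target _).subset (mem_image_of_mem _ rfl)
  exact hadj.1.symm

theorem IsSuperPrime.eq_of_target_eq (hM : M.IsSuperPrime) {d d' : D}
    (h : M.vertexOf d = M.vertexOf d') (h' : M.target d = M.target d') : d = d' := by
  have hinj : InjOn M.target {x | M.vertexOf x = M.vertexOf d'} := by
    refine (ncard_image_iff (toFinite _)).1 (le_antisymm (ncard_image_le (toFinite _)) ?_)
    rw [hM.image_target]
    exact (M.ncard_setOf_vertexOf_eq_le _).trans (le_ncard_neighborSet_of_isKConnected hM _)
  exact hinj h rfl h'

end Target

section Separation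

variable {D : Type*} [Finite D] {M : DoodleDiagram D}

theorem eq_of_cornerMap_eq_zero {a : D → ZMod 2} {v : M.Vertex}
    (ha : ∀ d, M.vertexOf d = v → M.cornerMap a d = 0) {x y : D} (hx : M.vertexOf x = v)
    (hy : M.vertexOf y = v) : a x = a y := by
  classical
  have h := eq_of_sameCycle (b := fun d => if M.vertexOf d = v then a d else 0) (fun d => by
    rw [vertexOf_rot]
    split_ifs with hd
    · exact CharTwo.add_eq_zero.1 (M.cornerMap_rot a d ▸ ha _ ((M.vertexOf_rot d).trans hd))
    · rfl) (M.vertexOf_eq_iff.1 (hx.trans hy.symm))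
  rwa [if_pos hx, if_pos hy] at h

-- The coboundary is constant on the darts that are not inside `S`, since `S` does not separate.
theorem IsSuperPrime.exists_cornerMap_eq {D : Type*} [Fintype D] {M : DoodleDiagram D}
    (hM : M.IsSuperPrime) {K : D → ZMod 2}
    (hV : fiberSum M.vertexOf K = 0) (hF : fiberSum M.regionOf K = 0) {S : Finset M.Vertex}
    (hS : S.card < 4) (hK : ∀ d, M.vertexOf d ∉ S → K d = 0) :
    ∃ a : D → ZMod 2, M.cornerMap a = K ∧
      ∀ d, a d ≠ 0 → M.vertexOf d ∈ S ∧ M.target d ∈ S := by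
  obtain ⟨a, ha, rfl⟩ := M.exists_cornerMap_eq hV hF
  obtain ⟨w, hw⟩ := exists_notMem_of_isKConnected hM hS.le
  set s := surjInv M.vertexOf_surjective
  have hs (v : M.Vertex) : M.vertexOf (s v) = v := surjInv_eq _ v
  have hvertex {d : D} {v : M.Vertex} (hd : M.vertexOf d = v) (hv : v ∉ S) : a d = a (s v) :=
    eq_of_cornerMap_eq_zero (fun x hx => hK x (hx ▸ hv)) hd (hs v)
  have hconst {v : M.Vertex} (hv : v ∉ S) : a (s v) = a (s w) :=
    hM.eq_of_notMem hS (f := fun v => a (s v))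
      (fun d hd hd' => (hvertex rfl hd).symm.trans ((ha d).symm.trans (hvertex rfl hd'))) hv hw
  refine ⟨a + fun _ => a (s w), ?_, fun d hd => ?_⟩
  · ext d
    simp only [cornerMap_apply, Pi.add_apply]
    rw [add_add_add_comm, ZModModule.add_self, add_zero]
  · contrapose! hd
    rw [Pi.add_apply, CharTwo.add_eq_zero]
    by_cases hv : M.vertexOf d ∈ S
    · exact (ha d).symm.trans ((hvertex rfl (hd hv)).trans (hconst (hd hv)))
    · rw [hvertex rfl hv, hconst hv]

theorem IsSuperPrime.eq_of_vertexOf_of_regionOf (hM : M.IsSuperPrime) {d d' : D}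
    (h : M.vertexOf d = M.vertexOf d') (h' : M.regionOf d = M.regionOf d') : d = d' := by
  classical
  have := Fintype.ofFinite D
  obtain ⟨a, ha, haS⟩ := hM.exists_cornerMap_eq (K := Pi.single d 1 + Pi.single d' 1)
    (S := {M.vertexOf d})
    (by simp only [map_add, fiberSum_single, h, ZModModule.add_self])
    (by simp only [map_add, fiberSum_single, h', ZModModule.add_self])
    (by simp) (by grind [Pi.add_apply])
  have hzero : a = 0 := by
    ext x
    by_contra hx
    obtain ⟨h₁, h₂⟩ := haS x hx
    rw [Finset.mem_singleton] at h₁ h₂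
    exact hM.target_ne x (h₂.trans h₁.symm)
  by_contra hne
  simpa [hzero, hne] using congrFun ha d

theorem IsSuperPrime.regionOf_rev_ne (hM : M.IsSuperPrime) (d : D) :
    M.regionOf (M.rev d) ≠ M.regionOf d := fun h => by
  rw [← regionOf_rot] at h
  exact M.rot_ne d (hM.eq_of_vertexOf_of_regionOf (M.vertexOf_rot d) h)

end Separation

section Contact

variable {D : Type*} [Finite D] (M : DoodleDiagram D)

/-- The vertex lies on the boundary of the region. -/
def IsOn (R : M.Region) (v : M.Vertex) : Prop := ∃ r, M.regionOf r = R ∧ M.vertexOf r = v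

/-- The regions have a common boundary vertex. -/
def Touches (R F : M.Region) : Prop := ∃ v, M.IsOn R v ∧ M.IsOn F v

variable {M} {R : M.Region}

theorem isOn_vertexOf (d : D) : M.IsOn (M.regionOf d) (M.vertexOf d) := ⟨d, rfl, rfl⟩

theorem isOn_target (d : D) : M.IsOn (M.regionOf d) (M.target d) :=
  ⟨M.rot (M.rev d), M.regionOf_rot_rev d, M.vertexOf_rot _⟩

theorem touches_of_isOn_vertexOf {d : D} (h : M.IsOn R (M.vertexOf d)) :
    M.Touches R (M.regionOf d) := ⟨_, h, isOn_vertexOf d⟩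

theorem touches_of_isOn_target {d : D} (h : M.IsOn R (M.target d)) :
    M.Touches R (M.regionOf d) := ⟨_, h, isOn_target d⟩

theorem touches_self (R : M.Region) : M.Touches R R := by
  obtain ⟨d, rfl⟩ := M.regionOf_surjective R
  exact touches_of_isOn_vertexOf (isOn_vertexOf d)

end Contact

section Local

variable {D : Type*} [Finite D] {M : DoodleDiagram D} {R : M.Region}

theorem IsSuperPrime.exists_dart_of_cornerMap_ne_zero (hM : M.IsSuperPrime) [DecidableEq M.Vertex]
    {a : D → ZMod 2} {u v : M.Vertex}
    (ha : ∀ d, a d ≠ 0 → M.vertexOf d ∈ ({u, v} : Finset M.Vertex) ∧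
      M.target d ∈ ({u, v} : Finset M.Vertex))
    {x : D} (hx : M.vertexOf x = u) (hax : M.cornerMap a x ≠ 0) :
    ∃ d, M.vertexOf d = u ∧ M.target d = v ∧ (x = d ∨ x = M.rot d) := by
  have htarget {d : D} (hd : M.vertexOf d = u) (had : a d ≠ 0) : M.target d = v := by
    have h := (ha d had).2
    rw [Finset.mem_insert, Finset.mem_singleton] at h
    exact h.resolve_left fun h => hM.target_ne d (h.trans hd.symm)
  by_cases h : a x = 0
  · rw [cornerMap_apply, h, zero_add] at hax
    have hx' := (M.vertexOf_rot_symm x).trans hx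
    exact ⟨_, hx', htarget hx' hax, Or.inr (M.rot.apply_symm_apply x).symm⟩
  · exact ⟨x, hx, htarget hx h, Or.inl rfl⟩

theorem IsSuperPrime.exists_common_edge (hM : M.IsSuperPrime) {r f : D} (hrf : r ≠ f)
    (hu : M.vertexOf r = M.vertexOf f) {v : M.Vertex} (hv : v ≠ M.vertexOf r)
    (hr : M.IsOn (M.regionOf r) v) (hf : M.IsOn (M.regionOf f) v) :
    (M.rot r = f ∧ M.target r = v) ∨ (M.rot f = r ∧ M.target f = v) := by
  classical
  have := Fintype.ofFinite D
  obtain ⟨r', hr', rfl⟩ := hr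
  obtain ⟨f', hf', hv'⟩ := hf
  obtain ⟨a, ha, haS⟩ := hM.exists_cornerMap_eq
    (K := Pi.single r 1 + Pi.single f 1 + (Pi.single r' 1 + Pi.single f' 1))
    (S := {M.vertexOf r, M.vertexOf r'})
    (by simp only [map_add, fiberSum_single, hu, hv', ZModModule.add_self])
    (by simp only [map_add, fiberSum_single, hr', hf', ZModModule.add_self])
    (Finset.card_le_two.trans_lt (by norm_num)) (by grind [Pi.add_apply])
  have hne {x : D} (hx : M.vertexOf x = M.vertexOf r) : x ≠ r' ∧ x ≠ f' :=
    ⟨by rintro rfl; exact hv hx, by rintro rfl; exact hv (hv'.symm.trans hx)⟩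
  obtain ⟨d, hd, hdt, hdr⟩ := hM.exists_dart_of_cornerMap_ne_zero haS (x := r) rfl (by
    simp [ha, hne, hrf])
  obtain ⟨d', hd', hdt', hdf⟩ := hM.exists_dart_of_cornerMap_ne_zero haS (x := f) hu.symm (by
    simp [ha, hne, hu, hrf.symm])
  obtain rfl := hM.eq_of_target_eq (hd.trans hd'.symm) (hdt.trans hdt'.symm)
  rcases hdr with rfl | rfl <;> rcases hdf with rfl | rfl
  · exact absurd rfl hrf
  · exact Or.inl ⟨rfl, hdt⟩
  · exact Or.inr ⟨rfl, hdt⟩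
  · exact absurd rfl hrf

theorem iterate_rot_inj {i j : ℕ} (hi : i < 4) (hj : j < 4) {d : D} :
    M.rot^[i] d = M.rot^[j] d ↔ i = j := by
  refine (iterate_injOn_Iio_minimalPeriod (f := M.rot) (x := d)).eq_iff ?_ ?_ <;>
    rwa [mem_Iio, M.four_valent]

theorem apply_iterate_rot_eq {a : D → ZMod 2} {d : D} {i n : ℕ} (hi : 0 < i)
    (hcorner : ∀ j, 0 < j → j < n → M.cornerMap a (M.rot^[j] d) = if j = i then 1 else 0)
    {j : ℕ} (hj : j < n) : a (M.rot^[j] d) = a d + if i ≤ j then 1 else 0 := by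
  induction j with
  | zero => simp [hi.ne']
  | succ j ih =>
    have h := hcorner _ j.succ_pos hj
    rw [iterate_succ_apply', cornerMap_rot, ih (by omega), ← ZModModule.sub_eq_add,
      sub_eq_iff_eq_add] at h
    rw [iterate_succ_apply', h]
    grind

/-- A closed curve through the two regions and `R` meets the graph only in `M.vertexOf d`, `u` and
`u'`. As these do not separate the graph, the curve has no other vertex on one of its sides. -/
theorem IsSuperPrime.target_eq_or_of_isOn (hM : M.IsSuperPrime) {d : D} {i : ℕ} (hi : 0 < i)
    (hi' : i < 4) {u u' : M.Vertex} (hu : M.IsOn (M.regionOf d) u) (huR : M.IsOn R u)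
    (hu' : M.IsOn (M.regionOf (M.rot^[i] d)) u') (huR' : M.IsOn R u')
    (hne : u ≠ M.vertexOf d) (hne' : u' ≠ M.vertexOf d) :
    (∀ j < i, M.target (M.rot^[j] d) = u ∨ M.target (M.rot^[j] d) = u') ∨
      ∀ j, i ≤ j → j < 4 → M.target (M.rot^[j] d) = u ∨ M.target (M.rot^[j] d) = u' := by
  classical
  have := Fintype.ofFinite D
  obtain ⟨f, hf, rfl⟩ := hu
  obtain ⟨f', hf', rfl⟩ := hu'
  obtain ⟨r, hr, hrf⟩ := huR
  obtain ⟨r', hr', hrf'⟩ := huR'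
  obtain ⟨a, ha, haS⟩ := hM.exists_cornerMap_eq
    (K := Pi.single (M.rot^[i] d) 1 + Pi.single d 1 + (Pi.single f 1 + Pi.single r 1) +
      (Pi.single f' 1 + Pi.single r' 1))
    (S := {M.vertexOf d, M.vertexOf f, M.vertexOf f'})
    (by simp only [map_add, fiberSum_single, hrf, hrf', vertexOf_iterate_rot,
          ZModModule.add_self])
    (by simp only [map_add, fiberSum_single, hf, hf', hr, hr', ZModModule.add_add_add_cancel,
          ZModModule.add_self])
    (Finset.card_le_three.trans_lt (by norm_num))
    (by grind [Pi.add_apply, vertexOf_iterate_rot])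
  have htarget {j : ℕ} (h : a (M.rot^[j] d) ≠ 0) :
      M.target (M.rot^[j] d) = M.vertexOf f ∨ M.target (M.rot^[j] d) = M.vertexOf f' := by
    have h' := (haS _ h).2
    rw [Finset.mem_insert, Finset.mem_insert, Finset.mem_singleton] at h'
    refine h'.resolve_left fun h'' => hM.target_ne _ (h''.trans (M.vertexOf_iterate_rot j d).symm)
  have hcorner (j : ℕ) (hj : 0 < j) (hj' : j < 4) :
      M.cornerMap a (M.rot^[j] d) = if j = i then 1 else 0 := by
    have hoff {x : D} (hx : M.vertexOf x ≠ M.vertexOf d) : M.rot^[j] d ≠ x :=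
      fun h => hx (h ▸ M.vertexOf_iterate_rot j d)
    simp [ha, Pi.single_apply, iterate_rot_inj hj' hi', M.iterate_rot_ne hj.ne' hj', hoff hne,
      hoff hne', hoff (hrf.trans_ne hne), hoff (hrf'.trans_ne hne')]
  have hjump {j : ℕ} (hj : j < 4) := apply_iterate_rot_eq hi hcorner hj
  by_cases h0 : a d = 0
  · exact Or.inr fun j hij hj => htarget (by simp [hjump hj, h0, hij])
  · exact Or.inl fun j hj => htarget (by rwa [hjump (hj.trans hi'), if_neg hj.not_ge, add_zero])

theorem IsSuperPrime.target_iterate_rot_inj (hM : M.IsSuperPrime) {i j : ℕ} (hi : i < 4)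
    (hj : j < 4) {d : D} : M.target (M.rot^[i] d) = M.target (M.rot^[j] d) ↔ i = j := by
  refine ⟨fun h => (iterate_rot_inj hi hj).1 (hM.eq_of_target_eq ?_ h), fun h => by rw [h]⟩
  rw [vertexOf_iterate_rot, vertexOf_iterate_rot]

theorem IsSuperPrime.not_touches_of_edge (hM : M.IsSuperPrime) {d : D}
    (hd : ¬ M.IsOn R (M.vertexOf d)) (hd' : ¬ M.IsOn R (M.target d)) :
    ¬ M.Touches R (M.regionOf d) ∨ ¬ M.Touches R (M.regionOf (M.rev d)) := by
  by_contra! h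
  obtain ⟨⟨u, huR, hu⟩, ⟨u', huR', hu'⟩⟩ := h
  rw [← regionOf_rot] at hu'
  rcases hM.target_eq_or_of_isOn (i := 1) one_pos (by norm_num) hu huR hu' huR'
    (by rintro rfl; exact hd huR) (by rintro rfl; exact hd huR') with h | h
  · rcases h 0 one_pos with h | h
    · exact hd' (h ▸ huR)
    · exact hd' (h ▸ huR')
  · -- three edges would have their targets among two vertices
    have h₁ := h 1 le_rfl (by norm_num)
    have h₂ := h 2 (by norm_num) (by norm_num)
    have h₃ := h 3 (by norm_num) (by norm_num)
    have hinj {i j : ℕ} (hi : i < 4) (hj : j < 4) (hij : i ≠ j) :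
        M.target (M.rot^[i] d) ≠ M.target (M.rot^[j] d) :=
      (hM.target_iterate_rot_inj hi hj).not.2 hij
    grind

theorem IsSuperPrime.isOn_of_touches (hM : M.IsSuperPrime) {d : D}
    (hd : ¬ M.IsOn R (M.vertexOf d)) (h : M.Touches R (M.regionOf d))
    (h' : M.Touches R (M.regionOf (M.rot (M.rot d)))) :
    (M.IsOn R (M.target d) ∧ M.IsOn R (M.target (M.rot d))) ∨
      (M.IsOn R (M.target (M.rot (M.rot d))) ∧ M.IsOn R (M.target (M.rot (M.rot (M.rot d))))) := by
  obtain ⟨u, huR, hu⟩ := h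
  obtain ⟨u', huR', hu'⟩ := h'
  have hon {v : M.Vertex} (hv : v = u ∨ v = u') : M.IsOn R v := by
    rcases hv with rfl | rfl <;> assumption
  rcases hM.target_eq_or_of_isOn (i := 2) two_pos (by norm_num) hu huR hu' huR'
    (by rintro rfl; exact hd huR) (by rintro rfl; exact hd huR') with h | h
  · exact Or.inl ⟨hon (h 0 two_pos), hon (h 1 one_lt_two)⟩
  · exact Or.inr ⟨hon (h 2 le_rfl (by norm_num)), hon (h 3 (by norm_num) (by norm_num))⟩

theorem IsSuperPrime.not_isOn_opposite (hM : M.IsSuperPrime) {d : D}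
    (h : M.IsOn R (M.target d)) : ¬ M.IsOn R (M.target (M.rot (M.rot d))) := by
  intro h'
  have hinj {i j : ℕ} (hi : i < 4) (hj : j < 4) (hij : i ≠ j) :
      M.target (M.rot^[i] d) ≠ M.target (M.rot^[j] d) :=
    (hM.target_iterate_rot_inj hi hj).not.2 hij
  rcases hM.target_eq_or_of_isOn (i := 2) two_pos (by norm_num) (isOn_target d) h
    (isOn_target (M.rot (M.rot d))) h' (hM.target_ne d)
    (by simpa only [vertexOf_rot] using hM.target_ne (M.rot (M.rot d))) with h | h
  · rcases h 1 one_lt_two with h | h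
    · exact hinj (i := 1) (j := 0) (by norm_num) (by norm_num) one_ne_zero h
    · exact hinj (i := 1) (j := 2) (by norm_num) (by norm_num) (by norm_num) h
  · rcases h 3 (by norm_num) (by norm_num) with h | h
    · exact hinj (i := 3) (j := 0) (by norm_num) (by norm_num) (by norm_num) h
    · exact hinj (i := 3) (j := 2) (by norm_num) (by norm_num) (by norm_num) h

theorem IsSuperPrime.exists_not_touches (hM : M.IsSuperPrime) {v : M.Vertex}
    (hv : ¬ M.IsOn R v) : ∃ d, M.vertexOf d = v ∧ ¬ M.Touches R (M.regionOf d) := by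
  obtain ⟨d, rfl⟩ := M.vertexOf_surjective v
  by_contra! h
  have h₀ := hM.isOn_of_touches hv (h d rfl) (h _ (by simp only [vertexOf_rot]))
  have h₁ := hM.isOn_of_touches (d := M.rot d) (by rwa [vertexOf_rot]) (h _ (M.vertexOf_rot d))
    (h _ (by simp only [vertexOf_rot]))
  rw [M.rot_four] at h₁
  have hopp₀ := hM.not_isOn_opposite (R := R) (d := d)
  have hopp₁ := hM.not_isOn_opposite (R := R) (d := M.rot d)
  tauto

/-- The regions at a vertex off `R` that do not touch `R` are consecutive around the vertex. -/
theorem IsSuperPrime.iff_of_vertexOf_eq (hM : M.IsSuperPrime) {Q : M.Region → Prop}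
    (hQ : ∀ d, ¬ M.Touches R (M.regionOf d) → ¬ M.Touches R (M.regionOf (M.rev d)) →
      (Q (M.regionOf d) ↔ Q (M.regionOf (M.rev d))))
    {x y : D} (hxy : M.vertexOf x = M.vertexOf y) (hv : ¬ M.IsOn R (M.vertexOf x))
    (hx : ¬ M.Touches R (M.regionOf x)) (hy : ¬ M.Touches R (M.regionOf y)) :
    Q (M.regionOf x) ↔ Q (M.regionOf y) := by
  have hrot {z : D} (hz : ¬ M.Touches R (M.regionOf z))
      (hz' : ¬ M.Touches R (M.regionOf (M.rot z))) :
      Q (M.regionOf z) ↔ Q (M.regionOf (M.rot z)) := by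
    rw [regionOf_rot] at hz' ⊢
    exact hQ z hz hz'
  have hfour := M.rot_four x
  rcases M.eq_rot_of_vertexOf_eq hxy with rfl | rfl | rfl | rfl
  · rfl
  · exact hrot hx hy
  · by_cases h₁ : M.Touches R (M.regionOf (M.rot x))
    · by_cases h₃ : M.Touches R (M.regionOf (M.rot (M.rot (M.rot x))))
      · exfalso
        rcases hM.isOn_of_touches (d := M.rot x) (by rwa [vertexOf_rot]) h₁ h₃ with h | h
        · exact hy (touches_of_isOn_target h.2)
        · exact hx (touches_of_isOn_target (hfour ▸ h.2))
      · have h := hrot h₃ (hfour.symm ▸ hx)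
        rw [hfour] at h
        exact h.symm.trans (hrot hy h₃).symm
    · exact (hrot hx h₁).trans (hrot h₁ hy)
  · have h := hrot hy (hfour.symm ▸ hx)
    rw [hfour] at h
    exact h.symm

end Local

section OffBoundary

variable {D : Type*} [Finite D] {M : DoodleDiagram D}

theorem IsSuperPrime.eq_or_of_isOn (hM : M.IsSuperPrime) {r f g : D} (hrf : r ≠ f)
    (hu : M.vertexOf r = M.vertexOf f) (hg : M.regionOf g = M.regionOf f)
    (hgr : M.IsOn (M.regionOf r) (M.vertexOf g)) :
    g = f ∨ (M.rot r = f ∧ M.target r = M.vertexOf g) ∨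
      (M.rot f = r ∧ M.target f = M.vertexOf g) := by
  by_cases h : M.vertexOf g = M.vertexOf r
  · exact Or.inl (hM.eq_of_vertexOf_of_regionOf (h.trans hu) hg)
  · exact Or.inr (hM.exists_common_edge hrf hu h hgr (hg ▸ isOn_vertexOf g))

theorem IsSuperPrime.exists_not_isOn (hM : M.IsSuperPrime) (R : M.Region) :
    ∃ v, ¬ M.IsOn R v := by
  obtain ⟨r, rfl⟩ := M.regionOf_surjective R
  refine ⟨M.target (M.rot r), fun h => ?_⟩
  rw [target, ← vertexOf_rot] at h
  rcases hM.eq_or_of_isOn (M.rot_ne r).symm (M.vertexOf_rot r).symm (M.regionOf_rot_rev (M.rot r)) h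
    with h' | ⟨-, h'⟩ | ⟨h', -⟩
  · exact hM.target_ne (M.rot r) (by rw [target, ← vertexOf_rot, h'])
  · rw [vertexOf_rot] at h'
    exact M.rot_ne r (hM.eq_of_target_eq (M.vertexOf_rot r).symm h').symm
  · exact M.rot_two_ne r h'

variable {a : D → ZMod 2}

theorem sum_cornerMap_eq_zero (ha : ∀ d, a (M.rev d) = a d) {F : M.Region} {A : Finset D}
    (hA : ∀ g ∈ A, M.regionOf g = F) (hA' : ∀ g ∉ A, M.regionOf g = F → M.cornerMap a g = 0) :
    ∑ g ∈ A, M.cornerMap a g = 0 := by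
  classical
  have := Fintype.ofFinite D
  have hF := congrFun (M.fiberSum_regionOf_cornerMap ha) F
  rw [fiberSum_apply] at hF
  refine (Finset.sum_subset (fun g hg => ?_) fun g hg hg' => ?_).trans hF
  · exact Finset.mem_filter.2 ⟨Finset.mem_univ g, hA g hg⟩
  · exact hA' g hg' (Finset.mem_filter.1 hg).2

theorem IsSuperPrime.apply_rot_eq (hM : M.IsSuperPrime) (ha : ∀ d, a (M.rev d) = a d) {r : D}
    (hoff : ∀ d, ¬ M.IsOn (M.regionOf r) (M.vertexOf d) → M.cornerMap a d = 0) :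
    a (M.rot r) = a (M.rot (M.rot r)) := by
  have hsum := sum_cornerMap_eq_zero ha (F := M.regionOf (M.rot (M.rot r)))
      (A := {M.rot (M.rot r)}) (by simp) fun g hg hgF => by
    refine hoff g fun hgR => ?_
    rcases hM.eq_or_of_isOn (M.rot_two_ne r).symm (by simp only [vertexOf_rot]) hgF hgR
      with h | ⟨h, -⟩ | ⟨h, -⟩
    · exact hg (Finset.mem_singleton.2 h)
    · exact M.rot_ne _ h.symm
    · exact M.rot_three_ne _ h
  rw [Finset.sum_singleton, cornerMap_rot] at hsum
  exact (CharTwo.add_eq_zero.1 hsum).symm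

theorem IsSuperPrime.apply_rot_symm_rev_eq (hM : M.IsSuperPrime) (ha : ∀ d, a (M.rev d) = a d)
    {r : D}
    (hoff : ∀ d, ¬ M.IsOn (M.regionOf r) (M.vertexOf d) → M.cornerMap a d = 0) :
    a (M.rot.symm (M.rev r)) = a (M.rot r) := by
  classical
  have hne : M.rev r ≠ M.rot r := fun h => hM.target_ne r <| by rw [target, h, vertexOf_rot]
  have hsum := sum_cornerMap_eq_zero ha (F := M.regionOf (M.rev r)) (A := {M.rev r, M.rot r})
    (by simp [regionOf_rot]) fun g hg hgF => by
      refine hoff g fun hgR => ?_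
      rw [Finset.mem_insert, Finset.mem_singleton, not_or] at hg
      rw [← regionOf_rot_rev] at hgR
      rcases hM.eq_or_of_isOn (M.rot_ne (M.rev r)) (M.vertexOf_rot _) hgF hgR
        with h | ⟨h, -⟩ | ⟨-, h⟩
      · exact hg.1 h
      · exact M.rot_two_ne _ h
      · refine hg.2 (hM.eq_of_vertexOf_of_regionOf ?_ ?_)
        · rw [vertexOf_rot, ← h, target_rev]
        · rw [regionOf_rot, hgF]
  rw [Finset.sum_pair hne, cornerMap_apply, cornerMap_rot, ha] at hsum
  grind

theorem IsSuperPrime.exists_eq_of_isOn (hM : M.IsSuperPrime) {R : M.Region}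
    (ha : ∀ d, a (M.rev d) = a d)
    (hoff : ∀ d, ¬ M.IsOn R (M.vertexOf d) → M.cornerMap a d = 0) :
    ∃ c, ∀ d, M.IsOn R (M.vertexOf d) → ¬ M.IsOn R (M.target d) → a d = c := by
  classical
  -- Walk around `R`, from one edge that leaves its boundary to the next.
  obtain ⟨r₀, hr₀⟩ := M.regionOf_surjective R
  refine ⟨a (M.rot r₀), fun d ⟨r, hr, hrd⟩ hd' => ?_⟩
  have hrot {r : D} (hr : M.regionOf r = R) : a (M.rot r) = a (M.rot (M.rot r)) :=
    hM.apply_rot_eq ha (hr ▸ hoff)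
  have hstep {r : D} (hr : M.regionOf r = R) : a (M.rot (M.rot (M.rev r))) = a (M.rot r) := by
    have h := hM.apply_rot_symm_rev_eq ha (r := r) (hr ▸ hoff)
    rw [← M.rot_four (M.rot.symm (M.rev r)), Equiv.apply_symm_apply] at h
    exact (hrot ((M.regionOf_rot_rev r).trans hr)).trans h
  have hconst : a (M.rot r) = a (M.rot r₀) := by
    have h := eq_of_sameCycle (b := fun x => if M.regionOf x = R then a (M.rot x) else 0)
      (fun x => by
        simp only [Equiv.Perm.mul_apply, regionOf_rot_rev]
        split_ifs with hx
        · exact hstep hx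
        · rfl) (M.regionOf_eq_iff.1 (hr.trans hr₀.symm))
    rwa [if_pos hr, if_pos hr₀] at h
  rcases M.eq_rot_of_vertexOf_eq hrd with rfl | rfl | rfl | rfl
  · exact absurd (hr ▸ isOn_target _) hd'
  · exact hconst
  · exact (hrot hr).symm.trans hconst
  · refine absurd ⟨_, ?_, rfl⟩ hd'
    rw [← regionOf_rot, M.rot_four, hr]

theorem exists_extension {R : M.Region} {f : M.Vertex → ZMod 2}
    (hf : ∀ d, ¬ M.IsOn R (M.vertexOf d) → ¬ M.IsOn R (M.target d) →
      f (M.vertexOf d) = f (M.target d)) :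
    ∃ a : D → ZMod 2, (∀ d, a (M.rev d) = a d) ∧
      ∀ d, ¬ M.IsOn R (M.vertexOf d) → a d = f (M.vertexOf d) := by
  classical
  refine ⟨fun d => if M.IsOn R (M.vertexOf d) then
    if M.IsOn R (M.target d) then 0 else f (M.target d) else f (M.vertexOf d), fun d => ?_,
    fun d hd => if_neg hd⟩
  simp only [target_rev, show M.vertexOf (M.rev d) = M.target d from rfl]
  by_cases h : M.IsOn R (M.vertexOf d) <;> by_cases h' : M.IsOn R (M.target d)
  · simp [h, h']
  · simp [h, h']
  · simp [h, h']
  · simp [h, h', hf d h h']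

/-- The boundary of a region does not separate the other vertices. -/
theorem IsSuperPrime.eq_off_boundary (hM : M.IsSuperPrime) {R : M.Region} {f : M.Vertex → ZMod 2}
    (hf : ∀ d, ¬ M.IsOn R (M.vertexOf d) → ¬ M.IsOn R (M.target d) →
      f (M.vertexOf d) = f (M.target d))
    {v w : M.Vertex} (hv : ¬ M.IsOn R v) (hw : ¬ M.IsOn R w) : f v = f w := by
  classical
  obtain ⟨a, ha, haf⟩ := exists_extension hf
  obtain ⟨c, hc⟩ := hM.exists_eq_of_isOn (R := R) ha fun d hd => by
    have hd' : ¬ M.IsOn R (M.vertexOf (M.rot.symm d)) := by rwa [vertexOf_rot_symm]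
    rw [cornerMap_apply, haf d hd, haf _ hd', vertexOf_rot_symm, ZModModule.add_self]
  have hleave {d : D} (hd : M.IsOn R (M.vertexOf d)) (hd' : ¬ M.IsOn R (M.target d)) :
      f (M.target d) = c :=
    (haf _ hd').symm.trans ((ha d).trans (hc d hd hd'))
  have h := hM.eq_of_notMem (S := ∅) (by simp) (f := fun v => if M.IsOn R v then c else f v)
    (fun d _ _ => by
      by_cases h : M.IsOn R (M.vertexOf d) <;> by_cases h' : M.IsOn R (M.target d)
      · simp [h, h']
      · simp [h, h', hleave h h']
      · have h'' := hleave (d := M.rev d) h' (by rwa [target_rev])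
        rw [target_rev] at h''
        simp [h, h', h'']
      · simp [h, h', hf d h h'])
    (Finset.notMem_empty v) (Finset.notMem_empty w)
  rwa [if_neg hv, if_neg hw] at h

end OffBoundary

section RegionConnectivity

variable {D : Type*} [Finite D] {M : DoodleDiagram D} {R : M.Region} {Q : M.Region → Prop}

theorem IsSuperPrime.iff_of_not_touches (hM : M.IsSuperPrime)
    (hQ : ∀ d, ¬ M.Touches R (M.regionOf d) → ¬ M.Touches R (M.regionOf (M.rev d)) →
      (Q (M.regionOf d) ↔ Q (M.regionOf (M.rev d))))
    {F F' : M.Region} (hF : ¬ M.Touches R F) (hF' : ¬ M.Touches R F') : Q F ↔ Q F' := by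
  classical
  set P : M.Vertex → Prop := fun v =>
    ∃ d, M.vertexOf d = v ∧ ¬ M.Touches R (M.regionOf d) ∧ Q (M.regionOf d)
  have hPQ {d : D} (hd : ¬ M.Touches R (M.regionOf d)) :
      P (M.vertexOf d) ↔ Q (M.regionOf d) := by
    refine ⟨fun ⟨x, hx, hxR, hxQ⟩ => ?_, fun h => ⟨d, rfl, hd, h⟩⟩
    have hv : ¬ M.IsOn R (M.vertexOf x) := fun h => hxR (touches_of_isOn_vertexOf h)
    exact (hM.iff_of_vertexOf_eq hQ hx hv hxR hd).1 hxQ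
  have hedge {d : D} (hd : ¬ M.Touches R (M.regionOf d)) :
      P (M.vertexOf d) ↔ P (M.target d) := by
    have h := hPQ (d := M.rot (M.rev d)) (by rwa [regionOf_rot_rev])
    rw [vertexOf_rot, regionOf_rot_rev] at h
    exact (hPQ hd).trans h.symm
  obtain ⟨d, rfl⟩ := M.regionOf_surjective F
  obtain ⟨d', rfl⟩ := M.regionOf_surjective F'
  have h := hM.eq_off_boundary (R := R) (f := fun v => if P v then 1 else 0)
    (v := M.vertexOf d) (w := M.vertexOf d') (fun x hx hx' => by
      refine if_congr ?_ rfl rfl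
      rcases hM.not_touches_of_edge hx hx' with h | h
      · exact hedge h
      · have h' := hedge h
        rw [target_rev] at h'
        exact h'.symm)
    (fun h => hF (touches_of_isOn_vertexOf h)) (fun h => hF' (touches_of_isOn_vertexOf h))
  rw [← hPQ hF, ← hPQ hF']
  by_cases hP : P (M.vertexOf d) <;> by_cases hP' : P (M.vertexOf d') <;> simp_all

theorem iff_of_touches
    (hQ : ∀ d, M.Touches R (M.regionOf d) → M.Touches R (M.regionOf (M.rev d)) →
      (Q (M.regionOf d) ↔ Q (M.regionOf (M.rev d))))
    {F : M.Region} (hF : M.Touches R F) : Q F ↔ Q R := by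
  obtain ⟨_, ⟨r, rfl, rfl⟩, d, rfl, hd⟩ := hF
  have hstep (x : D) :
      (M.vertexOf x = M.vertexOf r → Q (M.regionOf x)) ↔
        (M.vertexOf (M.rot x) = M.vertexOf r → Q (M.regionOf (M.rot x))) := by
    rw [vertexOf_rot, regionOf_rot]
    refine forall_congr' fun hx => hQ x (touches_of_isOn_vertexOf (hx ▸ isOn_vertexOf r)) ?_
    rw [← regionOf_rot]
    exact touches_of_isOn_vertexOf (by rw [vertexOf_rot, hx]; exact isOn_vertexOf r)
  have h := eq_of_sameCycle (b := fun x => M.vertexOf x = M.vertexOf r → Q (M.regionOf x))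
    (fun x => propext (hstep x).symm) (M.vertexOf_eq_iff.1 hd)
  simpa [hd] using h

end RegionConnectivity

section Flags

variable {D : Type*} [Finite D] (M : DoodleDiagram D)

/-- A flag of the cell subdivision, encoded by the dart along its edge that starts at its vertex
and by the side of the dart that its region lies on (`true` for the side of `regionOf`). This is
the region of the flag. -/
def flagRegion (y : D × Bool) : M.Region := M.regionOf (if y.2 then y.1 else M.rev y.1)

/-- The cell of each dimension in a flag. -/
def flagCell (y : D × Bool) : Fin 3 → M.Cell :=
  ![.vertex (M.vertexOf y.1), .edge (M.edgeOf y.1), .region (M.flagRegion y)]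

/-- The flag that differs from the given one in the cell of dimension `i` only. -/
def flagAdj : Fin 3 → D × Bool → D × Bool
  | 0, (d, b) => (M.rev d, !b)
  | 1, (d, true) => (M.rot.symm d, false)
  | 1, (d, false) => (M.rot d, true)
  | 2, (d, b) => (d, !b)

/-- The side of the triangle of a flag in the barycentric subdivision that is opposite to the
barycentre of its cell of dimension `i`. -/
def face (i : Fin 3) (y : D × Bool) : Sym2 M.Cell :=
  s(M.flagCell y (i + 1), M.flagCell y (i + 2))

variable {M}

theorem dim_flagCell (y : D × Bool) (i : Fin 3) : (M.flagCell y i).dim = i := by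
  fin_cases i <;> rfl

theorem flagCell_inj {y z : D × Bool} {i j : Fin 3} :
    M.flagCell y i = M.flagCell z j ↔ i = j ∧ M.flagCell y i = M.flagCell z i := by
  refine ⟨fun h => ?_, fun h => h.1 ▸ h.2⟩
  obtain rfl : i = j := Fin.ext (by rw [← dim_flagCell (M := M) y, h, dim_flagCell])
  exact ⟨rfl, h⟩

theorem flagCell_ne (y : D × Bool) {i j : Fin 3} (hij : i ≠ j) :
    M.flagCell y i ≠ M.flagCell y j := fun h => hij (flagCell_inj.1 h).1

theorem flagCell_flagAdj {i j : Fin 3} (hij : j ≠ i) (y : D × Bool) :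
    M.flagCell (M.flagAdj i y) j = M.flagCell y j := by
  obtain ⟨d, _ | _⟩ := y <;> fin_cases i <;> fin_cases j <;>
    first
    | exact absurd rfl hij
    | simp [flagCell, flagAdj, flagRegion, M.rev_rev, vertexOf_rot, vertexOf_rot_symm, edgeOf_rev,
        regionOf_rot, ← M.regionOf_rot (M.rot.symm _)]

theorem flagAdj_flagAdj (i : Fin 3) (y : D × Bool) : M.flagAdj i (M.flagAdj i y) = y := by
  obtain ⟨d, _ | _⟩ := y <;> fin_cases i <;> simp [flagAdj, M.rev_rev]

theorem flagAdj_snd (i : Fin 3) (y : D × Bool) : (M.flagAdj i y).2 = !y.2 := by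
  obtain ⟨d, _ | _⟩ := y <;> fin_cases i <;> rfl

theorem flagAdj_ne (i : Fin 3) (y : D × Bool) : M.flagAdj i y ≠ y := fun h => by
  simpa [flagAdj_snd] using congrArg Prod.snd h

theorem face_flagAdj (i : Fin 3) (y : D × Bool) : M.face i (M.flagAdj i y) = M.face i y := by
  rw [face, face, flagCell_flagAdj (by simp), flagCell_flagAdj (by simp)]

theorem flagCell_mem_face {i j : Fin 3} (hij : i ≠ j) (y : D × Bool) :
    M.flagCell y i ∈ M.face j y := by
  obtain rfl | rfl : i = j + 1 ∨ i = j + 2 := by decide +revert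
  · exact Sym2.mem_mk_left _ _
  · exact Sym2.mem_mk_right _ _

theorem exists_eq_or_eq_flagAdj (i : Fin 3) (y : D × Bool) :
    ∃ d, y = (d, true) ∨ y = M.flagAdj i (d, true) := by
  obtain ⟨d, _ | _⟩ := y
  · refine ⟨(M.flagAdj i (d, false)).1, Or.inr ?_⟩
    rw [← flagAdj_flagAdj (M := M) i (d, false)]
    exact congrArg (M.flagAdj i) (Prod.ext (by rw [flagAdj_flagAdj]) (flagAdj_snd i _))
  · exact ⟨d, Or.inl rfl⟩

theorem exists_face_eq (i : Fin 3) (y : D × Bool) : ∃ d, M.face i y = M.face i (d, true) := by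
  obtain ⟨d, rfl | rfl⟩ := exists_eq_or_eq_flagAdj (M := M) i y
  · exact ⟨d, rfl⟩
  · exact ⟨d, face_flagAdj i _⟩

theorem exists_flagCell_eq {i j : Fin 3} (hij : i ≠ j) (y : D × Bool) :
    ∃ d, M.flagCell (d, true) i = M.flagCell y i ∧ M.flagCell (d, true) j = M.flagCell y j := by
  obtain ⟨l, hil, hjl⟩ : ∃ l, i ≠ l ∧ j ≠ l := by decide +revert
  obtain ⟨d, rfl | rfl⟩ := exists_eq_or_eq_flagAdj (M := M) l y
  · exact ⟨d, rfl, rfl⟩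
  · exact ⟨d, (flagCell_flagAdj hil _).symm, (flagCell_flagAdj hjl _).symm⟩

theorem add_face_eq_sum (k : Sym2 M.Cell → ZMod 2) (i : Fin 3) (y : D × Bool) :
    k (M.face (i + 1) y) + k (M.face (i + 2) y) =
      ∑ j ∈ Finset.univ.erase i, k s(M.flagCell y i, M.flagCell y j) := by
  have hi : Finset.univ.erase i = {i + 2, i + 1} ∧ i + 2 ≠ i + 1 ∧ i + 1 + 1 = i + 2 ∧
      i + 1 + 2 = i ∧ i + 2 + 1 = i ∧ i + 2 + 2 = i + 1 := by
    decide +revert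
  obtain ⟨hi, hne, h₁₁, h₁₂, h₂₁, h₂₂⟩ := hi
  rw [hi, Finset.sum_pair hne, face, face, h₁₁, h₁₂, h₂₁, h₂₂, Sym2.eq_swap]

theorem eq_of_flagAdj {X : Type*} {b : D × Bool → X} (hb : ∀ i y, b (M.flagAdj i y) = b y)
    (y z : D × Bool) : b y = b z := by
  have hfalse (d : D) : b (d, false) = b (d, true) := hb 2 (d, true)
  have htrue := M.eq_of_invariant (b := fun d => b (d, true))
    (fun d => (hb 1 (d, false)).trans (hfalse d)) (fun d => (hb 0 (d, false)).trans (hfalse d))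
  obtain ⟨d, _ | _⟩ := y <;> obtain ⟨d', _ | _⟩ := z <;> simp only [hfalse, htrue d d']

theorem eq_of_flagCell_eq {X : Type*} {b : D × Bool → X} {i : Fin 3}
    (hb : ∀ j ≠ i, ∀ y, b (M.flagAdj j y) = b y) {y z : D × Bool}
    (h : M.flagCell y i = M.flagCell z i) : b y = b z := by
  suffices htrue : ∀ d d', M.flagCell (d, true) i = M.flagCell (d', true) i →
      b (d, true) = b (d', true) by
    have hne : i + 1 ≠ i := by simp
    obtain ⟨d, rfl | rfl⟩ := exists_eq_or_eq_flagAdj (M := M) (i + 1) y <;>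
      obtain ⟨d', rfl | rfl⟩ := exists_eq_or_eq_flagAdj (M := M) (i + 1) z <;>
      simpa only [hb _ hne] using
        htrue d d' (by simpa only [flagCell_flagAdj hne.symm] using h)
  intro d d' h
  fin_cases i
  · refine eq_of_sameCycle (b := fun d => b (d, true)) (fun d => ?_)
      (M.vertexOf_eq_iff.1 (Cell.vertex.inj h))
    exact (hb 1 (by decide) (d, false)).trans (hb 2 (by decide) (d, true))
  · rcases M.edgeOf_eq_iff.1 (Cell.edge.inj h) with h | h <;> cases h
    · rfl
    · exact ((hb 0 (by decide) (d, false)).trans (hb 2 (by decide) (d, true))).symm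
  · refine eq_of_sameCycle (b := fun d => b (d, true)) (fun d => ?_)
      (M.regionOf_eq_iff.1 (Cell.region.inj h))
    exact (hb 1 (by decide) (M.rev d, false)).trans (hb 0 (by decide) (d, true))

theorem IsSuperPrime.eq_of_flagCell_true (hM : M.IsSuperPrime) {i : Fin 3} {d d' : D}
    (h : ∀ j ≠ i, M.flagCell (d, true) j = M.flagCell (d', true) j) : d = d' := by
  fin_cases i
  · rcases M.edgeOf_eq_iff.1 (Cell.edge.inj (h 1 (by decide))) with rfl | rfl
    · rfl
    · exact absurd (Cell.region.inj (h 2 (by decide))).symm (hM.regionOf_rev_ne d)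
  · exact hM.eq_of_vertexOf_of_regionOf (Cell.vertex.inj (h 0 (by decide)))
      (Cell.region.inj (h 2 (by decide)))
  · rcases M.edgeOf_eq_iff.1 (Cell.edge.inj (h 1 (by decide))) with rfl | rfl
    · rfl
    · exact absurd (Cell.vertex.inj (h 0 (by decide))).symm (hM.target_ne d)

theorem IsSuperPrime.eq_or_eq_flagAdj (hM : M.IsSuperPrime) {i : Fin 3} {y z : D × Bool}
    (h : ∀ j ≠ i, M.flagCell z j = M.flagCell y j) : z = y ∨ z = M.flagAdj i y := by
  obtain ⟨d, hy⟩ := exists_eq_or_eq_flagAdj (M := M) i y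
  obtain ⟨d', hz⟩ := exists_eq_or_eq_flagAdj (M := M) i z
  obtain rfl : d' = d := hM.eq_of_flagCell_true fun j hj => by
    rcases hy with rfl | rfl <;> rcases hz with rfl | rfl <;>
      simpa only [flagCell_flagAdj hj] using h j hj
  rcases hy with rfl | rfl <;> rcases hz with rfl | rfl <;> simp [flagAdj_flagAdj]

theorem IsSuperPrime.flagCell_injective (hM : M.IsSuperPrime) : Injective M.flagCell := by
  intro y z h
  rcases hM.eq_or_eq_flagAdj (i := 0) fun j _ => congrFun h j with h₀ | h₀
  · exact h₀
  rcases hM.eq_or_eq_flagAdj (i := 2) fun j _ => congrFun h j with h₂ | h₂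
  · exact h₂
  · exact absurd (congrArg Prod.fst (h₀.symm.trans h₂)) (M.rev_ne _)

end Flags

section Triangles

variable {D : Type*} [Finite D] {M : DoodleDiagram D} [DecidableEq M.Cell]

variable (M) in
/-- The triangle of a flag in the barycentric subdivision. -/
def flag (y : D × Bool) : Finset M.Cell :=
  {M.flagCell y 0, M.flagCell y 1, M.flagCell y 2}

theorem mem_flag {y : D × Bool} {c : M.Cell} : c ∈ M.flag y ↔ ∃ i, M.flagCell y i = c := by
  simp [flag, Fin.exists_fin_succ, eq_comm]

theorem flagCell_mem_flag {y z : D × Bool} {i : Fin 3} :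
    M.flagCell z i ∈ M.flag y ↔ M.flagCell y i = M.flagCell z i := by
  refine mem_flag.trans ⟨?_, fun h => ⟨i, h⟩⟩
  rintro ⟨j, hj⟩
  obtain ⟨rfl, h⟩ := flagCell_inj.1 hj
  exact h

theorem card_flag (y : D × Bool) : (M.flag y).card = 3 :=
  Finset.card_eq_three.2 ⟨_, _, _, flagCell_ne y (by decide), flagCell_ne y (by decide),
    flagCell_ne y (by decide), rfl⟩

theorem IsSuperPrime.flag_injective (hM : M.IsSuperPrime) : Injective M.flag := fun _ _ h =>
  hM.flagCell_injective <| funext fun _ =>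
    (flagCell_mem_flag.1 (h ▸ flagCell_mem_flag.2 rfl)).symm

theorem mem_triangleEdges_flag {y : D × Bool} {e : Sym2 M.Cell} :
    e ∈ triangleEdges (M.flag y) ↔ ∃ i, M.face i y = e := by
  rw [← Finset.mem_coe, flag, coe_triangleEdges_insert (flagCell_ne y (by decide))
    (flagCell_ne y (by decide)) (flagCell_ne y (by decide)), Fin.exists_fin_succ,
    Fin.exists_fin_two]
  simp only [mem_insert_iff, mem_singleton_iff, eq_comm (a := e)]
  exact or_rotate

theorem face_mem_triangleEdges {i : Fin 3} {y z : D × Bool} :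
    M.face i y ∈ triangleEdges (M.flag z) ↔ ∀ j ≠ i, M.flagCell z j = M.flagCell y j := by
  have h₁ : i + 1 ≠ i := by simp
  have h₂ : i + 2 ≠ i := by simp
  have hj (j : Fin 3) (hj : j ≠ i) : j = i + 1 ∨ j = i + 2 := by decide +revert
  rw [face, mk_mem_triangleEdges, flagCell_mem_flag, flagCell_mem_flag]
  refine ⟨fun ⟨h, h', _⟩ j hj' => ?_, fun h => ⟨h _ h₁, h _ h₂, fun h' => ?_⟩⟩
  · rcases hj j hj' with rfl | rfl <;> assumption
  · simpa using (flagCell_inj.1 h').1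

theorem IsSuperPrime.face_mem_triangleEdges_iff (hM : M.IsSuperPrime) {i : Fin 3} {y z : D × Bool} :
    M.face i y ∈ triangleEdges (M.flag z) ↔ z = y ∨ z = M.flagAdj i y := by
  rw [face_mem_triangleEdges]
  refine ⟨hM.eq_or_eq_flagAdj, ?_⟩
  rintro (rfl | rfl) j hj
  · rfl
  · exact flagCell_flagAdj hj y

end Triangles

section Potential

variable {D : Type*} [Finite D] (M : DoodleDiagram D)

theorem exists_sum_rev {m : D → ZMod 2} (hm : ∀ d, m (M.rev d) = m d) :
    ∃ p : D → ZMod 2, ∀ d, p d + p (M.rev d) = m d := by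
  classical
  choose s hs using M.edgeOf_surjective
  refine ⟨fun d => if d = s (M.edgeOf d) then m d else 0, fun d => ?_⟩
  simp only [edgeOf_rev, hm]
  rcases M.edgeOf_eq_iff.1 (hs (M.edgeOf d)).symm with h | h
  · rw [h, if_pos rfl, if_neg (M.rev_ne d), add_zero]
  · rw [h, if_pos rfl, if_neg (M.rev_ne d).symm, zero_add]

variable {D : Type*} [Fintype D] (M : DoodleDiagram D)

theorem fiberSum_edgeOf (m : D → ZMod 2) (d : D) :
    fiberSum M.edgeOf m (M.edgeOf d) = m d + m (M.rev d) := by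
  classical
  have h : ({x | M.edgeOf x = M.edgeOf d} : Finset D) = {d, M.rev d} := by
    ext x
    simp [eq_comm (b := M.edgeOf d), edgeOf_eq_iff]
  rw [fiberSum_apply, ← Finset.sum_pair (M.rev_ne d).symm, ← h]

/-- The vanishing of the first homology of the barycentric subdivision: `k i d` is the value of a
cycle on the face `M.face i (d, true)`, and `f` is a chain of flags which it bounds. -/
theorem exists_potential {k : Fin 3 → D → ZMod 2} (hV : fiberSum M.vertexOf (k 1 + k 2) = 0)
    (hE : fiberSum M.edgeOf (k 2 + k 0) = 0) (hF : fiberSum M.regionOf (k 0 + k 1) = 0) :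
    ∃ f : D × Bool → ZMod 2, ∀ i d, f (d, true) + f (M.flagAdj i (d, true)) = k i d := by
  obtain ⟨p, hp⟩ := M.exists_sum_rev (m := k 0 + k 2 ∘ M.rev) fun d => by
    have h := congrFun hE (M.edgeOf d)
    rw [fiberSum_edgeOf] at h
    simp only [Pi.add_apply, Pi.zero_apply, comp_apply, M.rev_rev] at h ⊢
    grind
  have hp' : p + p ∘ M.rev = k 0 + k 2 ∘ M.rev := funext hp
  have hsymm (f : D → ZMod 2) :
      fiberSum M.regionOf (f ∘ M.rot.symm) = fiberSum M.regionOf (f ∘ M.rev) := by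
    rw [← fiberSum_comp_perm (σ := M.rot * M.rev) M.regionOf_rot_rev]
    congr 1
    ext d
    simp
  obtain ⟨a, ha, haK⟩ := M.exists_cornerMap_eq
    (K := k 1 + k 2 ∘ M.rot.symm + (p + p ∘ M.rot.symm))
    (by rw [map_add] at hV
        simp only [map_add, fiberSum_comp_perm M.vertexOf_rot_symm, ZModModule.add_self, hV])
    (by simp only [map_add, hsymm]
        rw [← map_add _ p, hp', map_add, add_add_add_comm, ZModModule.add_self, add_zero, ← map_add,
          add_comm, hF])
  refine ⟨fun y => p y.1 + a y.1 + if y.2 then 0 else k 2 y.1, fun i d => ?_⟩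
  fin_cases i
  · have h := hp d
    simp only [Pi.add_apply, comp_apply, ← ha d] at h ⊢
    grind [flagAdj]
  · have h := congrFun haK d
    simp only [cornerMap_apply, Pi.add_apply, comp_apply] at h ⊢
    grind [flagAdj]
  · grind [flagAdj]

end Potential

section Triangulation

variable {D : Type*} [Fintype D] {M : DoodleDiagram D} [DecidableEq M.Cell]

variable (M) in
/-- The triangles of the barycentric subdivision. -/
def flags : Finset (Finset M.Cell) := Finset.univ.image M.flag

theorem mem_flags {t : Finset M.Cell} : t ∈ M.flags ↔ ∃ y, M.flag y = t := by simp [flags]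

theorem IsSuperPrime.triangleBoundary_face (hM : M.IsSuperPrime) {A : Finset (Finset M.Cell)}
    (hA : A ⊆ M.flags) (i : Fin 3) (y : D × Bool) :
    triangleBoundary A (M.face i y) =
      (if M.flag y ∈ A then 1 else 0) + if M.flag (M.flagAdj i y) ∈ A then 1 else 0 := by
  classical
  rw [← Finset.sum_ite_eq' A (M.flag y) fun _ => 1,
    ← Finset.sum_ite_eq' A (M.flag (M.flagAdj i y)) fun _ => 1, ← Finset.sum_add_distrib,
    triangleBoundary]
  refine Finset.sum_congr rfl fun t ht => ?_
  obtain ⟨z, rfl⟩ := mem_flags.1 (hA ht)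
  simp only [hM.face_mem_triangleEdges_iff, hM.flag_injective.eq_iff]
  by_cases h : z = y
  · rw [h]
    simp [(flagAdj_ne i y).symm]
  · simp [h]

theorem IsSuperPrime.flag_flagAdj_mem_iff (hM : M.IsSuperPrime) {A : Finset (Finset M.Cell)}
    (hA : A ⊆ M.flags) {i : Fin 3} {y : D × Bool} (h : triangleBoundary A (M.face i y) = 0) :
    M.flag (M.flagAdj i y) ∈ A ↔ M.flag y ∈ A := by
  rw [hM.triangleBoundary_face hA, CharTwo.add_eq_zero] at h
  by_cases h₁ : M.flag y ∈ A <;> by_cases h₂ : M.flag (M.flagAdj i y) ∈ A <;> simp_all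

theorem IsSuperPrime.edgeBoundary_eq_fiberSum (hM : M.IsSuperPrime) {k : Sym2 M.Cell → ZMod 2}
    (hk : ∀ e, k e ≠ 0 → ∃ t ∈ M.flags, e ∈ triangleEdges t) {i : Fin 3} {w : M.Cell}
    (hw : w.dim = i) :
    edgeBoundary k w = fiberSum (fun d => M.flagCell (d, true) i)
      (fun d => k (M.face (i + 1) (d, true)) + k (M.face (i + 2) (d, true))) w := by
  have hthird : ∀ i j : Fin 3, j ≠ i → ∃ l, ∀ m ≠ l, m = i ∨ m = j := by decide
  simp only [edgeBoundary_apply, fiberSum_apply, add_face_eq_sum]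
  rw [← Finset.sum_product']
  symm
  refine Finset.sum_of_injOn (fun p => M.flagCell (p.1, true) p.2) ?_ (fun _ _ => Finset.mem_univ _)
    ?_ ?_
  · rintro ⟨d, j⟩ hd ⟨d', j'⟩ hd' h
    simp only [Finset.coe_product, mem_prod, Finset.mem_coe, Finset.mem_filter, Finset.mem_univ,
      true_and, Finset.mem_erase, and_true] at hd hd'
    obtain ⟨rfl, h⟩ := flagCell_inj.1 h
    obtain ⟨l, hl⟩ := hthird i j hd.2
    rw [hM.eq_of_flagCell_true (i := l) (d := d) (d' := d')]
    intro m hm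
    rcases hl m hm with rfl | rfl
    · exact hd.1.trans hd'.1.symm
    · exact h
  · intro u _ hu
    by_contra hku
    obtain ⟨t, ht, het⟩ := hk _ hku
    obtain ⟨y, rfl⟩ := mem_flags.1 ht
    rw [mk_mem_triangleEdges, mem_flag, mem_flag] at het
    obtain ⟨⟨i', rfl⟩, ⟨j, rfl⟩, hij⟩ := het
    obtain rfl : i' = i := Fin.ext (by rw [← hw, dim_flagCell])
    have hji : j ≠ i' := by
      rintro rfl
      exact hij rfl
    obtain ⟨d, hi, hj⟩ := exists_flagCell_eq hji.symm y
    exact hu ⟨(d, j), by simp [hi, hji], hj⟩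
  · rintro ⟨d, j⟩ hd
    simp only [Finset.mem_product, Finset.mem_filter] at hd
    simp only [hd.1.2]

theorem IsSuperPrime.exists_triangleBoundary_eq (hM : M.IsSuperPrime) {k : Sym2 M.Cell → ZMod 2}
    (hk : ∀ e, k e ≠ 0 → ∃ t ∈ M.flags, e ∈ triangleEdges t) (hk₀ : edgeBoundary k = 0) :
    ∃ B ⊆ M.flags, triangleBoundary B = k := by
  have hcycle (i : Fin 3) (d : D) : fiberSum (fun d => M.flagCell (d, true) i)
      (fun d => k (M.face (i + 1) (d, true)) + k (M.face (i + 2) (d, true)))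
      (M.flagCell (d, true) i) = 0 := by
    rw [← hM.edgeBoundary_eq_fiberSum hk (dim_flagCell _ i), hk₀, Pi.zero_apply]
  obtain ⟨f, hf⟩ := M.exists_potential (k := fun i d => k (M.face i (d, true)))
    (funext <| M.vertexOf_surjective.forall.2 fun d =>
      (fiberSum_comp_apply (g := Cell.vertex) (fun _ _ => Cell.vertex.inj) _ _).symm.trans
        (hcycle 0 d))
    (funext <| M.edgeOf_surjective.forall.2 fun d =>
      (fiberSum_comp_apply (g := Cell.edge) (fun _ _ => Cell.edge.inj) _ _).symm.trans
        (hcycle 1 d))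
    (funext <| M.regionOf_surjective.forall.2 fun d =>
      (fiberSum_comp_apply (g := Cell.region) (fun _ _ => Cell.region.inj) _ _).symm.trans
        (hcycle 2 d))
  set B := ({y | f y = 1} : Finset (D × Bool)).image M.flag with hB
  have hBT : B ⊆ M.flags := Finset.image_subset_image (Finset.filter_subset _ _)
  have hcases : ∀ x : ZMod 2, x = 0 ∨ x = 1 := by decide
  have hmem (y : D × Bool) : (if M.flag y ∈ B then 1 else 0) = f y := by
    have h : M.flag y ∈ B ↔ f y = 1 := by simp [hB, hM.flag_injective.eq_iff]
    generalize f y = x at h ⊢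
    rcases hcases x with rfl | rfl
    · simp [h]
    · simp [h]
  have hface (i : Fin 3) (y : D × Bool) : triangleBoundary B (M.face i y) = k (M.face i y) := by
    obtain ⟨d, hd⟩ := exists_face_eq (M := M) i y
    rw [hd, hM.triangleBoundary_face hBT, hmem, hmem, hf]
  refine ⟨B, hBT, funext fun e => ?_⟩
  by_cases he : ∃ t ∈ M.flags, e ∈ triangleEdges t
  · obtain ⟨t, ht, het⟩ := he
    obtain ⟨y, rfl⟩ := mem_flags.1 ht
    obtain ⟨i, rfl⟩ := mem_triangleEdges_flag.1 het
    exact hface i y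
  · rw [not_not.1 (mt (hk e) he), not_not.1 (mt exists_mem_of_triangleBoundary_ne_zero _)]
    exact fun ⟨t, ht, het⟩ => he ⟨t, hBT ht, het⟩

theorem IsSuperPrime.isSphereTriangulation (hM : M.IsSuperPrime) :
    IsSphereTriangulation M.flags where
  card_eq := by
    simp only [mem_flags, forall_exists_index, forall_apply_eq_imp_iff, card_flag, implies_true]
  edge := by
    intro t ht e he
    obtain ⟨y, rfl⟩ := mem_flags.1 ht
    obtain ⟨i, rfl⟩ := mem_triangleEdges_flag.1 he
    refine ⟨M.flag (M.flagAdj i y), mem_flags.2 ⟨_, rfl⟩, hM.flag_injective.ne (flagAdj_ne i y),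
      mem_triangleEdges_flag.2 ⟨i, face_flagAdj i y⟩, fun s hs h => ?_⟩
    obtain ⟨z, rfl⟩ := mem_flags.1 hs
    exact (hM.face_mem_triangleEdges_iff.1 h).imp (congrArg _) (congrArg _)
  homology := fun _ => hM.exists_triangleBoundary_eq
  star := by
    intro A hA w hw t ht hwt t' ht' hwt'
    obtain ⟨y, rfl⟩ := mem_flags.1 (hA ht)
    obtain ⟨y', rfl⟩ := mem_flags.1 ht'
    obtain ⟨i, rfl⟩ := mem_flag.1 hwt
    have hadj (j : Fin 3) (hj : j ≠ i) (z : D × Bool) :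
        (M.flagCell (M.flagAdj j z) i = M.flagCell y i ∧ M.flag (M.flagAdj j z) ∈ A) =
          (M.flagCell z i = M.flagCell y i ∧ M.flag z ∈ A) := by
      rw [flagCell_flagAdj hj.symm]
      refine propext (and_congr_right fun h => hM.flag_flagAdj_mem_iff hA (hw _ ?_))
      exact h ▸ flagCell_mem_face hj.symm z
    exact ((eq_of_flagCell_eq (b := fun z => M.flagCell z i = M.flagCell y i ∧ M.flag z ∈ A) hadj
      (flagCell_mem_flag.1 hwt').symm).mp ⟨rfl, ht⟩).2
  connected := by
    intro A hA h₀
    have hmem (y z : D × Bool) : M.flag y ∈ A ↔ M.flag z ∈ A :=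
      (eq_of_flagAdj (b := fun y => M.flag y ∈ A)
        (fun i y => propext (hM.flag_flagAdj_mem_iff hA (congrFun h₀ _))) y z).to_iff
    refine A.eq_empty_or_nonempty.imp_right fun ⟨t, ht⟩ => hA.antisymm fun t' ht' => ?_
    obtain ⟨y, rfl⟩ := mem_flags.1 (hA ht)
    obtain ⟨y', rfl⟩ := mem_flags.1 ht'
    exact (hmem y y').1 ht

open scoped Classical in
variable (M) in
/-- The triangles of the barycentric subdivision in the regions with the property `N`. -/
noncomputable def flagsOf (N : M.Region → Prop) : Finset (Finset M.Cell) :=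
  (Finset.univ.filter fun y => N (M.flagRegion y)).image M.flag

theorem flagsOf_subset {N : M.Region → Prop} : M.flagsOf N ⊆ M.flags := by
  classical exact Finset.image_subset_image (Finset.filter_subset _ _)

theorem IsSuperPrime.flag_mem_flagsOf (hM : M.IsSuperPrime) {N : M.Region → Prop}
    {y : D × Bool} : M.flag y ∈ M.flagsOf N ↔ N (M.flagRegion y) := by
  classical
  simp [flagsOf, hM.flag_injective.eq_iff]

end Triangulation

section Faces

variable {D : Type*} [Finite D] {M : DoodleDiagram D}

namespace Cell

theorem IsFaceOf.refl (c : M.Cell) : c.IsFaceOf c := by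
  refine ⟨le_rfl, ?_⟩
  rw [inter_self]
  cases c with
  | vertex v => exact M.vertexOf_surjective v
  | edge e => exact M.edgeOf_surjective e
  | region F => exact M.regionOf_surjective F

theorem IsFaceOf.eq_of_dim_eq {c c' : M.Cell} (h : c.IsFaceOf c') (hd : c.dim = c'.dim) :
    c = c' := by
  obtain ⟨-, d, hc, hc'⟩ := h
  cases c <;> cases c' <;> cases hd <;> cases hc <;> cases hc' <;> rfl

theorem IsFaceOf.trans {c c' c'' : M.Cell} (h : c.IsFaceOf c') (h' : c'.IsFaceOf c'') :
    c.IsFaceOf c'' := by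
  by_cases hdim : c.dim = c'.dim
  · exact h.eq_of_dim_eq hdim ▸ h'
  by_cases hdim' : c'.dim = c''.dim
  · exact h'.eq_of_dim_eq hdim' ▸ h
  refine ⟨h.1.trans h'.1, ?_⟩
  have hlt := h.1.lt_of_ne hdim
  have hlt' := h'.1.lt_of_ne hdim'
  obtain ⟨-, d, hv, he⟩ := h
  obtain ⟨-, d', he', hF⟩ := h'
  cases c <;> cases c' <;> cases c'' <;> simp only [dim] at hlt hlt' <;> try omega
  rcases M.edgeOf_eq_iff.1 (Eq.trans he (Eq.symm he')) with h | h <;> rw [h] at hF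
  · exact ⟨d, hv, hF⟩
  · exact ⟨M.rot d, Eq.trans (M.vertexOf_rot d) hv, Eq.trans (M.regionOf_rot d) hF⟩

end Cell

theorem vertex_isFaceOf_region_iff {v : M.Vertex} {F : M.Region} :
    (Cell.vertex v).IsFaceOf (Cell.region F) ↔ M.IsOn F v :=
  ⟨fun ⟨_, d, hv, hF⟩ => ⟨d, hF, hv⟩, fun ⟨d, hF, hv⟩ => ⟨Nat.zero_le _, d, hv, hF⟩⟩

theorem isOn_flagRegion (y : D × Bool) :
    M.IsOn (M.flagRegion y) (M.vertexOf y.1) ∧ M.IsOn (M.flagRegion y) (M.target y.1) := by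
  obtain ⟨d, _ | _⟩ := y
  · exact ⟨⟨M.rot d, M.regionOf_rot d, M.vertexOf_rot d⟩, isOn_vertexOf (M.rev d)⟩
  · exact ⟨isOn_vertexOf d, isOn_target d⟩

theorem touches_of_flagCell_eq {y z : D × Bool} {i : Fin 3} (h : M.flagCell y i = M.flagCell z i) :
    M.Touches (M.flagRegion y) (M.flagRegion z) := by
  fin_cases i
  · exact ⟨_, (isOn_flagRegion y).1, Cell.vertex.inj h ▸ (isOn_flagRegion z).1⟩
  · rcases M.edgeOf_eq_iff.1 (Cell.edge.inj h) with h | h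
    · exact ⟨_, (isOn_flagRegion y).1, h ▸ (isOn_flagRegion z).1⟩
    · exact ⟨_, (isOn_flagRegion y).2, by rw [target, ← h]; exact (isOn_flagRegion z).1⟩
  · exact Cell.region.inj h ▸ touches_self _

theorem flagCell_isFaceOf {i j : Fin 3} (hij : i ≤ j) (y : D × Bool) :
    (M.flagCell y i).IsFaceOf (M.flagCell y j) := by
  have hedge : (M.flagCell y 1).IsFaceOf (M.flagCell y 2) := by
    obtain ⟨d, _ | _⟩ := y
    · exact ⟨one_le_two, M.rev d, M.edgeOf_rev d, rfl⟩
    · exact ⟨one_le_two, d, rfl, rfl⟩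
  have hvertex : (M.flagCell y 0).IsFaceOf (M.flagCell y 1) := ⟨Nat.zero_le _, y.1, rfl, rfl⟩
  fin_cases i <;> fin_cases j <;>
    first
    | exact absurd hij (by decide)
    | exact .refl _
    | exact hedge
    | exact hvertex
    | exact hvertex.trans hedge

theorem exists_flagCell_eq_of_isFaceOf {v : M.Vertex} {e : M.Edge} {F : M.Region}
    (hv : (Cell.vertex v).IsFaceOf (Cell.edge e)) (he : (Cell.edge e).IsFaceOf (Cell.region F)) :
    ∃ y, M.flagCell y = ![.vertex v, .edge e, .region F] := by
  obtain ⟨-, d, rfl, rfl⟩ := hv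
  obtain ⟨-, d', hd', rfl⟩ := he
  rcases M.edgeOf_eq_iff.1 (Eq.symm hd') with rfl | rfl
  · exact ⟨(d', true), rfl⟩
  · exact ⟨(d, false), rfl⟩

theorem exists_flagCell_eq_of_chain {s : Set M.Cell} {F : M.Region}
    (hs : ∀ c c', c ∈ s → c' ∈ s → c.IsFaceOf c' ∨ c'.IsFaceOf c)
    (hF : ∀ c ∈ s, c.IsFaceOf (Cell.region F)) :
    ∃ y, M.flagRegion y = F ∧ ∀ c ∈ s, ∃ i, M.flagCell y i = c := by
  have heq (c c' : M.Cell) (hc : c ∈ s) (hc' : c' ∈ s) (hd : c.dim = c'.dim) : c = c' :=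
    (hs c c' hc hc').elim (fun h => h.eq_of_dim_eq hd) fun h => (h.eq_of_dim_eq hd.symm).symm
  suffices ∃ y, M.flagRegion y = F ∧ (∀ v, .vertex v ∈ s → M.flagCell y 0 = .vertex v) ∧
      ∀ e, .edge e ∈ s → M.flagCell y 1 = .edge e by
    obtain ⟨y, hy, hv, he⟩ := this
    refine ⟨y, hy, fun c hc => ?_⟩
    cases c with
    | vertex v => exact ⟨0, hv v hc⟩
    | edge e => exact ⟨1, he e hc⟩
    | region G => exact ⟨2, (congrArg _ hy).trans ((hF _ hc).eq_of_dim_eq rfl).symm⟩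
  by_cases he : ∃ e, .edge e ∈ s <;> by_cases hv : ∃ v, .vertex v ∈ s
  · obtain ⟨e, he⟩ := he
    obtain ⟨v, hv⟩ := hv
    have hve := (hs _ _ hv he).resolve_right fun h => Nat.not_succ_le_zero 0 h.1
    obtain ⟨y, hy⟩ := exists_flagCell_eq_of_isFaceOf hve (hF _ he)
    exact ⟨y, Cell.region.inj (congrFun hy 2),
      fun _ hv' => (congrFun hy 0).trans (heq _ _ hv hv' rfl),
      fun _ he' => (congrFun hy 1).trans (heq _ _ he he' rfl)⟩
  · obtain ⟨e, he⟩ := he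
    obtain ⟨-, d, rfl, rfl⟩ := hF _ he
    exact ⟨(d, true), rfl, fun v hv' => absurd ⟨v, hv'⟩ hv, fun _ he' => heq _ _ he he' rfl⟩
  · obtain ⟨v, hv⟩ := hv
    obtain ⟨-, d, rfl, rfl⟩ := hF _ hv
    exact ⟨(d, true), rfl, fun _ hv' => heq _ _ hv hv' rfl, fun e he' => absurd ⟨e, he'⟩ he⟩
  · obtain ⟨d, rfl⟩ := M.regionOf_surjective F
    exact ⟨(d, true), rfl, fun v hv' => absurd ⟨v, hv'⟩ hv, fun e he' => absurd ⟨e, he'⟩ he⟩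

theorem closedCell_subset {c c' : M.Cell} (h : c.IsFaceOf c') : M.closedCell c ⊆ M.closedCell c' :=
  fun _ hx => ⟨hx.1, fun c₀ hc₀ => (hx.2 c₀ hc₀).trans h⟩

theorem exists_flag_of_mem_closedCell {F : M.Region} {x : M.Cell → ℝ}
    (hx : x ∈ M.closedCell (Cell.region F)) :
    ∃ y, M.flagRegion y = F ∧ ∀ c, x c ≠ 0 → ∃ i, M.flagCell y i = c :=
  exists_flagCell_eq_of_chain (s := {c | x c ≠ 0}) hx.1.2 hx.2

theorem mem_closedCell_of_flag {y : D × Bool} {x : M.Cell → ℝ} (hx : x ∈ stdSimplex ℝ M.Cell)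
    (h : ∀ c, x c ≠ 0 → ∃ i, M.flagCell y i = c) :
    x ∈ M.closedCell (Cell.region (M.flagRegion y)) := by
  refine ⟨⟨hx, fun c c' hc hc' => ?_⟩, fun c hc => ?_⟩
  · obtain ⟨i, rfl⟩ := h c hc
    obtain ⟨j, rfl⟩ := h c' hc'
    exact (le_total i j).imp (flagCell_isFaceOf · y) (flagCell_isFaceOf · y)
  · obtain ⟨i, rfl⟩ := h c hc
    exact flagCell_isFaceOf (Fin.le_last i) y

theorem disjoint_closedCell_boundary {R F : M.Region} (h : ¬M.Touches R F) :
    Disjoint (M.closedCell (Cell.region F)) (M.boundary R) := by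
  rw [disjoint_left]
  rintro x hxF ⟨hxR, -⟩
  obtain ⟨c, hc⟩ := exists_ne_zero_of_mem_stdSimplex hxF.1.1
  obtain ⟨z, rfl, hz⟩ := exists_flag_of_mem_closedCell hxF
  obtain ⟨y, rfl, hy⟩ := exists_flag_of_mem_closedCell hxR
  obtain ⟨i, hi⟩ := hz c hc
  obtain ⟨j, hj⟩ := hy c hc
  obtain ⟨rfl, -⟩ := flagCell_inj.1 (hj.trans hi.symm)
  exact h (touches_of_flagCell_eq (hj.trans hi.symm))

theorem not_isOn_of_disjoint {R : M.Region} {c : M.Cell}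
    (h : Disjoint (M.closedCell c) (M.boundary R)) {v : M.Vertex}
    (hv : (Cell.vertex v).IsFaceOf c) : ¬M.IsOn R v := by
  classical
  intro hR
  let x : M.Cell → ℝ := Pi.single (Cell.vertex v) 1
  have hsupp (c' : M.Cell) (hc' : x c' ≠ 0) : c' = Cell.vertex v :=
    by_contra fun hne => hc' (Pi.single_eq_of_ne hne 1)
  have hsphere : x ∈ M.sphere := by
    refine ⟨single_mem_stdSimplex ℝ _, fun c₁ c₂ h₁ h₂ => Or.inl ?_⟩
    rw [hsupp _ h₁, hsupp _ h₂]
    exact .refl _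
  have hmem {c' : M.Cell} (hc' : (Cell.vertex v).IsFaceOf c') : x ∈ M.closedCell c' :=
    ⟨hsphere, fun c₀ hc₀ => hsupp c₀ hc₀ ▸ hc'⟩
  exact disjoint_left.1 h (hmem hv)
    ⟨hmem (vertex_isFaceOf_region_iff.2 hR), Pi.single_eq_of_ne (by simp) 1⟩

end Faces

section InnerComplement

variable {D : Type*} [Finite D] {M : DoodleDiagram D}

theorem IsSuperPrime.exists_region_of_disjoint (hM : M.IsSuperPrime) {R : M.Region} {c : M.Cell}
    (h : Disjoint (M.closedCell c) (M.boundary R)) :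
    ∃ F, ¬M.Touches R F ∧ c.IsFaceOf (Cell.region F) := by
  cases c with
  | vertex v =>
    obtain ⟨d, rfl, hd⟩ := hM.exists_not_touches (not_isOn_of_disjoint h (.refl _))
    exact ⟨_, hd, vertex_isFaceOf_region_iff.2 (isOn_vertexOf d)⟩
  | edge e =>
    obtain ⟨d, rfl⟩ := M.edgeOf_surjective e
    have hstart := not_isOn_of_disjoint h (v := M.vertexOf d) ⟨Nat.zero_le _, d, rfl, rfl⟩
    have htarget := not_isOn_of_disjoint h (v := M.target d)
      ⟨Nat.zero_le _, M.rev d, rfl, M.edgeOf_rev d⟩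
    rcases hM.not_touches_of_edge hstart htarget with hd | hd
    · exact ⟨_, hd, one_le_two, d, rfl, rfl⟩
    · exact ⟨_, hd, one_le_two, M.rev d, M.edgeOf_rev d, rfl⟩
  | region F =>
    exact ⟨F, fun ⟨_, hR, hF⟩ => not_isOn_of_disjoint h (vertex_isFaceOf_region_iff.2 hF) hR,
      .refl _⟩

end InnerComplement

section FlagsOf

variable {D : Type*} [Fintype D] {M : DoodleDiagram D} [DecidableEq M.Cell]

theorem IsSuperPrime.innerComplement_eq (hM : M.IsSuperPrime) (R : M.Region) :
    M.innerComplement R =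
      realization (M.flagsOf fun F => ¬M.Touches R F : Set (Finset M.Cell)) := by
  ext x
  simp only [innerComplement, mem_iUnion, mem_ofPred_eq, exists_prop]
  constructor
  · rintro ⟨c, hc, hx⟩
    obtain ⟨F, hF, hcF⟩ := hM.exists_region_of_disjoint hc
    obtain ⟨y, rfl, hy⟩ := exists_flag_of_mem_closedCell (closedCell_subset hcF hx)
    exact ⟨hx.1.1, M.flag y, hM.flag_mem_flagsOf.2 hF, fun c hc => mem_flag.2 (hy c hc)⟩
  · rintro ⟨hx, t, ht, hxt⟩
    obtain ⟨y, rfl⟩ := mem_flags.1 (flagsOf_subset ht)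
    exact ⟨_, disjoint_closedCell_boundary (hM.flag_mem_flagsOf.1 ht),
      mem_closedCell_of_flag hx fun c hc => mem_flag.1 (hxt c hc)⟩

theorem IsSuperPrime.stronglyConnected_flagsOf (hM : M.IsSuperPrime) {N : M.Region → Prop}
    (hN : ∀ Q : M.Region → Prop,
      (∀ d, N (M.regionOf d) → N (M.regionOf (M.rev d)) →
        (Q (M.regionOf d) ↔ Q (M.regionOf (M.rev d)))) →
      ∀ F F', N F → N F' → (Q F ↔ Q F')) :
    StronglyConnected (M.flagsOf N) := by
  intro B hB
  have hadj (i : Fin 3) (y : D × Bool) (hy : N (M.flagRegion y))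
      (hy' : N (M.flagRegion (M.flagAdj i y))) : M.flag (M.flagAdj i y) ∈ B ↔ M.flag y ∈ B := by
    have hmem := hM.flag_mem_flagsOf.2 hy
    have hmem' := hM.flag_mem_flagsOf.2 hy'
    have hface : M.face i y ∈ triangleEdges (M.flag y) := mem_triangleEdges_flag.2 ⟨i, rfl⟩
    have hface' : M.face i y ∈ triangleEdges (M.flag (M.flagAdj i y)) :=
      mem_triangleEdges_flag.2 ⟨i, face_flagAdj i y⟩
    exact ⟨hB _ hmem' _ hmem _ hface' hface, hB _ hmem _ hmem' _ hface hface'⟩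
  have hregion {y z : D × Bool} (h : M.flagRegion y = M.flagRegion z) (hy : N (M.flagRegion y))
      (hyB : M.flag y ∈ B) : M.flag z ∈ B := by
    refine ((eq_of_flagCell_eq (M := M) (i := 2) (b := fun x => N (M.flagRegion x) ∧ M.flag x ∈ B)
      (fun j hj x => ?_) (congrArg Cell.region h)).mp ⟨hy, hyB⟩).2
    have hx : M.flagRegion (M.flagAdj j x) = M.flagRegion x :=
      Cell.region.inj (flagCell_flagAdj (M := M) hj.symm x)
    exact propext (by rw [hx]; exact and_congr_right fun hN => hadj j x hN (hx.symm ▸ hN))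
  let Q (F : M.Region) : Prop := ∃ y, M.flagRegion y = F ∧ M.flag y ∈ B
  have hQ {y : D × Bool} (hy : N (M.flagRegion y)) : Q (M.flagRegion y) ↔ M.flag y ∈ B :=
    ⟨fun ⟨_, hz, hzB⟩ => hregion hz (hz ▸ hy) hzB, fun h => ⟨y, rfl, h⟩⟩
  have hQN := hN Q fun d hd hd' => (hQ (y := (d, true)) hd).trans
    ((hadj 2 (d, true) hd hd').symm.trans (hQ (y := (d, false)) hd').symm)
  rw [or_iff_not_imp_right, Finset.not_disjoint_iff]
  rintro ⟨t, ht, htB⟩ t' ht'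
  obtain ⟨y, rfl⟩ := mem_flags.1 (flagsOf_subset ht)
  obtain ⟨y', rfl⟩ := mem_flags.1 (flagsOf_subset ht')
  rw [hM.flag_mem_flagsOf] at ht ht'
  exact (hQ ht').1 ((hQN _ _ ht ht').1 ((hQ ht).2 htB))

theorem IsSuperPrime.flags_sdiff_flagsOf (hM : M.IsSuperPrime) (N : M.Region → Prop) :
    M.flags \ M.flagsOf (fun F => ¬N F) = M.flagsOf N := by
  ext t
  rw [Finset.mem_sdiff]
  constructor
  · rintro ⟨h, h'⟩
    obtain ⟨y, rfl⟩ := mem_flags.1 h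
    rw [hM.flag_mem_flagsOf, not_not] at h'
    exact hM.flag_mem_flagsOf.2 h'
  · intro h
    obtain ⟨y, rfl⟩ := mem_flags.1 (flagsOf_subset h)
    rw [hM.flag_mem_flagsOf, not_not]
    exact ⟨flagsOf_subset h, hM.flag_mem_flagsOf.1 h⟩

end FlagsOf

theorem IsSuperPrime.exists_isDisk_innerComplement {D : Type*} [Finite D] {M : DoodleDiagram D}
    (hM : M.IsSuperPrime) (R : M.Region) : ∃ S, IsDisk (M.innerComplement R) S := by
  classical
  have := Fintype.ofFinite D
  rw [hM.innerComplement_eq R]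
  refine hM.isSphereTriangulation.exists_isDisk flagsOf_subset ?_ (fun h => ?_) ?_ ?_
  · obtain ⟨v, hv⟩ := hM.exists_not_isOn R
    obtain ⟨d, -, hd⟩ := hM.exists_not_touches hv
    exact ⟨M.flag (d, true), hM.flag_mem_flagsOf.2 hd⟩
  · obtain ⟨d, rfl⟩ := M.regionOf_surjective R
    have hd : M.flag (d, true) ∈ M.flags := mem_flags.2 ⟨_, rfl⟩
    rw [← h, hM.flag_mem_flagsOf] at hd
    exact hd (touches_self _)
  · exact hM.stronglyConnected_flagsOf fun Q hQ F F' => hM.iff_of_not_touches hQ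
  · rw [hM.flags_sdiff_flagsOf]
    exact hM.stronglyConnected_flagsOf fun Q hQ F F' hF hF' =>
      (iff_of_touches hQ hF).trans (iff_of_touches hQ hF').symm

end DoodleDiagram

theorem theorem4p4 {D : Type*} [Finite D] (M : DoodleDiagram D) (hM : M.IsSuperPrime)
    (R : M.Region) :
    Nonempty (M.innerComplement R ≃ₜ
      Metric.closedBall (0 : EuclideanSpace ℝ (Fin 2)) 1) := by
  obtain ⟨S, hS⟩ := hM.exists_isDisk_innerComplement R
  exact hS.nonempty_homeomorph
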